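/- Let $n\ge 3$. The burnt pancake graph $BP_n$ has as vertices the $2^n\,n!$ signed permutations $u=u_1u_2\cdots u_n$ of $\{1,\dots,n\}$ (words with $u_i\in\{\pm1,\dots,\pm n\}$ such that $|u_1|\cdots|u_n|$ is a permutation of $\{1,\dots,n\}$; write $\bar u_i=-u_i$). Two vertices $u,v$ are adjacent if and only if $v$ is the $k$-th prefix-reversal $\bar u_k\bar u_{k-1}\cdots\bar u_1u_{k+1}\cdots u_n$ of $u$ for some $1\le k\le n$. A hybrid fault set of a graph $G$ is $F=F^{mv}\cup F^{e}$, where $F^{mv}$ is a (possibly empty) set of pairs $\{a,b\}$ that are the pairs of end-vertices of the edges of a matching of $G$ (a set of pairwise disjoint edges), and $F^{e}$ is a (possibly empty) set of edges of $G-F^{mv}$, where $G-F^{mv}$ is $G$ with all vertices occurring in the pairs of $F^{mv}$ deleted. Put $|F|=|F^{mv}|+|F^{e}|$, and let $G-F$ be $G-F^{mv}$ with the edges in $F^{e}$ deleted. Call $G$ $k$-hybrid fault Hamiltonian (respectively $k$-hybrid fault Hamiltonian connected) if for every hybrid fault set $F$ of $G$ with $|F|\le k$ the graph $G-F$ has a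 Hamiltonian cycle (respectively, has a Hamiltonian path between any two distinct vertices). Then: 1. $BP_n$ is $(n-2)$-hybrid fault Hamiltonian. 2. $BP_n$ is $(n-3)$-hybrid fault Hamiltonian connected. 3. Both bounds are tight: $BP_n$ is not $(n-1)$-hybrid fault Hamiltonian and not $(n-2)$-hybrid fault Hamiltonian connected. More precisely, for every vertex $u$ of $BP_n$: if $F$ is any set of $n-1$ edges incident to $u$, then $BP_n-F$ has no Hamiltonian cycle; and if $F$ is any set of $n-2$ edges incident to $u$, then $BP_n-F$ is not Hamiltonian-connected. -/

import Mathlib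

/-! ### Signed permutations and the burnt pancake graph -/

/-- A symbol of `[n]`: a number of `⟨n⟩` (here `Fin n`) together with a flag telling whether it
is barred. -/
abbrev SignedSymbol (n : ℕ) : Type := Fin n × Bool

/-- The bar operation `i ↦ ī`, `ī ↦ i`. -/
def SignedSymbol.bar {n : ℕ} (s : SignedSymbol n) : SignedSymbol n := (s.1, !s.2)

/-- A signed permutation of `⟨n⟩`: a word `u₁ u₂ … uₙ` of symbols whose absolute values
`|u₁| |u₂| … |uₙ|` are pairwise distinct, hence form a permutation of `⟨n⟩`. -/
abbrev SignedPermutation (n : ℕ) : Type :=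
  {u : Fin n → SignedSymbol n // Function.Injective fun i => (u i).1}

namespace SignedPermutation

/-- The word obtained from `u` by reversing and barring the positions `0, …, k`. With positions
counted from `0`, this is the prefix-reversal of length `k + 1`. -/
def prefixReversalWord {n : ℕ} (k : Fin n) (u : Fin n → SignedSymbol n) (i : Fin n) :
    SignedSymbol n :=
  if i ≤ k then (u ⟨k.1 - i.1, lt_of_le_of_lt (Nat.sub_le _ _) k.2⟩).bar else u i

/-- The prefix-reversal of length `k + 1` of a signed permutation:
`ū_{k+1} ū_k … ū_1 u_{k+2} … u_n` (in one-based notation). -/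
def prefixReversal {n : ℕ} (k : Fin n) (u : SignedPermutation n) : SignedPermutation n :=
  ⟨prefixReversalWord k u.1, by
    intro i j h
    have hu := u.2
    by_cases hi : i ≤ k <;> by_cases hj : j ≤ k
    · simp only [prefixReversalWord, hi, hj, if_true, SignedSymbol.bar] at h
      have h' := congrArg Fin.val (hu h)
      simp only at h'
      ext
      rw [Fin.le_def] at hi hj
      omega
    · simp only [prefixReversalWord, hi, hj, if_true, if_false, SignedSymbol.bar] at h
      have h' := congrArg Fin.val (hu h)
      simp only at h'
      rw [Fin.le_def] at hi hj
      omega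
    · simp only [prefixReversalWord, hi, hj, if_true, if_false, SignedSymbol.bar] at h
      have h' := congrArg Fin.val (hu h)
      simp only at h'
      rw [Fin.le_def] at hi hj
      omega
    · simp only [prefixReversalWord, hi, hj, if_false] at h
      exact hu h⟩

theorem prefixReversal_prefixReversal {n : ℕ} (k : Fin n) (u : SignedPermutation n) :
    prefixReversal k (prefixReversal k u) = u := by
  apply Subtype.ext
  funext i
  by_cases hi : i ≤ k
  · have h1 : (⟨k.1 - i.1, lt_of_le_of_lt (Nat.sub_le _ _) k.2⟩ : Fin n) ≤ k := by
      rw [Fin.le_def]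
      exact Nat.sub_le _ _
    have h2 : k.1 - (k.1 - i.1) = i.1 := by
      rw [Fin.le_def] at hi
      omega
    simp [prefixReversal, prefixReversalWord, hi, h1, h2, SignedSymbol.bar]
  · simp [prefixReversal, prefixReversalWord, hi]

theorem prefixReversal_ne {n : ℕ} (k : Fin n) (u : SignedPermutation n) :
    prefixReversal k u ≠ u := by
  intro h
  have hk : (prefixReversal k u).1 k = u.1 k := by rw [h]
  have h0 : (prefixReversal k u).1 k = (u.1 ⟨0, lt_of_le_of_lt (Nat.zero_le _) k.2⟩).bar := by
    simp [prefixReversal, prefixReversalWord]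
  rw [h0] at hk
  have h1 : (⟨0, lt_of_le_of_lt (Nat.zero_le _) k.2⟩ : Fin n) = k :=
    u.2 (show (u.1 ⟨0, lt_of_le_of_lt (Nat.zero_le _) k.2⟩).bar.1 = (u.1 k).1 from
      congrArg Prod.fst hk)
  rw [h1] at hk
  have h2 := congrArg Prod.snd hk
  simp [SignedSymbol.bar] at h2

end SignedPermutation

/-- The `n`-dimensional burnt pancake graph `BP_n`: its vertices are the signed permutations of
`⟨n⟩`, and `u`, `v` are adjacent iff `v` is a prefix-reversal of `u`. -/
def burntPancake (n : ℕ) : SimpleGraph (SignedPermutation n) where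
  Adj u v := ∃ k : Fin n, v = SignedPermutation.prefixReversal k u
  symm := ⟨by
    rintro u v ⟨k, rfl⟩
    exact ⟨k, (SignedPermutation.prefixReversal_prefixReversal k u).symm⟩⟩
  loopless := ⟨by
    rintro u ⟨k, h⟩
    exact SignedPermutation.prefixReversal_ne k u h.symm⟩

/-! ### Hybrid faults -/

namespace HybridFault

variable {V : Type*}

/-- A graph is Hamiltonian-connected if every two distinct vertices are joined by a Hamiltonian
path. -/
def IsHamiltonianConnected [DecidableEq V] (G : SimpleGraph V) : Prop :=
  ∀ u v : V, u ≠ v → ∃ p : G.Walk u v, p.IsHamiltonian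

/-- `M` is a set of edges of `G` no two of which share an end-vertex. -/
def IsMatchingEdgeSet (G : SimpleGraph V) (M : Finset (Sym2 V)) : Prop :=
  (∀ e ∈ M, e ∈ G.edgeSet) ∧ ∀ e ∈ M, ∀ f ∈ M, e ≠ f → ∀ v, v ∈ e → v ∉ f

/-- The fault-free vertices: those lying in none of the faulty pairs of `Fmv`. -/
def faultFree (Fmv : Finset (Sym2 V)) : Set V := {v | ∀ e ∈ Fmv, v ∉ e}

instance faultFree.decidableMem [DecidableEq V] (Fmv : Finset (Sym2 V)) :
    DecidablePred (· ∈ faultFree Fmv) :=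
  fun v => inferInstanceAs (Decidable (∀ e ∈ Fmv, v ∉ e))

/-- `G - F` for `F = Fmv ∪ Fe`: delete the edges in `Fe` and all the vertices that occur in the
pairs in `Fmv`. -/
def remove (G : SimpleGraph V) (Fmv Fe : Finset (Sym2 V)) : SimpleGraph (faultFree Fmv) :=
  (G.deleteEdges (Fe : Set (Sym2 V))).induce (faultFree Fmv)

/-- `F = Fmv ∪ Fe` is a hybrid fault set of `G`: `Fmv` consists of the pairs of end-vertices of
the edges of a matching of `G`, and `Fe` consists of edges of `G - Fmv`. -/
structure IsFaultSet (G : SimpleGraph V) (Fmv Fe : Finset (Sym2 V)) : Prop where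
  matching : IsMatchingEdgeSet G Fmv
  edges : ∀ e ∈ Fe, e ∈ G.edgeSet ∧ ∀ v ∈ e, v ∈ faultFree Fmv

/-- `G` is `k`-hybrid fault Hamiltonian: `G - F` has a Hamiltonian cycle for every hybrid fault
set `F = Fmv ∪ Fe` with `|F| = |Fmv| + |Fe| ≤ k`. -/
def IsFaultHamiltonian [Fintype V] [DecidableEq V] (G : SimpleGraph V) (k : ℕ) : Prop :=
  ∀ Fmv Fe : Finset (Sym2 V), IsFaultSet G Fmv Fe → Fmv.card + Fe.card ≤ k →
    (remove G Fmv Fe).IsHamiltonian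

/-- `G` is `k`-hybrid fault Hamiltonian connected: `G - F` is Hamiltonian-connected for every
hybrid fault set `F = Fmv ∪ Fe` with `|F| = |Fmv| + |Fe| ≤ k`. -/
def IsFaultHamiltonianConnected [DecidableEq V] (G : SimpleGraph V) (k : ℕ) : Prop :=
  ∀ Fmv Fe : Finset (Sym2 V), IsFaultSet G Fmv Fe → Fmv.card + Fe.card ≤ k →
    IsHamiltonianConnected (remove G Fmv Fe)

end HybridFault

/-!
The positive parts are proved together by induction on the dimension. In the burnt pancake graph of
dimension `m + 1`, the signed permutations with a given last symbol induce a copy of the graph of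
dimension `m`, and there are `2 * m + 2` such copies. The only edge at a vertex that leaves its copy
leads to its `mate`, the reversal of the whole word. Two copies are joined by `linkCount m` edges,
unless their last symbols are bars of each other, in which case there are none. A pair of faulty
mates leaves a single faulty vertex in each of two copies; therefore the induction is about lists of
faults that may also be single vertices (`PathTolerant`, `CycleTolerant`).

By induction, a copy hit by at most `m - 3` faults is Hamiltonian-connected (`PathTolerant.good`),
and a copy hit by at most `m - 2` faults has a spanning cycle (`CycleTolerant.hamCycle`). Since a
fault hits at most two copies (`sum_hitCount_le`), there are few copies of the second kind or worse.
Good copies are strung together along a `Route`, a path in the graph of all copies, which is nearly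
complete; this gives `hamPath_region`. A copy with a spanning cycle is inserted by opening the cycle
at an edge whose ends have mates in good copies (`hamPath_insert`); such an edge exists because
exposed vertices are rare compared with `linkCount m`. That the four or more vertices at which paths
leave bad copies lead to different copies is a matter of comparing first letters of words:
`cls_ne_of_adj`, `cls_fst_ne_of_adj_adj`, `cls_ne_cls_across`, `cls_ne_of_contains`.

A copy may be hit by all the `m - 1` faults when a cycle is sought, so that the induction hypothesis
does not apply to it. One fault is then restored, and a spanning cycle of the restored copy falls
into one or two paths when the fault is removed again; these are joined through the other copies
(`exists_path_of_restored`, `OneBad.hamCycle_of_pair`, `hamCycle_of_hits_both`).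

In dimension four, the eight copies are too few for the insertion of two or more bad copies. There,
a bad copy is dimension three with one missing vertex, and it is a bridge: it has spanning paths
whose ends lead to any two prescribed copies with which it is linked (`IsBridge`,
`isBridge_of_missing`). Bridges can be placed between consecutive good copies
(`hamPath_two_bridges`, `hamCycle_of_four_bridges`). The facts about dimension three that are needed
for this, and the start of the induction, are read off explicit walks that the kernel verifies
(`isSpanning`).

Tightness is a matter of degrees: a vertex with one remaining edge is on no cycle
(`not_isHamiltonian`), and a Hamiltonian path between the two remaining neighbours of a vertex
cannot pass through this vertex and any further one (`not_isHamiltonianConnected`).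
-/

namespace BurntPancake

open SimpleGraph SignedPermutation

/-! ### Spanning paths and cycles of vertex sets -/

section HamPath

variable {V : Type*} {A A' : SimpleGraph V} {X Y : Set V} {x y a b : V}

/-- `HamPath A X x y`: the graph `A` has a path from `x` to `y` whose set of vertices is exactly
`X`. -/
def HamPath (A : SimpleGraph V) (X : Set V) (x y : V) : Prop :=
  ∃ p : A.Walk x y, p.IsPath ∧ ∀ v, v ∈ p.support ↔ v ∈ X

theorem HamPath.single (x : V) : HamPath A {x} x x :=
  ⟨.nil, by simp, by simp⟩

theorem HamPath.cons (h : A.Adj a x) (ha : a ∉ X) (hp : HamPath A X x y) :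
    HamPath A (insert a X) a y := by
  obtain ⟨p, hp, hX⟩ := hp
  refine ⟨.cons h p, ?_, fun v => by simp [hX]⟩
  rw [Walk.cons_isPath_iff, hX]
  exact ⟨hp, ha⟩

/-- A spanning path is built by prepending vertices to a path of length zero. -/
@[elab_as_elim]
theorem HamPath.induction {P : ∀ X x y, HamPath A X x y → Prop}
    (single : ∀ x, P {x} x x (.single x))
    (cons : ∀ X x z y (hxz : A.Adj x z) (hx : x ∉ X) (hq : HamPath A X z y), P X z y hq →
      P (insert x X) x y (hq.cons hxz hx))
    {X : Set V} {x y : V} (h : HamPath A X x y) : P X x y h := by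
  have h' := h
  obtain ⟨p, hp, hX⟩ := h'
  induction p generalizing X with
  | @nil u =>
    have : X = {u} := by ext v; simpa using (hX v).symm
    subst this
    exact single _
  | @cons u v w huv q ih =>
    rw [Walk.cons_isPath_iff] at hp
    have hu : X = insert u {v | v ∈ q.support} := by
      ext z
      rw [← hX z]
      simp
    subst hu
    have hq : HamPath A {v | v ∈ q.support} v w := ⟨q, hp.1, fun _ => Iff.rfl⟩
    exact cons _ _ _ _ huv hp.2 hq (ih hq hp.1 fun _ => Iff.rfl)

theorem HamPath.eq_singleton (h : HamPath A X x x) : X = {x} := by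
  obtain ⟨p, hp, hX⟩ := h
  rw [Walk.isPath_iff_nil, Walk.nil_iff_support_eq] at hp
  ext v
  simpa [hp] using (hX v).symm

theorem HamPath.symm (h : HamPath A X x y) : HamPath A X y x := by
  obtain ⟨p, hp, hX⟩ := h
  exact ⟨p.reverse, hp.reverse, by simpa using hX⟩

theorem HamPath.left_mem (h : HamPath A X x y) : x ∈ X := by
  obtain ⟨p, -, hX⟩ := h
  exact (hX x).1 p.start_mem_support

theorem HamPath.right_mem (h : HamPath A X x y) : y ∈ X := h.symm.left_mem

theorem HamPath.congr (h : HamPath A X x y) (e : X = Y) : HamPath A Y x y := e ▸ h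

theorem HamPath.trans (h : HamPath A X x a) (hab : A.Adj a b) (h' : HamPath A Y b y)
    (hd : Disjoint X Y) : HamPath A (X ∪ Y) x y := by
  induction h using HamPath.induction with
  | single x => exact h'.cons hab (by simpa using hd)
  | cons X x z a hxz hx _ ih =>
    rw [Set.disjoint_insert_left] at hd
    rw [Set.insert_union]
    exact (ih hab hd.2).cons hxz (by simp [hx, hd.1])

theorem HamPath.map {W : Type*} {B : SimpleGraph W} {X : Set W} {x y : W} {f : W → V}
    (hf : Function.Injective f) (hadj : ∀ u v, B.Adj u v → A.Adj (f u) (f v))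
    (h : HamPath B X x y) : HamPath A (f '' X) (f x) (f y) := by
  induction h using HamPath.induction with
  | single x => simpa using HamPath.single _
  | cons X x z y hxz hx _ ih =>
    rw [Set.image_insert_eq]
    exact ih.cons (hadj _ _ hxz) (by rintro ⟨w, hw, he⟩; exact hx (hf he ▸ hw))

theorem HamPath.mono (h : HamPath A X x y)
    (hA : ∀ u ∈ X, ∀ v ∈ X, A.Adj u v → A'.Adj u v) : HamPath A' X x y := by
  induction h using HamPath.induction with
  | single x => exact .single _
  | cons X x z y hxz hx hq ih =>
    exact (ih fun u hu v hv => hA u (by simp [hu]) v (by simp [hv])).cons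
      (hA _ (by simp) _ (by simp [hq.left_mem]) hxz) hx

/-- A spanning path can be cut just before any of its vertices but the first. -/
theorem HamPath.split_before (h : HamPath A X x y) {u : V} (hu : u ∈ X) (hux : u ≠ x) :
    ∃ w X₁ X₂, X = X₁ ∪ X₂ ∧ Disjoint X₁ X₂ ∧ HamPath A X₁ x w ∧ A.Adj w u ∧
      HamPath A X₂ u y := by
  induction h using HamPath.induction with
  | single x => simp at hu; contradiction
  | cons X x z y hxz hx hq ih =>
    by_cases huz : u = z
    · subst huz
      exact ⟨x, {x}, X, by simp, by simpa using hx, .single _, hxz, hq⟩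
    · obtain ⟨w, X₁, X₂, rfl, hd, h1, hw, h2⟩ := ih (by simpa [hux] using hu) huz
      simp only [Set.mem_union, not_or] at hx
      refine ⟨w, insert x X₁, X₂, by rw [Set.insert_union], ?_, h1.cons hxz hx.1, hw, h2⟩
      rw [Set.disjoint_insert_left]
      exact ⟨hx.2, hd⟩

/-- A spanning path can be cut just after any of its vertices but the last. -/
theorem HamPath.split_after (h : HamPath A X x y) {u : V} (hu : u ∈ X) (huy : u ≠ y) :
    ∃ w X₁ X₂, X = X₁ ∪ X₂ ∧ Disjoint X₁ X₂ ∧ HamPath A X₁ x u ∧ A.Adj u w ∧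
      HamPath A X₂ w y := by
  obtain ⟨w, X₁, X₂, rfl, hd, h1, hw, h2⟩ := h.symm.split_before hu huy
  exact ⟨w, X₂, X₁, Set.union_comm _ _, hd.symm, h2.symm, hw.symm, h1.symm⟩

/-- Removing an inner vertex of a spanning path leaves two spanning paths. -/
theorem HamPath.remove_vertex (h : HamPath A X x y) {u : V} (hu : u ∈ X) (hux : u ≠ x)
    (huy : u ≠ y) : ∃ g k X₁ X₂, X \ {u} = X₁ ∪ X₂ ∧ Disjoint X₁ X₂ ∧ HamPath A X₁ x g ∧
      A.Adj g u ∧ A.Adj u k ∧ HamPath A X₂ k y := by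
  obtain ⟨g, X₁, X₂, rfl, hd, h1, hg, h2⟩ := h.split_before hu hux
  obtain ⟨k, Y₁, Y₂, rfl, hd', h3, hk, h4⟩ := h2.split_after h2.left_mem huy
  -- the first part of the second path is a path from `u` to `u`
  obtain rfl := h3.eq_singleton
  refine ⟨g, k, X₁, Y₂, ?_, hd.mono_right (by simp), h1, hg, hk, h4⟩
  rw [Set.disjoint_union_right, Set.disjoint_singleton_right] at hd
  rw [Set.disjoint_singleton_left] at hd'
  ext v
  simp only [Set.mem_sdiff, Set.mem_union, Set.mem_singleton_iff]
  constructor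
  · tauto
  · rintro (hv | hv)
    · exact ⟨.inl hv, fun e => hd.1 (e ▸ hv)⟩
    · exact ⟨.inr (.inr hv), fun e => hd' (e ▸ hv)⟩

/-- A spanning path has an edge avoiding `B`, or at least every other of its vertices lies in `B`.
The second bound, for paths that start in `B`, is the one the induction needs. -/
theorem HamPath.cut_or_card_le [Finite V] (h : HamPath A X x y) (B : Set V) :
    (∃ a b X₁ X₂, X = X₁ ∪ X₂ ∧ Disjoint X₁ X₂ ∧ HamPath A X₁ x a ∧ A.Adj a b ∧
      HamPath A X₂ b y ∧ a ∉ B ∧ b ∉ B) ∨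
    (X.ncard ≤ 2 * (X ∩ B).ncard + 1 ∧ (x ∈ B → X.ncard ≤ 2 * (X ∩ B).ncard)) := by
  induction h using HamPath.induction with
  | single x =>
    right
    refine ⟨by simp, fun hx => ?_⟩
    rw [Set.inter_eq_left.2 (by simpa using hx)]
    simp
  | cons X x z y hxz hx hq ih =>
    rcases ih with ⟨a, b, X₁, X₂, rfl, hd, h1, hab, h2, ha, hb⟩ | ⟨ih1, ih2⟩
    · simp only [Set.mem_union, not_or] at hx
      refine .inl ⟨a, b, insert x X₁, X₂, by rw [Set.insert_union], ?_, h1.cons hxz hx.1, hab, h2,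
        ha, hb⟩
      rw [Set.disjoint_insert_left]
      exact ⟨hx.2, hd⟩
    · rw [Set.ncard_insert_of_notMem hx]
      by_cases hxB : x ∈ B
      · right
        rw [Set.insert_inter_of_mem hxB, Set.ncard_insert_of_notMem (fun h => hx h.1)]
        omega
      · by_cases hzB : z ∈ B
        · right
          rw [Set.insert_inter_of_notMem hxB]
          have := ih2 hzB
          simp only [hxB, false_imp_iff, and_true]
          omega
        · exact .inl ⟨x, z, {x}, X, by simp, by simpa using hx, .single _, hxz, hq, hxB, hzB⟩

/-- A long spanning path has an edge both of whose ends avoid a given small set. -/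
theorem HamPath.exists_cut [Finite V] (h : HamPath A X x y) (B : Set V)
    (hB : 2 * (X ∩ B).ncard + 1 < X.ncard) :
    ∃ a b X₁ X₂, X = X₁ ∪ X₂ ∧ Disjoint X₁ X₂ ∧ HamPath A X₁ x a ∧ A.Adj a b ∧
      HamPath A X₂ b y ∧ a ∉ B ∧ b ∉ B := by
  rcases h.cut_or_card_le B with h | h
  · exact h
  · omega

/-- `HamCycle A X`: the graph `A` has a cycle whose set of vertices is exactly `X`. It is
presented as a spanning path of `X` with adjacent ends, on at least three vertices. -/
def HamCycle (A : SimpleGraph V) (X : Set V) : Prop :=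
  3 ≤ X.ncard ∧ ∃ a b, HamPath A X a b ∧ A.Adj b a

theorem HamCycle.congr (h : HamCycle A X) (e : X = Y) : HamCycle A Y := e ▸ h

theorem HamCycle.rotate (h : HamCycle A X) (hx : x ∈ X) : ∃ w, HamPath A X x w ∧ A.Adj w x := by
  obtain ⟨-, a, b, hp, hba⟩ := h
  by_cases hxa : x = a
  · subst hxa
    exact ⟨b, hp, hba⟩
  · obtain ⟨w, X₁, X₂, rfl, hd, h1, hw, h2⟩ := hp.split_before hx hxa
    exact ⟨w, (h2.trans hba h1 hd.symm).congr (Set.union_comm _ _), hw⟩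

/-- The two neighbours of a vertex on a spanning cycle: from that vertex, the cycle can be
traversed in both directions. -/
theorem HamCycle.exists_two (h : HamCycle A X) (hx : x ∈ X) :
    ∃ v w, v ≠ w ∧ A.Adj x v ∧ A.Adj x w ∧ HamPath A X x v ∧ HamPath A X x w := by
  obtain ⟨w, hp, hw⟩ := h.rotate hx
  have hxw : x ≠ w := fun e => A.irrefl (e ▸ hw)
  obtain ⟨v, X₁, X₂, rfl, hd, h1, hv, h2⟩ := hp.split_after hp.left_mem hxw
  obtain rfl := h1.eq_singleton
  refine ⟨v, w, ?_, hv, hw.symm, h1.trans hw.symm h2.symm hd, hp⟩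
  rintro rfl
  have h3 := h.1
  rw [h2.eq_singleton] at h3
  have := Set.ncard_union_le {x} {v}
  simp only [Set.ncard_singleton] at this
  omega

/-- Two vertices of a spanning cycle are the ends of two disjoint arcs that cover it. -/
theorem HamCycle.two_arcs (h : HamCycle A X) (hx : x ∈ X) (hy : y ∈ X) (hxy : y ≠ x) :
    ∃ u v X₁ X₂, X = X₁ ∪ X₂ ∧ Disjoint X₁ X₂ ∧ HamPath A X₁ x u ∧ HamPath A X₂ v y := by
  obtain ⟨w, hp, -⟩ := h.rotate hx
  obtain ⟨u, X₁, X₂, e, hd, h1, -, h2⟩ := hp.split_before hy hxy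
  exact ⟨u, w, X₁, X₂, e, hd, h1, h2.symm⟩

/-- A long spanning cycle has an edge both of whose ends avoid a given small set. -/
theorem HamCycle.exists_cut [Finite V] (h : HamCycle A X) (B : Set V)
    (hB : 2 * (X ∩ B).ncard < X.ncard) :
    ∃ a b, HamPath A X a b ∧ A.Adj a b ∧ a ∉ B ∧ b ∉ B := by
  obtain ⟨-, a, b, hp, hba⟩ := h
  rcases hp.cut_or_card_le B with ⟨u, v, X₁, X₂, rfl, hd, h1, huv, h2, hu, hv⟩ | h1
  · exact ⟨v, u, (h2.trans hba h1 hd.symm).congr (Set.union_comm _ _), huv.symm, hv, hu⟩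
  rcases hp.symm.cut_or_card_le B with ⟨u, v, X₁, X₂, rfl, hd, h1, huv, h2, hu, hv⟩ | h2
  · exact ⟨v, u, (h2.trans hba.symm h1 hd.symm).congr (Set.union_comm _ _), huv.symm, hv, hu⟩
  refine ⟨a, b, hp, hba.symm, fun ha => ?_, fun hb => ?_⟩
  · have := h1.2 ha
    omega
  · have := h2.2 hb
    omega

/-- Deleting one edge from a graph with a spanning cycle leaves a spanning path whose ends were
adjacent. -/
theorem HamCycle.delete_edge (h : HamCycle A X) (e : Sym2 V)
    (hA : ∀ u v, A.Adj u v → A'.Adj u v ∨ s(u, v) = e) :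
    ∃ a b, HamPath A' X a b ∧ A.Adj a b := by
  -- a path uses the deleted edge at most once, as it meets the first end of the edge only once
  have key : ∀ {X x y}, HamPath A X x y → HamPath A' X x y ∨ ∃ a b X₁ X₂, X = X₁ ∪ X₂ ∧
      Disjoint X₁ X₂ ∧ HamPath A' X₁ x a ∧ A.Adj a b ∧ s(a, b) = e ∧ HamPath A' X₂ b y := by
    intro X x y h
    induction h using HamPath.induction with
    | single x => exact .inl (.single x)
    | cons X x z y hxz hx hq ih =>
      rcases hA _ _ hxz with h' | he
      · rcases ih with ih | ⟨a, b, X₁, X₂, rfl, hd, h1, hab, he, h2⟩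
        · exact .inl (ih.cons h' hx)
        · simp only [Set.mem_union, not_or] at hx
          refine .inr ⟨a, b, insert x X₁, X₂, by rw [Set.insert_union], ?_, h1.cons h' hx.1, hab,
            he, h2⟩
          rw [Set.disjoint_insert_left]
          exact ⟨hx.2, hd⟩
      · refine .inr ⟨x, z, {x}, X, by simp, by simpa using hx, .single _, hxz, he, hq.mono ?_⟩
        intro u hu v hv huv
        refine (hA _ _ huv).resolve_right fun h' => hx ?_
        have : x ∈ s(u, v) := by rw [h', ← he]; simp
        rcases Sym2.mem_iff.1 this with rfl | rfl <;> assumption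
  obtain ⟨h3, a, b, hp, hba⟩ := h
  rcases key hp with hp | ⟨u, v, X₁, X₂, rfl, hd, h1, huv, he, h2⟩
  · exact ⟨a, b, hp, hba.symm⟩
  · rcases hA _ _ hba with hba | hba
    · exact ⟨v, u, (h2.trans hba h1 hd.symm).congr (Set.union_comm _ _), huv.symm⟩
    · -- the closing edge of the cycle and an inner edge of the path are not both the deleted edge
      exfalso
      have hne : ∀ {w z}, w ∈ X₁ → z ∈ X₂ → w ≠ z := fun hw hz e =>
        Set.disjoint_left.1 hd hw (e ▸ hz)
      rw [← he, Sym2.eq_iff] at hba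
      rcases hba with ⟨rfl, -⟩ | ⟨rfl, rfl⟩
      · exact hne h1.right_mem h2.right_mem rfl
      · rw [h1.eq_singleton, h2.eq_singleton] at h3
        have := Set.ncard_union_le {a} {b}
        simp only [Set.ncard_singleton] at this
        omega

/-- Deleting one vertex from a spanning cycle leaves a spanning path between two distinct
neighbours of that vertex. -/
theorem HamCycle.delete_vertex (h : HamCycle A X) (hx : x ∈ X) :
    ∃ g k, g ≠ k ∧ A.Adj x g ∧ A.Adj x k ∧ HamPath A (X \ {x}) g k := by
  obtain ⟨w, hp, hw⟩ := h.rotate hx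
  have hxw : x ≠ w := fun e => A.irrefl (e ▸ hw)
  obtain ⟨v, X₁, X₂, rfl, hd, h1, hv, h2⟩ := hp.split_after hp.left_mem hxw
  obtain rfl := h1.eq_singleton
  have h3 := h.1
  refine ⟨v, w, ?_, hv, hw.symm, h2.congr ?_⟩
  · rintro rfl
    rw [h2.eq_singleton] at h3
    have := Set.ncard_union_le {x} {v}
    simp only [Set.ncard_singleton] at this
    omega
  · rw [Set.disjoint_singleton_left] at hd
    ext u
    simp only [Set.mem_sdiff, Set.mem_union, Set.mem_singleton_iff]
    constructor
    · exact fun hu => ⟨.inr hu, fun e => hd (e ▸ hu)⟩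
    · tauto

end HamPath

/-! ### Words: copies, classes and mates -/

section Words

variable {n m : ℕ}

@[simp] theorem bar_bar (s : SignedSymbol n) : s.bar.bar = s := by simp [SignedSymbol.bar]

@[simp] theorem bar_fst (s : SignedSymbol n) : s.bar.1 = s.1 := rfl

theorem bar_ne (s : SignedSymbol n) : s.bar ≠ s := by
  intro h
  simpa [SignedSymbol.bar] using congrArg Prod.snd h

theorem bar_inj {s t : SignedSymbol n} : s.bar = t.bar ↔ s = t :=
  ⟨fun h => by rw [← bar_bar s, h, bar_bar], fun h => by rw [h]⟩

/-- Symbols with the same absolute value are equal or bars of each other. -/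
theorem fst_eq_iff {s t : SignedSymbol n} : s.1 = t.1 ↔ s = t ∨ s = t.bar := by
  obtain ⟨i, b⟩ := s
  obtain ⟨j, c⟩ := t
  cases b <;> cases c <;> simp [SignedSymbol.bar]

/-- The last symbol of a signed permutation. The signed permutations with a given last symbol
induce a copy of the burnt pancake graph of one dimension less. -/
def copy (v : SignedPermutation (m + 1)) : SignedSymbol (m + 1) := v.1 (Fin.last m)

/-- The reversal of the whole word: the only neighbour of `v` outside its copy. -/
def mate (v : SignedPermutation (m + 1)) : SignedPermutation (m + 1) :=
  prefixReversal (Fin.last m) v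

/-- The copy that contains the mate of `v`. -/
def cls (v : SignedPermutation (m + 1)) : SignedSymbol (m + 1) := copy (mate v)

/-- `x` is one of the letters of the word `v`. -/
def Contains (v : SignedPermutation n) (x : SignedSymbol n) : Prop := ∃ i, v.1 i = x

@[simp] theorem mate_mate (v : SignedPermutation (m + 1)) : mate (mate v) = v :=
  prefixReversal_prefixReversal _ _

theorem mate_inj {v w : SignedPermutation (m + 1)} : mate v = mate w ↔ v = w :=
  ⟨fun h => by rw [← mate_mate v, h, mate_mate], fun h => by rw [h]⟩

theorem mate_eq_comm {v w : SignedPermutation (m + 1)} : mate v = w ↔ v = mate w := by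
  rw [← mate_inj, mate_mate]

theorem copy_mate (v : SignedPermutation (m + 1)) : copy (mate v) = cls v := rfl

@[simp] theorem cls_mate (v : SignedPermutation (m + 1)) : cls (mate v) = copy v := by
  rw [cls, mate_mate]

theorem adj_mate (v : SignedPermutation (m + 1)) : (burntPancake (m + 1)).Adj v (mate v) :=
  ⟨Fin.last m, rfl⟩

theorem mate_apply (v : SignedPermutation (m + 1)) (i : Fin (m + 1)) :
    (mate v).1 i = (v.1 i.rev).bar := by
  have : i ≤ Fin.last m := Fin.le_last i
  simp only [mate, prefixReversal, prefixReversalWord, this, if_true]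
  have h : (⟨(Fin.last m).1 - i.1, lt_of_le_of_lt (Nat.sub_le _ _) (Fin.last m).2⟩ :
      Fin (m + 1)) = i.rev := by
    ext
    simp [Fin.rev]
  rw [h]

theorem cls_eq (v : SignedPermutation (m + 1)) : cls v = (v.1 0).bar := by
  simp [cls, copy, mate_apply]

theorem copy_prefixReversal (k : Fin m) (v : SignedPermutation (m + 1)) :
    copy (prefixReversal k.castSucc v) = copy v := by
  have : ¬ Fin.last m ≤ k.castSucc := by simp [Fin.le_def]
  simp [copy, prefixReversal, prefixReversalWord, this]

theorem cls_prefixReversal (k : Fin m) (v : SignedPermutation (m + 1)) :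
    cls (prefixReversal k.castSucc v) = v.1 k.castSucc := by
  rw [cls_eq]
  simp only [prefixReversal, prefixReversalWord, Fin.zero_le, if_true, bar_bar]
  congr 1

theorem adj_cases {v w : SignedPermutation (m + 1)} (h : (burntPancake (m + 1)).Adj v w) :
    w = mate v ∨ ∃ k : Fin m, w = prefixReversal k.castSucc v := by
  obtain ⟨k, rfl⟩ := h
  rcases Fin.eq_castSucc_or_eq_last k with ⟨k, rfl⟩ | rfl
  · exact .inr ⟨k, rfl⟩
  · exact .inl rfl

theorem letter_eq {v : SignedPermutation n} {i j : Fin n} (h : (v.1 i).1 = (v.1 j).1) : i = j :=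
  v.2 h

theorem cls_fst_ne (hm : 0 < m) (v : SignedPermutation (m + 1)) : (cls v).1 ≠ (copy v).1 := by
  rw [cls_eq, bar_fst]
  intro h
  have := congrArg Fin.val (letter_eq h)
  simp at this
  omega

theorem cls_ne_copy (hm : 0 < m) (v : SignedPermutation (m + 1)) : cls v ≠ copy v :=
  fun h => cls_fst_ne hm v (by rw [h])

theorem cls_ne_bar_copy (hm : 0 < m) (v : SignedPermutation (m + 1)) : cls v ≠ (copy v).bar :=
  fun h => cls_fst_ne hm v (by rw [h, bar_fst])

/-- A neighbour in the same copy arises from a reversal of a proper prefix. -/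
theorem exists_of_adj (hm : 0 < m) {v w : SignedPermutation (m + 1)}
    (h : (burntPancake (m + 1)).Adj v w) (hc : copy w = copy v) :
    ∃ k : Fin m, w = prefixReversal k.castSucc v := by
  rcases adj_cases h with rfl | h
  · exact absurd hc (cls_ne_copy hm v)
  · exact h

theorem eq_mate_of_adj {v w : SignedPermutation (m + 1)}
    (h : (burntPancake (m + 1)).Adj v w) (hc : copy w ≠ copy v) : w = mate v := by
  rcases adj_cases h with h | ⟨k, rfl⟩
  · exact h
  · exact absurd (copy_prefixReversal k v) hc

/-- Adjacent vertices of a copy have mates in different copies. -/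
theorem cls_ne_of_adj (hm : 0 < m) {v w : SignedPermutation (m + 1)}
    (h : (burntPancake (m + 1)).Adj v w) (hc : copy w = copy v) : cls v ≠ cls w := by
  obtain ⟨k, rfl⟩ := exists_of_adj hm h hc
  rw [cls_prefixReversal, cls_eq]
  intro h
  have h0 : (0 : Fin (m + 1)) = k.castSucc := letter_eq (by rw [← h, bar_fst])
  rw [← h0] at h
  exact bar_ne _ h

/-- The mates of two neighbours of a vertex in its copy do not lie in the copies of a symbol and
its bar. -/
theorem cls_fst_ne_of_adj_adj (hm : 0 < m) {u v w : SignedPermutation (m + 1)}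
    (hv : (burntPancake (m + 1)).Adj u v) (hw : (burntPancake (m + 1)).Adj u w)
    (hcv : copy v = copy u) (hcw : copy w = copy u) (hvw : v ≠ w) : (cls v).1 ≠ (cls w).1 := by
  obtain ⟨k, rfl⟩ := exists_of_adj hm hv hcv
  obtain ⟨l, rfl⟩ := exists_of_adj hm hw hcw
  rw [cls_prefixReversal, cls_prefixReversal]
  intro h
  exact hvw (by rw [letter_eq h])

theorem cls_ne_of_adj_adj (hm : 0 < m) {u v w : SignedPermutation (m + 1)}
    (hv : (burntPancake (m + 1)).Adj u v) (hw : (burntPancake (m + 1)).Adj u w)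
    (hcv : copy v = copy u) (hcw : copy w = copy u) (hvw : v ≠ w) : cls v ≠ cls w :=
  fun h => cls_fst_ne_of_adj_adj hm hv hw hcv hcw hvw (by rw [h])

theorem contains_mate {v : SignedPermutation (m + 1)} {x : SignedSymbol (m + 1)} :
    Contains (mate v) x ↔ Contains v x.bar := by
  constructor
  · rintro ⟨i, rfl⟩
    exact ⟨i.rev, by rw [mate_apply, bar_bar]⟩
  · rintro ⟨i, h⟩
    exact ⟨i.rev, by rw [mate_apply, Fin.rev_rev, h, bar_bar]⟩

/-- If the word `v` contains the bar of `r`, no neighbour of `v` in its copy has its mate in the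
copy `r`. -/
theorem cls_ne_of_contains (hm : 0 < m) {v w : SignedPermutation (m + 1)}
    {r : SignedSymbol (m + 1)} (hr : Contains v r.bar) (h : (burntPancake (m + 1)).Adj v w)
    (hc : copy w = copy v) : cls w ≠ r := by
  obtain ⟨k, rfl⟩ := exists_of_adj hm h hc
  rw [cls_prefixReversal]
  rintro rfl
  obtain ⟨i, hi⟩ := hr
  have := letter_eq (show (v.1 i).1 = (v.1 k.castSucc).1 by rw [hi, bar_fst])
  rw [this] at hi
  exact bar_ne _ hi.symm

/-- The mates of the neighbours of `f` in its copy and the mates of the neighbours of the mate of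
`f` in its copy lie in different copies. -/
theorem cls_ne_cls_across (hm : 0 < m) {f g k : SignedPermutation (m + 1)}
    (hg : (burntPancake (m + 1)).Adj f g) (hcg : copy g = copy f)
    (hk : (burntPancake (m + 1)).Adj (mate f) k) (hck : copy k = copy (mate f)) :
    cls g ≠ cls k := by
  obtain ⟨i, rfl⟩ := exists_of_adj hm hg hcg
  obtain ⟨j, rfl⟩ := exists_of_adj hm hk hck
  rw [cls_prefixReversal, cls_prefixReversal, mate_apply]
  intro h
  have := letter_eq (show (f.1 i.castSucc).1 = (f.1 j.castSucc.rev).1 by rw [h, bar_fst])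
  rw [← this] at h
  exact bar_ne _ h.symm

/-- A copy contains no triangle. -/
theorem no_triangle (hm : 0 < m) {a b c : SignedPermutation (m + 1)}
    (hab : (burntPancake (m + 1)).Adj a b) (hac : (burntPancake (m + 1)).Adj a c)
    (hcb : copy b = copy a) (hcc : copy c = copy a) :
    ¬ (burntPancake (m + 1)).Adj b c := by
  intro hbc
  obtain ⟨i, rfl⟩ := exists_of_adj hm hab hcb
  obtain ⟨j, rfl⟩ := exists_of_adj hm hac hcc
  obtain ⟨k, hk⟩ := exists_of_adj hm hbc (by rw [hcb, hcc])
  have e := congrArg cls hk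
  rw [cls_prefixReversal, cls_prefixReversal] at e
  -- the letter in position `k` after the first reversal is the letter in position `j`
  have hij : i ≠ j := by
    rintro rfl
    exact (burntPancake (m + 1)).irrefl hbc
  simp only [prefixReversal, prefixReversalWord] at e
  split_ifs at e with h
  · have h0 := congrArg Prod.fst e
    rw [bar_fst] at h0
    rw [← letter_eq h0] at e
    exact bar_ne _ e.symm
  · have h1 := letter_eq (congrArg Prod.fst e)
    rw [Fin.castSucc_inj] at h1
    subst h1
    -- so `j = k > i`, and the letters in position `j` of both sides differ
    have h2 := congrArg (fun v => v.1 j.castSucc) hk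
    simp only [prefixReversal, prefixReversalWord, le_refl, if_true] at h2
    have h3 : (⟨j.castSucc.1 - j.castSucc.1, lt_of_le_of_lt (Nat.sub_le _ _) j.castSucc.2⟩ :
        Fin (m + 1)) = 0 := by ext; simp
    simp only [h3, Fin.zero_le, if_true] at h2
    have h0 := congrArg Prod.fst h2
    simp only [bar_fst] at h0
    have h4 := letter_eq h0
    have h5 := congrArg Fin.val h4
    simp at h5
    rw [Fin.le_def] at h
    simp at h
    rw [← h4] at h2
    simp at h2
    exact bar_ne _ h2

end Words

/-! ### Symmetries, copies and counting -/

section Relabel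

variable {n : ℕ}

/-- The action on symbols of a permutation of the absolute values, followed by bars on a
prescribed set of absolute values. -/
def relabelSymbol (σ : Equiv.Perm (Fin n)) (β : Fin n → Bool) (s : SignedSymbol n) :
    SignedSymbol n := (σ s.1, xor s.2 (β s.1))

theorem relabelSymbol_bar (σ : Equiv.Perm (Fin n)) (β : Fin n → Bool) (s : SignedSymbol n) :
    relabelSymbol σ β s.bar = (relabelSymbol σ β s).bar := by
  simp [relabelSymbol, SignedSymbol.bar]

theorem relabelSymbol_injective (σ : Equiv.Perm (Fin n)) (β : Fin n → Bool) :
    Function.Injective (relabelSymbol σ β) := by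
  rintro ⟨i, b⟩ ⟨j, c⟩ h
  simp only [relabelSymbol, Prod.mk.injEq, EmbeddingLike.apply_eq_iff_eq] at h
  obtain ⟨rfl, h⟩ := h
  simpa using h

/-- The action of a relabelling of the symbols on signed permutations; it is an automorphism of
the burnt pancake graph. -/
def relabel (σ : Equiv.Perm (Fin n)) (β : Fin n → Bool) (v : SignedPermutation n) :
    SignedPermutation n :=
  ⟨fun i => relabelSymbol σ β (v.1 i), fun _ _ h => v.2 (σ.injective h)⟩

theorem relabel_injective (σ : Equiv.Perm (Fin n)) (β : Fin n → Bool) :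
    Function.Injective (relabel σ β) := by
  intro v w h
  ext1
  funext i
  exact relabelSymbol_injective σ β (congrFun (congrArg Subtype.val h) i)

theorem prefixReversal_relabel (σ : Equiv.Perm (Fin n)) (β : Fin n → Bool) (k : Fin n)
    (v : SignedPermutation n) :
    prefixReversal k (relabel σ β v) = relabel σ β (prefixReversal k v) := by
  ext1
  funext i
  simp only [prefixReversal, prefixReversalWord, relabel]
  split_ifs
  · rw [relabelSymbol_bar]
  · rfl

theorem relabel_adj (σ : Equiv.Perm (Fin n)) (β : Fin n → Bool) {v w : SignedPermutation n}
    (h : (burntPancake n).Adj v w) :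
    (burntPancake n).Adj (relabel σ β v) (relabel σ β w) := by
  obtain ⟨k, rfl⟩ := h
  exact ⟨k, (prefixReversal_relabel σ β k v).symm⟩

theorem copy_relabel {m : ℕ} (σ : Equiv.Perm (Fin (m + 1))) (β : Fin (m + 1) → Bool)
    (v : SignedPermutation (m + 1)) : copy (relabel σ β v) = relabelSymbol σ β (copy v) := rfl

theorem cls_relabel {m : ℕ} (σ : Equiv.Perm (Fin (m + 1))) (β : Fin (m + 1) → Bool)
    (v : SignedPermutation (m + 1)) : cls (relabel σ β v) = relabelSymbol σ β (cls v) := by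
  rw [cls_eq, cls_eq, relabelSymbol_bar]
  rfl

/-- Relabellings act transitively on the ordered pairs of symbols with different absolute values. -/
theorem exists_relabelSymbol {s t s' t' : SignedSymbol n} (h : s.1 ≠ t.1) (h' : s'.1 ≠ t'.1) :
    ∃ σ β, relabelSymbol σ β s = s' ∧ relabelSymbol σ β t = t' := by
  set x := Equiv.swap s.1 s'.1 t.1 with hx
  have hxs : x ≠ s'.1 := by
    intro e
    rw [hx, Equiv.swap_apply_eq_iff, Equiv.swap_apply_right] at e
    exact h e.symm
  refine ⟨Equiv.swap x t'.1 * Equiv.swap s.1 s'.1,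
    fun i => if i = s.1 then xor s.2 s'.2 else xor t.2 t'.2, ?_, ?_⟩
  · ext1
    · simp only [relabelSymbol, Equiv.Perm.coe_mul, Function.comp, Equiv.swap_apply_left]
      rw [Equiv.swap_apply_of_ne_of_ne hxs.symm h']
    · simp [relabelSymbol]
  · ext1
    · simp only [relabelSymbol, Equiv.Perm.coe_mul, Function.comp]
      rw [← hx, Equiv.swap_apply_left]
    · simp [relabelSymbol, h.symm]

end Relabel

section Extend

variable {m : ℕ}

/-- Makes room for the absolute value of `s` among the absolute values of `m` symbols. -/
def liftSymbol (s : SignedSymbol (m + 1)) (x : SignedSymbol m) : SignedSymbol (m + 1) :=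
  (s.1.succAbove x.1, x.2)

theorem liftSymbol_bar (s : SignedSymbol (m + 1)) (x : SignedSymbol m) :
    liftSymbol s x.bar = (liftSymbol s x).bar := rfl

theorem liftSymbol_fst_ne (s : SignedSymbol (m + 1)) (x : SignedSymbol m) :
    (liftSymbol s x).1 ≠ s.1 := Fin.succAbove_ne _ _

theorem liftSymbol_injective (s : SignedSymbol (m + 1)) : Function.Injective (liftSymbol s) := by
  rintro ⟨i, b⟩ ⟨j, c⟩ h
  simpa [liftSymbol] using h

theorem exists_liftSymbol {s x : SignedSymbol (m + 1)} (h : x.1 ≠ s.1) :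
    ∃ y, liftSymbol s y = x := by
  obtain ⟨i, hi⟩ := Fin.exists_succAbove_eq h
  exact ⟨(i, x.2), by simp [liftSymbol, hi]⟩

/-- The isomorphism from the burnt pancake graph of dimension `m` to the copy `s` inside the one
of dimension `m + 1`. -/
def extend (s : SignedSymbol (m + 1)) (u : SignedPermutation m) : SignedPermutation (m + 1) :=
  ⟨Fin.snoc (α := fun _ => SignedSymbol (m + 1)) (fun i => liftSymbol s (u.1 i)) s, by
    intro i j
    refine Fin.lastCases ?_ (fun i => ?_) i <;> refine Fin.lastCases ?_ (fun j => ?_) j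
    · simp
    · intro h
      simp only [Fin.snoc_last, Fin.snoc_castSucc] at h
      exact absurd h.symm (liftSymbol_fst_ne s _)
    · intro h
      simp only [Fin.snoc_last, Fin.snoc_castSucc] at h
      exact absurd h (liftSymbol_fst_ne s _)
    · intro h
      simp only [Fin.snoc_castSucc, liftSymbol, Fin.succAbove_right_inj] at h
      rw [u.2 h]⟩

@[simp] theorem extend_castSucc (s : SignedSymbol (m + 1)) (u : SignedPermutation m) (i : Fin m) :
    (extend s u).1 i.castSucc = liftSymbol s (u.1 i) := by
  simp [extend]

@[simp] theorem copy_extend (s : SignedSymbol (m + 1)) (u : SignedPermutation m) :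
    copy (extend s u) = s := by
  simp [extend, copy]

theorem extend_injective (s : SignedSymbol (m + 1)) : Function.Injective (extend s) := by
  intro u v h
  ext1
  funext i
  apply liftSymbol_injective s
  rw [← extend_castSucc, ← extend_castSucc, h]

theorem exists_extend {s : SignedSymbol (m + 1)} {v : SignedPermutation (m + 1)}
    (h : copy v = s) : ∃ u, extend s u = v := by
  have : ∀ i : Fin m, ∃ y, liftSymbol s y = v.1 i.castSucc := fun i => by
    apply exists_liftSymbol
    rw [← h]
    intro e
    exact (Fin.castSucc_lt_last i).ne (letter_eq e)
  choose u hu using this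
  refine ⟨⟨u, fun i j e => ?_⟩, ?_⟩
  · have h1 : (v.1 i.castSucc).1 = (v.1 j.castSucc).1 := by
      rw [← hu, ← hu]
      simpa [liftSymbol] using e
    simpa using letter_eq h1
  · ext1
    funext i
    refine Fin.lastCases ?_ (fun i => ?_) i
    · rw [show (extend s _).1 (Fin.last m) = s from copy_extend s _, ← h]
      rfl
    · rw [extend_castSucc]
      exact hu i

theorem prefixReversal_extend (s : SignedSymbol (m + 1)) (u : SignedPermutation m) (k : Fin m) :
    prefixReversal k.castSucc (extend s u) = extend s (prefixReversal k u) := by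
  ext1
  funext i
  refine Fin.lastCases ?_ (fun i => ?_) i
  · exact (copy_prefixReversal k _).trans ((copy_extend s _).trans (copy_extend s _).symm)
  · rw [extend_castSucc]
    simp only [prefixReversal, prefixReversalWord, Fin.castSucc_le_castSucc_iff]
    split_ifs
    · rw [liftSymbol_bar, ← extend_castSucc]
      rfl
    · rw [extend_castSucc]

theorem extend_adj_iff (hm : 0 < m) (s : SignedSymbol (m + 1)) {u v : SignedPermutation m} :
    (burntPancake (m + 1)).Adj (extend s u) (extend s v) ↔ (burntPancake m).Adj u v := by
  constructor
  · intro h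
    obtain ⟨k, hk⟩ := exists_of_adj hm h (by simp)
    rw [prefixReversal_extend] at hk
    exact ⟨k, extend_injective s hk⟩
  · rintro ⟨k, rfl⟩
    exact ⟨k.castSucc, (prefixReversal_extend s u k).symm⟩

theorem cls_extend {m : ℕ} (s : SignedSymbol (m + 2)) (u : SignedPermutation (m + 1)) :
    cls (extend s u) = (liftSymbol s (u.1 0)).bar := by
  rw [cls_eq, ← extend_castSucc]
  rfl

end Extend

section Counting

theorem ncard_eq_sum_fibers {V ι : Type*} [Finite V] [Fintype ι] (f : V → ι) (X : Set V) :
    X.ncard = ∑ i, (X ∩ {v | f v = i}).ncard := by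
  classical
  have := Fintype.ofFinite V
  rw [Set.ncard_eq_toFinset_card', Finset.card_eq_sum_card_fiberwise (t := Finset.univ) (f := f)
    (by simp)]
  refine Finset.sum_congr rfl fun i _ => ?_
  rw [Set.ncard_eq_toFinset_card']
  congr 1
  ext v
  simp

variable {m : ℕ}

theorem ncard_copy_eq (s : SignedSymbol (m + 1)) :
    {v | copy v = s}.ncard = Nat.card (SignedPermutation m) := by
  have : {v | copy v = s} = Set.range (extend s) := by
    ext v
    constructor
    · intro h
      exact exists_extend h
    · rintro ⟨u, rfl⟩
      simp
  rw [this, ← Set.image_univ, Set.ncard_image_of_injective _ (extend_injective s),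
    Set.ncard_univ]

theorem card_signedPermutation_succ (m : ℕ) :
    Nat.card (SignedPermutation (m + 1)) = 2 * (m + 1) * Nat.card (SignedPermutation m) := by
  rw [← Set.ncard_univ, ncard_eq_sum_fibers copy]
  simp only [Set.univ_inter, ncard_copy_eq]
  simp [mul_comm]

theorem ncard_copy_cls_le {s t s' t' : SignedSymbol (m + 1)} (h : s.1 ≠ t.1) (h' : s'.1 ≠ t'.1) :
    {v | copy v = s ∧ cls v = t}.ncard ≤ {v | copy v = s' ∧ cls v = t'}.ncard := by
  obtain ⟨σ, β, hs, ht⟩ := exists_relabelSymbol h h'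
  refine Set.ncard_le_ncard_of_injOn (relabel σ β) ?_ (relabel_injective σ β).injOn
    (Set.toFinite _)
  rintro v ⟨rfl, rfl⟩
  exact ⟨by rw [copy_relabel, hs], by rw [cls_relabel, ht]⟩

/-- The number of edges between two copies whose last symbols have different absolute values. -/
noncomputable def linkCount (m : ℕ) : ℕ := Nat.card (SignedPermutation (m - 1))

theorem ncard_copy (hm : 0 < m) (s : SignedSymbol (m + 1)) :
    {v | copy v = s}.ncard = 2 * m * linkCount m := by
  obtain ⟨m, rfl⟩ : ∃ k, m = k + 1 := ⟨m - 1, by omega⟩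
  rw [ncard_copy_eq, card_signedPermutation_succ]
  rfl

theorem ncard_copy_cls (hm : 0 < m) {s t : SignedSymbol (m + 1)} (h : s.1 ≠ t.1) :
    {v | copy v = s ∧ cls v = t}.ncard = linkCount m := by
  have h1 := ncard_copy hm s
  rw [ncard_eq_sum_fibers cls] at h1
  have h2 : ∀ c : SignedSymbol (m + 1), ({v | copy v = s} ∩ {v | cls v = c}).ncard =
      if c.1 = s.1 then 0 else {v | copy v = s ∧ cls v = t}.ncard := by
    intro c
    split_ifs with hc
    · rw [Set.ncard_eq_zero]
      ext v
      simp only [Set.mem_inter_iff, Set.mem_ofPred_eq, Set.mem_empty_iff_false, iff_false]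
      rintro ⟨rfl, rfl⟩
      exact cls_fst_ne hm v hc
    · exact le_antisymm (ncard_copy_cls_le (Ne.symm hc) h) (ncard_copy_cls_le h (Ne.symm hc))
  simp only [h2, Fintype.sum_prod_type, Fintype.sum_bool, ← two_mul, ← Finset.mul_sum] at h1
  rw [Finset.sum_ite, Finset.sum_const_zero, zero_add, Finset.sum_const,
    Finset.filter_not, Finset.filter_eq', if_pos (Finset.mem_univ _),
    Finset.card_sdiff_of_subset (by simp)] at h1
  simp only [Finset.card_univ, Fintype.card_fin, Finset.card_singleton, smul_eq_mul,
    Nat.add_sub_cancel, mul_assoc] at h1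
  exact Nat.eq_of_mul_eq_mul_left hm (Nat.eq_of_mul_eq_mul_left two_pos h1)

/-- A crude bound; it is an equality for `m = 3`, the case in which the counting is tightest. -/
theorem le_linkCount (hm : 3 ≤ m) : 8 * (m - 2) ≤ linkCount m := by
  obtain ⟨k, rfl⟩ : ∃ k, m = k + 3 := ⟨m - 3, by omega⟩
  induction k with
  | zero =>
    have h0 : Nat.card (SignedPermutation 0) = 1 := by
      have : Unique (SignedPermutation 0) :=
        { default := ⟨Fin.elim0, fun i => i.elim0⟩
          uniq := fun v => Subtype.ext (funext fun i => i.elim0) }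
      exact Nat.card_unique
    have := card_signedPermutation_succ 1
    rw [card_signedPermutation_succ 0, h0] at this
    have h2 : linkCount (0 + 3) = Nat.card (SignedPermutation (1 + 1)) := rfl
    rw [h2, this]
  | succ k ih =>
    have h1 := card_signedPermutation_succ (k + 2)
    have h2 : linkCount (k + 1 + 3) = Nat.card (SignedPermutation (k + 2 + 1)) := rfl
    have h3 : linkCount (k + 3) = Nat.card (SignedPermutation (k + 2)) := rfl
    rw [h2, h1, ← h3]
    have := ih (by omega)
    simp only [show k + 3 - 2 = k + 1 by omega,
      show k + 1 + 3 - 2 = k + 2 by omega] at this ⊢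
    nlinarith

theorem contains_or (v : SignedPermutation (m + 1)) (x : SignedSymbol (m + 1)) :
    Contains v x ∨ Contains v x.bar := by
  obtain ⟨i, hi⟩ := Finite.surjective_of_injective v.2 x.1
  rcases fst_eq_iff.1 hi with h | h
  · exact .inl ⟨i, h⟩
  · exact .inr ⟨i, h⟩

/-- At least half of the vertices that link two copies contain a given symbol, if its absolute
value is not that of one of the copies. -/
theorem linkCount_le_two_mul (hm : 0 < m) {s t x : SignedSymbol (m + 1)} (h : s.1 ≠ t.1)
    (hs : x.1 ≠ s.1) (ht : x.1 ≠ t.1) :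
    linkCount m ≤ 2 * {v | (copy v = s ∧ cls v = t) ∧ Contains v x}.ncard := by
  have hfix : ∀ {y : SignedSymbol (m + 1)}, x.1 ≠ y.1 →
      relabelSymbol 1 (fun i => decide (i = x.1)) y = y := by
    intro y hy
    ext1
    · rfl
    · simp [relabelSymbol, hy.symm]
  have h1 : {v : SignedPermutation (m + 1) | (copy v = s ∧ cls v = t) ∧ Contains v x.bar}.ncard ≤
      {v : SignedPermutation (m + 1) | (copy v = s ∧ cls v = t) ∧ Contains v x}.ncard := by
    refine Set.ncard_le_ncard_of_injOn (relabel 1 fun i => decide (i = x.1)) ?_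
      (relabel_injective _ _).injOn (Set.toFinite _)
    rintro v ⟨⟨rfl, rfl⟩, i, hi⟩
    refine ⟨⟨by rw [copy_relabel, hfix hs], by rw [cls_relabel, hfix ht]⟩, i, ?_⟩
    simp only [relabel, hi]
    ext1
    · rfl
    · simp [relabelSymbol, SignedSymbol.bar]
  rw [← ncard_copy_cls hm h]
  calc _ ≤ ({v : SignedPermutation (m + 1) | (copy v = s ∧ cls v = t) ∧ Contains v x} ∪
        {v | (copy v = s ∧ cls v = t) ∧ Contains v x.bar}).ncard := by
        refine Set.ncard_le_ncard (fun v hv => ?_) (Set.toFinite _)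
        rcases contains_or v x with h | h
        · exact .inl ⟨hv, h⟩
        · exact .inr ⟨hv, h⟩
    _ ≤ _ := Set.ncard_union_le _ _
    _ ≤ _ := by omega

end Counting

/-! ### Faults and the copies they hit -/

/-- A fault: a deleted vertex, a deleted edge, or a pair of adjacent vertices deleted together.
Single vertices have to be admitted even though hybrid fault sets have none, because a faulty pair
whose ends lie in two copies leaves a single faulty vertex in each of them. -/
inductive Fault (V : Type*) where
  | vertex (v : V)
  | edge (a b : V)
  | pair (a b : V)

namespace Fault

variable {V : Type*}

/-- The vertices deleted by a fault. -/
def verts : Fault V → Set V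
  | vertex v => {v}
  | edge _ _ => ∅
  | pair a b => {a, b}

/-- The edges deleted by a fault, apart from those that lose an end. -/
def edges : Fault V → Set (Sym2 V)
  | vertex _ => ∅
  | edge a b => {s(a, b)}
  | pair _ _ => ∅

/-- The two vertices of a faulty pair have to be adjacent. -/
def Admissible (G : SimpleGraph V) : Fault V → Prop
  | pair a b => G.Adj a b
  | _ => True

end Fault

section Faults

variable {V : Type*}

/-- The vertices deleted by a list of faults. -/
def deleted (F : List (Fault V)) : Set V := {v | ∃ i ∈ F, v ∈ i.verts}

/-- The edges deleted by a list of faults, apart from those that lose an end. -/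
def cut (F : List (Fault V)) : Set (Sym2 V) := {e | ∃ i ∈ F, e ∈ i.edges}

/-- A list of faults is valid if its pairs are pairs of adjacent vertices and its members have no
vertices in common. -/
def Valid (G : SimpleGraph V) (F : List (Fault V)) : Prop :=
  (∀ i ∈ F, i.Admissible G) ∧ F.Pairwise fun i j => Disjoint i.verts j.verts

theorem deleted_cons (i : Fault V) (F : List (Fault V)) :
    deleted (i :: F) = i.verts ∪ deleted F := by
  ext v
  simp [deleted]

theorem cut_cons (i : Fault V) (F : List (Fault V)) : cut (i :: F) = i.edges ∪ cut F := by
  ext v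
  simp [cut]

theorem deleted_perm {F F' : List (Fault V)} (h : F.Perm F') : deleted F = deleted F' := by
  ext v
  simp [deleted, h.mem_iff]

theorem cut_perm {F F' : List (Fault V)} (h : F.Perm F') : cut F = cut F' := by
  ext v
  simp [cut, h.mem_iff]

theorem Valid.perm {G : SimpleGraph V} {F F' : List (Fault V)} (hF : Valid G F)
    (h : F.Perm F') : Valid G F' :=
  ⟨fun i hi => hF.1 i (h.mem_iff.2 hi), (h.pairwise_iff fun h => h.symm).1 hF.2⟩

theorem Valid.tail {G : SimpleGraph V} {i : Fault V} {F : List (Fault V)}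
    (hF : Valid G (i :: F)) : Valid G F :=
  ⟨fun j hj => hF.1 j (by simp [hj]), (List.pairwise_cons.1 hF.2).2⟩

theorem Valid.disjoint {G : SimpleGraph V} {i : Fault V} {F : List (Fault V)}
    (hF : Valid G (i :: F)) : Disjoint i.verts (deleted F) := by
  rw [Set.disjoint_left]
  rintro v hv ⟨j, hj, hvj⟩
  exact Set.disjoint_left.1 ((List.pairwise_cons.1 hF.2).1 j hj) hv hvj

theorem exists_perm_cons {α : Type*} {F : List α} {i : α} (h : i ∈ F) :
    ∃ F', F.Perm (i :: F') := by
  obtain ⟨l₁, l₂, rfl⟩ := List.append_of_mem h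
  exact ⟨l₁ ++ l₂, List.perm_middle⟩

end Faults

/-- The burnt pancake graph without the faulty edges. The faulty vertices are left in place; they
are avoided by restricting the vertex sets of paths and cycles. -/
def live {n : ℕ} (F : List (Fault (SignedPermutation n))) : SimpleGraph (SignedPermutation n) :=
  (burntPancake n).deleteEdges (cut F)

theorem live_adj {n : ℕ} {F : List (Fault (SignedPermutation n))} {v w : SignedPermutation n} :
    (live F).Adj v w ↔ (burntPancake n).Adj v w ∧ s(v, w) ∉ cut F := by
  simp [live]

/-- The burnt pancake graph of dimension `n` keeps a Hamiltonian cycle after any `n - 2` faults. -/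
def CycleTolerant (n : ℕ) : Prop :=
  ∀ F : List (Fault (SignedPermutation n)), Valid (burntPancake n) F → F.length + 2 ≤ n →
    HamCycle (live F) (deleted F)ᶜ

/-- The burnt pancake graph of dimension `n` remains Hamiltonian-connected after any `n - 3`
faults. -/
def PathTolerant (n : ℕ) : Prop :=
  ∀ F : List (Fault (SignedPermutation n)), Valid (burntPancake n) F → F.length + 3 ≤ n →
    ∀ x y, x ≠ y → x ∉ deleted F → y ∉ deleted F → HamPath (live F) (deleted F)ᶜ x y

section Copies

variable {m : ℕ}

/-- The fault `i` deletes a vertex of the copy `s` or an edge inside it. -/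
def Hits (i : Fault (SignedPermutation (m + 1))) (s : SignedSymbol (m + 1)) : Prop :=
  (∃ v ∈ i.verts, copy v = s) ∨ ∃ a b, s(a, b) ∈ i.edges ∧ copy a = s ∧ copy b = s

open Classical in
/-- The number of faults that hit the copy `s`. -/
noncomputable def hitCount (F : List (Fault (SignedPermutation (m + 1))))
    (s : SignedSymbol (m + 1)) : ℕ := F.countP fun i => Hits i s

/-- The fault-free vertices of the copies in `T`. -/
def region (F : List (Fault (SignedPermutation (m + 1)))) (T : Finset (SignedSymbol (m + 1))) :
    Set (SignedPermutation (m + 1)) := {v | copy v ∈ T ∧ v ∉ deleted F}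

/-- The copy `s` without its faults is Hamiltonian-connected. -/
def Good (F : List (Fault (SignedPermutation (m + 1)))) (s : SignedSymbol (m + 1)) : Prop :=
  ∀ x y, x ≠ y → x ∈ region F {s} → y ∈ region F {s} → HamPath (live F) (region F {s}) x y

/-- The trace of a fault on a copy that it hits. A pair with an end outside the copy leaves a single
faulty vertex. -/
theorem exists_restrict_fault (hm : 0 < m) (s : SignedSymbol (m + 1))
    {i : Fault (SignedPermutation (m + 1))} (hi : i.Admissible (burntPancake (m + 1)))
    (hs : Hits i s) :
    ∃ j : Fault (SignedPermutation m), j.Admissible (burntPancake m) ∧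
      (∀ u, u ∈ j.verts ↔ extend s u ∈ i.verts) ∧
      ∀ u v, s(u, v) ∈ j.edges ↔ s(extend s u, extend s v) ∈ i.edges := by
  have hinj : ∀ {u v : SignedPermutation m}, extend s u = extend s v ↔ u = v :=
    (extend_injective s).eq_iff
  have hne : ∀ {u : SignedPermutation m} {v : SignedPermutation (m + 1)}, copy v ≠ s →
      extend s u ≠ v := by
    rintro u v hv rfl
    exact hv (copy_extend s u)
  cases i with
  | vertex v =>
    simp only [Hits, Fault.verts, Fault.edges, Set.mem_singleton_iff, exists_eq_left,
      Set.mem_empty_iff_false, false_and, exists_false, or_false] at hs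
    obtain ⟨u, rfl⟩ := exists_extend hs
    exact ⟨.vertex u, trivial, by simp [Fault.verts, hinj], by simp [Fault.edges]⟩
  | edge a b =>
    simp only [Hits, Fault.verts, Fault.edges, Set.mem_singleton_iff,
      Set.mem_empty_iff_false, false_and, exists_false, false_or] at hs
    obtain ⟨a', b', he, ha, hb⟩ := hs
    obtain ⟨u, rfl⟩ := exists_extend ha
    obtain ⟨v, rfl⟩ := exists_extend hb
    refine ⟨.edge u v, trivial, by simp [Fault.verts], fun w z => ?_⟩
    simp only [Fault.edges, Set.mem_singleton_iff, ← he]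
    simp [hinj]
  | pair a b =>
    simp only [Fault.Admissible] at hi
    simp only [Hits, Fault.verts, Fault.edges, Set.mem_insert_iff, Set.mem_singleton_iff,
      exists_eq_or_imp, exists_eq_left, Set.mem_empty_iff_false, false_and, exists_false,
      or_false] at hs
    by_cases ha : copy a = s <;> by_cases hb : copy b = s
    · obtain ⟨u, rfl⟩ := exists_extend ha
      obtain ⟨v, rfl⟩ := exists_extend hb
      exact ⟨.pair u v, (extend_adj_iff hm s).1 hi, by simp [Fault.verts, hinj],
        by simp [Fault.edges]⟩
    · obtain ⟨u, rfl⟩ := exists_extend ha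
      exact ⟨.vertex u, trivial, by simp [Fault.verts, hinj, hne hb], by simp [Fault.edges]⟩
    · obtain ⟨v, rfl⟩ := exists_extend hb
      exact ⟨.vertex v, trivial, by simp [Fault.verts, hinj, hne ha], by simp [Fault.edges]⟩
    · tauto

/-- A list of faults induces one in every copy, made of the faults that hit it. -/
theorem exists_restrict (hm : 0 < m) (s : SignedSymbol (m + 1))
    {F : List (Fault (SignedPermutation (m + 1)))} (hF : Valid (burntPancake (m + 1)) F) :
    ∃ F' : List (Fault (SignedPermutation m)), Valid (burntPancake m) F' ∧
      F'.length = hitCount F s ∧ (∀ u, u ∈ deleted F' ↔ extend s u ∈ deleted F) ∧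
      ∀ u v, s(u, v) ∈ cut F' ↔ s(extend s u, extend s v) ∈ cut F := by
  induction F with
  | nil => exact ⟨[], ⟨by simp, by simp⟩, by simp [hitCount], by simp [deleted], by simp [cut]⟩
  | cons i F ih =>
    obtain ⟨F', hF', hl, hd, hc⟩ := ih hF.tail
    by_cases hi : Hits i s
    · obtain ⟨j, hj, hjd, hjc⟩ := exists_restrict_fault hm s (hF.1 i (by simp)) hi
      refine ⟨j :: F', ⟨by simpa [hj] using hF'.1, ?_⟩, by simpa [hitCount, hi] using hl, ?_, ?_⟩
      · refine List.pairwise_cons.2 ⟨fun k hk => Set.disjoint_left.2 fun u hu hu' => ?_, hF'.2⟩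
        exact Set.disjoint_left.1 hF.disjoint ((hjd u).1 hu) ((hd u).1 ⟨k, hk, hu'⟩)
      · intro u
        simp [deleted_cons, hjd, hd]
      · intro u v
        simp [cut_cons, hjc, hc]
    · have hi' := hi
      simp only [Hits, not_or, not_exists, not_and] at hi
      refine ⟨F', hF', ?_, ?_, ?_⟩
      · rw [hl, hitCount, hitCount, List.countP_cons_of_neg]
        simp [hi']
      · intro u
        rw [hd, deleted_cons, Set.mem_union, or_iff_right]
        exact fun h => hi.1 _ h (copy_extend s u)
      · intro u v
        rw [hc, cut_cons, Set.mem_union, or_iff_right]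
        exact fun h => hi.2 _ _ h (copy_extend s u) (copy_extend s v)

theorem mem_region_singleton {F : List (Fault (SignedPermutation (m + 1)))}
    {s : SignedSymbol (m + 1)} {v : SignedPermutation (m + 1)} :
    v ∈ region F {s} ↔ copy v = s ∧ v ∉ deleted F := by
  simp [region]

theorem image_extend_eq {F : List (Fault (SignedPermutation (m + 1)))} {s : SignedSymbol (m + 1)}
    {F' : List (Fault (SignedPermutation m))}
    (hd : ∀ u, u ∈ deleted F' ↔ extend s u ∈ deleted F) :
    extend s '' (deleted F')ᶜ = region F {s} := by
  ext v
  rw [mem_region_singleton]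
  constructor
  · rintro ⟨u, hu, rfl⟩
    exact ⟨copy_extend s u, fun h => hu ((hd u).2 h)⟩
  · rintro ⟨h, hv⟩
    obtain ⟨u, rfl⟩ := exists_extend h
    exact ⟨u, fun h => hv ((hd u).1 h), rfl⟩

/-- In dimension `m + 1`, the copies hit by at most `m - 3` faults are good. -/
theorem PathTolerant.good (hm : 0 < m) (h : PathTolerant m)
    {F : List (Fault (SignedPermutation (m + 1)))} (hF : Valid (burntPancake (m + 1)) F)
    {s : SignedSymbol (m + 1)} (hs : hitCount F s + 3 ≤ m) : Good F s := by
  obtain ⟨F', hF', hl, hd, hc⟩ := exists_restrict hm s hF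
  intro x y hxy hx hy
  rw [mem_region_singleton] at hx hy
  obtain ⟨x, rfl⟩ := exists_extend hx.1
  obtain ⟨y, rfl⟩ := exists_extend hy.1
  have := h F' hF' (by omega) x y (fun e => hxy (by rw [e])) (fun h => hx.2 ((hd x).1 h))
    fun h => hy.2 ((hd y).1 h)
  refine (this.map (extend_injective s) (A := live F) fun u v huv => ?_).congr (image_extend_eq hd)
  rw [live_adj] at huv ⊢
  exact ⟨(extend_adj_iff hm s).2 huv.1, fun h => huv.2 ((hc u v).2 h)⟩

theorem CycleTolerant.hamCycle (hm : 0 < m) (h : CycleTolerant m)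
    {F : List (Fault (SignedPermutation (m + 1)))} (hF : Valid (burntPancake (m + 1)) F)
    {s : SignedSymbol (m + 1)} (hs : hitCount F s + 2 ≤ m) :
    HamCycle (live F) (region F {s}) := by
  obtain ⟨F', hF', hl, hd, hc⟩ := exists_restrict hm s hF
  have hadj : ∀ u v, (live F').Adj u v → (live F).Adj (extend s u) (extend s v) := by
    intro u v huv
    rw [live_adj] at huv ⊢
    exact ⟨(extend_adj_iff hm s).2 huv.1, fun h => huv.2 ((hc u v).2 h)⟩
  obtain ⟨h3, a, b, hp, hab⟩ := h F' hF' (by omega)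
  refine HamCycle.congr ⟨?_, extend s a, extend s b, hp.map (extend_injective s) hadj,
    hadj _ _ hab⟩ (image_extend_eq hd)
  rwa [Set.ncard_image_of_injective _ (extend_injective s)]

end Copies

/-! ### Usable links between copies -/

section Exposed

variable {m : ℕ} {F : List (Fault (SignedPermutation (m + 1)))}
  {i : Fault (SignedPermutation (m + 1))} {s t r : SignedSymbol (m + 1)}
  {v : SignedPermutation (m + 1)}

/-- A fault that hits two copies is a pair of mates. -/
theorem Hits.exists_mate (hi : i.Admissible (burntPancake (m + 1))) (hs : Hits i s)
    (ht : Hits i t) (hst : s ≠ t) :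
    ∃ f, copy f = s ∧ cls f = t ∧ i.verts = {f, mate f} ∧ i.edges = ∅ := by
  cases i with
  | vertex v =>
    simp only [Hits, Fault.verts, Fault.edges, Set.mem_singleton_iff, exists_eq_left,
      Set.mem_empty_iff_false, false_and, exists_false, or_false] at hs ht
    exact absurd (hs.symm.trans ht) hst
  | edge a b =>
    simp only [Hits, Fault.verts, Fault.edges, Set.mem_singleton_iff,
      Set.mem_empty_iff_false, false_and, exists_false, false_or] at hs ht
    obtain ⟨u, v, he, rfl, -⟩ := hs
    obtain ⟨w, z, he', rfl, hz⟩ := ht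
    rw [← he', Sym2.eq_iff] at he
    rcases he with ⟨rfl, -⟩ | ⟨rfl, -⟩
    · exact absurd rfl hst
    · exact absurd hz hst
  | pair a b =>
    simp only [Fault.Admissible] at hi
    simp only [Hits, Fault.verts, Fault.edges, Set.mem_insert_iff, Set.mem_singleton_iff,
      exists_eq_or_imp, exists_eq_left, Set.mem_empty_iff_false, false_and, exists_false,
      or_false] at hs ht
    rcases hs with rfl | rfl <;> rcases ht with rfl | rfl
    · exact absurd rfl hst
    · have := eq_mate_of_adj hi hst.symm
      subst this
      exact ⟨a, rfl, rfl, rfl, rfl⟩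
    · have := eq_mate_of_adj hi.symm hst.symm
      subst this
      exact ⟨b, rfl, rfl, Set.pair_comm _ _, rfl⟩
    · exact absurd rfl hst

theorem hits_mate_iff {f : SignedPermutation (m + 1)} (hv : i.verts = {f, mate f})
    (he : i.edges = ∅) : Hits i r ↔ r = copy f ∨ r = cls f := by
  simp [Hits, hv, he, copy_mate, eq_comm]

theorem hitCount_cons_pos (h : Hits i s) : hitCount (i :: F) s = hitCount F s + 1 := by
  simp [hitCount, h]

theorem hitCount_cons_neg (h : ¬ Hits i s) : hitCount (i :: F) s = hitCount F s := by
  simp [hitCount, h]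

theorem hitCount_le_length : hitCount F s ≤ F.length := List.countP_le_length

theorem hitCount_eq_length : hitCount F s = F.length ↔ ∀ i ∈ F, Hits i s := by
  simp [hitCount, List.countP_eq_length]

theorem hitCount_eq_zero : hitCount F s = 0 ↔ ∀ i ∈ F, ¬ Hits i s := by
  simp [hitCount, List.countP_eq_zero]

theorem hitCount_perm {F' : List (Fault (SignedPermutation (m + 1)))} (h : F.Perm F') :
    hitCount F s = hitCount F' s := h.countP_eq _

/-- The vertices that cannot be left along the edge to their mate: the vertex, its mate, or the
edge between them is faulty. -/
def exposed (F : List (Fault (SignedPermutation (m + 1)))) : Set (SignedPermutation (m + 1)) :=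
  {v | v ∈ deleted F ∨ mate v ∈ deleted F ∨ s(v, mate v) ∈ cut F}

theorem mate_mem_exposed : mate v ∈ exposed F ↔ v ∈ exposed F := by
  simp only [exposed, Set.mem_ofPred_eq, mate_mate, Sym2.eq_swap (a := mate v)]
  tauto

theorem live_adj_mate (h : v ∉ exposed F) : (live F).Adj v (mate v) := by
  simp only [exposed, Set.mem_ofPred_eq, not_or] at h
  exact live_adj.2 ⟨adj_mate v, h.2.2⟩

theorem not_mem_deleted (h : v ∉ exposed F) : v ∉ deleted F := fun h' => h (.inl h')

theorem mate_not_mem_deleted (h : v ∉ exposed F) : mate v ∉ deleted F :=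
  fun h' => h (.inr (.inl h'))

theorem exposed_cons : exposed (i :: F) = exposed [i] ∪ exposed F := by
  ext v
  simp only [exposed, deleted_cons, cut_cons, Set.mem_ofPred_eq, Set.mem_union]
  have h1 : deleted ([] : List (Fault (SignedPermutation (m + 1)))) = ∅ := by simp [deleted]
  have h2 : cut ([] : List (Fault (SignedPermutation (m + 1)))) = ∅ := by simp [cut]
  simp only [h1, h2, Set.mem_empty_iff_false]
  tauto

/-- Of `v` and its mate, at most one lies in the copy `s`. -/
theorem exists_unique_in_copy (hm : 0 < m) (v : SignedPermutation (m + 1))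
    (s : SignedSymbol (m + 1)) : ∃ a, ∀ u, copy u = s → (u = v ∨ mate u = v) → u = a := by
  by_cases h : copy v = s
  · refine ⟨v, fun u hu huv => huv.resolve_right ?_⟩
    rintro rfl
    exact cls_ne_copy hm u (h.trans hu.symm)
  · refine ⟨mate v, fun u hu huv => ?_⟩
    rcases huv with rfl | rfl
    · exact absurd hu h
    · simp

theorem mem_exposed_edge {a b : SignedPermutation (m + 1)} (h : v ∈ exposed [.edge a b]) :
    v = a ∨ mate v = a := by
  simp only [exposed, deleted, cut, List.mem_singleton, exists_eq_left, Fault.verts, Fault.edges,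
    Set.mem_empty_iff_false, Set.mem_ofPred_eq, false_or, Set.mem_singleton_iff] at h
  rcases Sym2.eq_iff.1 h with ⟨h, -⟩ | ⟨-, h⟩ <;> simp [h]

theorem mem_exposed_vertex {a : SignedPermutation (m + 1)} (h : v ∈ exposed [.vertex a]) :
    v = a ∨ mate v = a := by
  simpa [exposed, deleted, cut, Fault.verts, Fault.edges] using h

theorem mem_exposed_pair {a b : SignedPermutation (m + 1)} (h : v ∈ exposed [.pair a b]) :
    (v = a ∨ mate v = a) ∨ v = b ∨ mate v = b := by
  simp [exposed, deleted, cut, Fault.verts, Fault.edges] at h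
  tauto

/-- A fault exposes at most two vertices of a copy, since of a vertex and its mate at most one lies
in the copy. -/
theorem ncard_exposed_le (hm : 0 < m) (F : List (Fault (SignedPermutation (m + 1))))
    (s : SignedSymbol (m + 1)) : ({v | copy v = s} ∩ exposed F).ncard ≤ 2 * F.length := by
  induction F with
  | nil => simp [exposed, deleted, cut]
  | cons i F ih =>
    have h1 : ({v | copy v = s} ∩ exposed [i]).ncard ≤ 2 := by
      obtain ⟨a, b, hab⟩ : ∃ a b, {v | copy v = s} ∩ exposed [i] ⊆ {a, b} := by
        cases i with
        | vertex v =>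
          obtain ⟨a, ha⟩ := exists_unique_in_copy hm v s
          exact ⟨a, a, fun u hu => .inl (ha u hu.1 (mem_exposed_vertex hu.2))⟩
        | edge v w =>
          obtain ⟨a, ha⟩ := exists_unique_in_copy hm v s
          exact ⟨a, a, fun u hu => .inl (ha u hu.1 (mem_exposed_edge hu.2))⟩
        | pair v w =>
          obtain ⟨a, ha⟩ := exists_unique_in_copy hm v s
          obtain ⟨b, hb⟩ := exists_unique_in_copy hm w s
          exact ⟨a, b, fun u hu => (mem_exposed_pair hu.2).imp (ha u hu.1) (hb u hu.1)⟩
      exact (Set.ncard_le_ncard hab (Set.toFinite _)).trans (by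
        have := Set.ncard_insert_le a {b}
        rwa [Set.ncard_singleton] at this)
    rw [exposed_cons, Set.inter_union_distrib_left, List.length_cons]
    have := Set.ncard_union_le ({v | copy v = s} ∩ exposed [i]) ({v | copy v = s} ∩ exposed F)
    omega

/-- Every fault exposes at most one of the vertices that link two given copies. -/
theorem ncard_link_exposed_le (hm : 0 < m) {F : List (Fault (SignedPermutation (m + 1)))}
    (hF : ∀ i ∈ F, i.Admissible (burntPancake (m + 1))) (s t : SignedSymbol (m + 1)) :
    ({v | copy v = s ∧ cls v = t} ∩ exposed F).ncard ≤ F.length := by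
  induction F with
  | nil => simp [exposed, deleted, cut]
  | cons i F ih =>
    have h1 : ({v | copy v = s ∧ cls v = t} ∩ exposed [i]).ncard ≤ 1 := by
      refine Set.ncard_le_one_iff_subsingleton.2 ?_
      have hi := hF i (by simp)
      rintro u ⟨⟨hu, hu'⟩, hui⟩ w ⟨⟨hw, hw'⟩, hwi⟩
      have same : ∀ v, (u = v ∨ mate u = v) → (w = v ∨ mate w = v) → u = w := by
        intro v h1 h2
        obtain ⟨a, ha⟩ := exists_unique_in_copy hm v s
        rw [ha u hu h1, ha w hw h2]
      cases i with
      | vertex v => exact same v (mem_exposed_vertex hui) (mem_exposed_vertex hwi)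
      | edge v z => exact same v (mem_exposed_edge hui) (mem_exposed_edge hwi)
      | pair a b =>
        simp only [Fault.Admissible] at hi
        have other : ∀ {u w a b : SignedPermutation (m + 1)}, copy u = s → cls u = t →
            copy w = s → cls w = t → (burntPancake (m + 1)).Adj a b →
            (u = a ∨ mate u = a) → (w = b ∨ mate w = b) → u = w := by
          rintro u w a b hu hu' hw hw' hab (rfl | rfl) (rfl | rfl)
          · exact absurd (hu'.trans hw'.symm) (cls_ne_of_adj hm hab (hw.trans hu.symm))
          · have := eq_mate_of_adj hab (by
              rw [copy_mate, hw', hu, ← hu', ← hu]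
              exact cls_ne_copy hm u)
            exact (mate_inj.1 this).symm
          · have := eq_mate_of_adj hab.symm (by
              rw [copy_mate, hu', hw, ← hw', ← hw]
              exact cls_ne_copy hm w)
            exact mate_inj.1 this
          · refine absurd ?_ (cls_ne_of_adj hm hab ?_)
            · rw [cls_mate, cls_mate, hu, hw]
            · rw [copy_mate, copy_mate, hu', hw']
        rcases mem_exposed_pair hui with h1 | h1 <;> rcases mem_exposed_pair hwi with h2 | h2
        · exact same a h1 h2
        · exact other hu hu' hw hw' hi h1 h2
        · exact (other hw hw' hu hu' hi h2 h1).symm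
        · exact same b h1 h2
    have ih := ih fun i hi => hF i (by simp [hi])
    rw [exposed_cons, Set.inter_union_distrib_left, List.length_cons]
    have := Set.ncard_union_le ({v | copy v = s ∧ cls v = t} ∩ exposed [i])
      ({v | copy v = s ∧ cls v = t} ∩ exposed F)
    omega

/-- If every fault hits some copy, so that none is an edge between two copies, and none hits the
copy of the mate of `v`, then `v` can be left along the edge to its mate. -/
theorem not_mem_exposed_of_not_hits (hF : ∀ i ∈ F, ∃ s, Hits i s) (hv : v ∉ deleted F)
    (hc : ∀ i ∈ F, ¬ Hits i (cls v)) (hm : 0 < m) : v ∉ exposed F := by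
  rintro (h | ⟨i, hi, h⟩ | ⟨i, hi, h⟩)
  · exact hv h
  · exact hc i hi (.inl ⟨_, h, rfl⟩)
  · obtain ⟨s, hs⟩ := hF i hi
    cases i with
    | vertex _ => exact h
    | pair _ _ => exact h
    | edge a b =>
      simp only [Fault.edges, Set.mem_singleton_iff] at h
      simp only [Hits, Fault.verts, Fault.edges, Set.mem_singleton_iff,
        Set.mem_empty_iff_false, false_and, exists_false, false_or, ← h] at hs
      obtain ⟨a', b', he, ha, hb⟩ := hs
      rcases Sym2.eq_iff.1 he with ⟨rfl, rfl⟩ | ⟨rfl, rfl⟩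
      · exact cls_ne_copy hm _ (hb.trans ha.symm)
      · exact cls_ne_copy hm _ (ha.trans hb.symm)

/-- If all faults hit the copy `s`, its fault-free vertices can be left along the edges to their
mates. -/
theorem not_mem_exposed_of_hits (hm : 0 < m)
    (hF : ∀ i ∈ F, i.Admissible (burntPancake (m + 1))) (hs : ∀ i ∈ F, Hits i s)
    (hv : v ∉ deleted F) (hc : copy v = s) : v ∉ exposed F := by
  rintro (h | ⟨i, hi, h⟩ | h)
  · exact hv h
  · have hne : s ≠ cls v := hc ▸ (cls_ne_copy hm v).symm
    obtain ⟨f, hf, -, hfi, -⟩ := (hs i hi).exists_mate (hF i hi) (t := cls v) (.inl ⟨_, h, rfl⟩)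
      hne
    rw [hfi] at h
    rcases h with h | h
    · rw [← h, copy_mate] at hf
      exact hne hf.symm
    · exact hv ⟨i, hi, by rw [hfi, mate_inj.1 h]; simp⟩
  · obtain ⟨i, hi, h⟩ := h
    have hs := hs i hi
    cases i with
    | vertex _ => exact h
    | pair _ _ => exact h
    | edge a b =>
      simp only [Fault.edges, Set.mem_singleton_iff] at h
      simp only [Hits, Fault.verts, Fault.edges, Set.mem_singleton_iff,
        Set.mem_empty_iff_false, false_and, exists_false, false_or, ← h] at hs
      obtain ⟨a', b', he, ha, hb⟩ := hs
      rcases Sym2.eq_iff.1 he with ⟨rfl, rfl⟩ | ⟨rfl, rfl⟩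
      · exact cls_ne_copy hm _ (hb.trans ha.symm)
      · exact cls_ne_copy hm _ (ha.trans hb.symm)

/-- If every fault is a pair of mates, exactly the faulty vertices are exposed. -/
theorem not_mem_exposed_of_mates (hF : ∀ i ∈ F, ∃ f, i.verts = {f, mate f} ∧ i.edges = ∅)
    (hv : v ∉ deleted F) : v ∉ exposed F := by
  rintro (h | ⟨i, hi, h⟩ | ⟨i, hi, h⟩)
  · exact hv h
  · obtain ⟨f, hf, -⟩ := hF i hi
    refine hv ⟨i, hi, ?_⟩
    rw [hf] at h ⊢
    rcases h with h | h
    · rw [← h]; simp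
    · rw [mate_inj.1 h]; simp
  · obtain ⟨f, -, hf⟩ := hF i hi
    rw [hf] at h
    exact h

end Exposed

section Choice

variable {m : ℕ} {F : List (Fault (SignedPermutation (m + 1)))} {s t : SignedSymbol (m + 1)}

/-- A usable edge between two copies, with one end outside a given small set. -/
theorem exists_link (hm : 0 < m) (hF : Valid (burntPancake (m + 1)) F) (hst : s.1 ≠ t.1)
    (X : Set (SignedPermutation (m + 1))) (h : F.length + X.ncard < linkCount m) :
    ∃ a, copy a = s ∧ cls a = t ∧ a ∉ exposed F ∧ a ∉ X := by
  by_contra! hc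
  have h1 : {v | copy v = s ∧ cls v = t} ⊆
      ({v | copy v = s ∧ cls v = t} ∩ exposed F) ∪ X := fun v hv => by
    by_cases hve : v ∈ exposed F
    · exact .inl ⟨hv, hve⟩
    · exact .inr (hc v hv.1 hv.2 hve)
  have h2 := Set.ncard_le_ncard h1 (Set.toFinite _)
  rw [ncard_copy_cls hm hst] at h2
  have h3 := Set.ncard_union_le ({v | copy v = s ∧ cls v = t} ∩ exposed F) X
  have h4 := ncard_link_exposed_le hm hF.1 s t
  omega

/-- A usable edge between two copies, one of whose ends contains a given symbol and is outside a
given small set. -/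
theorem exists_link_containing (hm : 0 < m) (hF : Valid (burntPancake (m + 1)) F)
    (hst : s.1 ≠ t.1) {x : SignedSymbol (m + 1)} (hs : x.1 ≠ s.1) (ht : x.1 ≠ t.1)
    (X : Set (SignedPermutation (m + 1))) (h : 2 * (F.length + X.ncard) < linkCount m) :
    ∃ a, copy a = s ∧ cls a = t ∧ a ∉ exposed F ∧ a ∉ X ∧ Contains a x := by
  by_contra! hc
  have h1 : {v | (copy v = s ∧ cls v = t) ∧ Contains v x} ⊆
      ({v | copy v = s ∧ cls v = t} ∩ exposed F) ∪ X := fun v hv => by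
    by_cases hve : v ∈ exposed F
    · exact .inl ⟨hv.1, hve⟩
    · by_contra hvX
      exact hc v hv.1.1 hv.1.2 hve (fun h => hvX (.inr h)) hv.2
  have h2 := Set.ncard_le_ncard h1 (Set.toFinite _)
  have h3 := Set.ncard_union_le ({v | copy v = s ∧ cls v = t} ∩ exposed F) X
  have h4 := ncard_link_exposed_le hm hF.1 s t
  have h5 := linkCount_le_two_mul hm hst hs ht
  omega

/-- The fault-free vertices of a copy are many, the more so if many of them are exposed: every fault
accounts for at most two vertices that are faulty or exposed. -/
theorem ncard_region (hm : 0 < m) (F : List (Fault (SignedPermutation (m + 1))))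
    (s : SignedSymbol (m + 1)) :
    2 * m * linkCount m + (region F {s} ∩ exposed F).ncard ≤
      (region F {s}).ncard + 2 * F.length := by
  rw [← ncard_copy hm s]
  have h1 : ({v | copy v = s} ∩ deleted F ∪ region F {s}) = {v | copy v = s} := by
    ext v
    simp only [Set.mem_union, mem_region_singleton, Set.mem_inter_iff, Set.mem_ofPred_eq]
    tauto
  have h2 := Set.ncard_union_le ({v | copy v = s} ∩ deleted F) (region F {s})
  rw [h1] at h2
  have h3 : ({v | copy v = s} ∩ deleted F).ncard + (region F {s} ∩ exposed F).ncard ≤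
      ({v | copy v = s} ∩ exposed F).ncard := by
    rw [← Set.ncard_union_eq ?_ (Set.toFinite _) (Set.toFinite _)]
    · refine Set.ncard_le_ncard ?_ (Set.toFinite _)
      rintro v (hv | hv)
      · exact ⟨hv.1, .inl hv.2⟩
      · exact ⟨(mem_region_singleton.1 hv.1).1, hv.2⟩
    · rw [Set.disjoint_left]
      intro v hv hv'
      exact hv'.1.2 hv.2
  have h4 := ncard_exposed_le hm F s
  omega

/-- The number of vertices of a copy that are unsuitable as exits: they are exposed, have their mate
in one of the copies in `S`, or belong to a prescribed set. -/
theorem ncard_region_inter_le (hm : 0 < m) (F : List (Fault (SignedPermutation (m + 1))))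
    (s : SignedSymbol (m + 1)) (S : Finset (SignedSymbol (m + 1)))
    (X : Set (SignedPermutation (m + 1))) :
    (region F {s} ∩ {v | v ∈ exposed F ∨ cls v ∈ S ∨ v ∈ X}).ncard ≤
      (region F {s} ∩ exposed F).ncard + S.card * linkCount m + X.ncard := by
  have h1 : region F {s} ∩ {v | v ∈ exposed F ∨ cls v ∈ S ∨ v ∈ X} ⊆
      (region F {s} ∩ exposed F) ∪ {v | copy v = s ∧ cls v ∈ S} ∪ X := by
    rintro v ⟨hv, h | h | h⟩
    · exact .inl (.inl ⟨hv, h⟩)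
    · exact .inl (.inr ⟨(mem_region_singleton.1 hv).1, h⟩)
    · exact .inr h
  have h2 : {v | copy v = s ∧ cls v ∈ S}.ncard ≤ S.card * linkCount m := by
    rw [show {v | copy v = s ∧ cls v ∈ S} = ⋃ c ∈ S, {v | copy v = s ∧ cls v = c} by
      ext v
      simp]
    have h3 : ∀ c, {v : SignedPermutation (m + 1) | copy v = s ∧ cls v = c}.ncard ≤
        linkCount m := by
      intro c
      by_cases hc : s.1 = c.1
      · convert Nat.zero_le _
        rw [Set.ncard_eq_zero]
        ext v
        simp only [Set.mem_ofPred_eq, Set.mem_empty_iff_false, iff_false]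
        rintro ⟨rfl, rfl⟩
        exact cls_fst_ne hm v hc.symm
      · exact (ncard_copy_cls hm hc).le
    induction S using Finset.induction_on with
    | empty => simp
    | insert c S hc ih =>
      rw [Finset.set_biUnion_insert, Finset.card_insert_of_notMem hc]
      have := Set.ncard_union_le {v : SignedPermutation (m + 1) | copy v = s ∧ cls v = c}
        (⋃ c ∈ S, {v | copy v = s ∧ cls v = c})
      have := h3 c
      have := ih (by
        rintro v ⟨hv, h | h | h⟩
        · exact .inl (.inl ⟨hv, h⟩)
        · exact .inl (.inr ⟨(mem_region_singleton.1 hv).1, h⟩)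
        · exact .inr h)
      linarith
  have h3 := Set.ncard_le_ncard h1 (Set.toFinite _)
  have h4 := Set.ncard_union_le (region F {s} ∩ exposed F ∪ {v | copy v = s ∧ cls v ∈ S}) X
  have h5 := Set.ncard_union_le (region F {s} ∩ exposed F) {v | copy v = s ∧ cls v ∈ S}
  omega

theorem live_adj_adj {v w : SignedPermutation (m + 1)} (h : (live F).Adj v w) :
    (burntPancake (m + 1)).Adj v w := (live_adj.1 h).1

/-- A spanning path of a copy can be cut at an edge whose ends can both be left along the edges
to their mates, which lie outside the copies in `S`. -/
theorem HamPath.exists_cut_link (hm : 0 < m) {x y : SignedPermutation (m + 1)}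
    (h : HamPath (live F) (region F {s}) x y) (S : Finset (SignedSymbol (m + 1)))
    (hS : 4 * F.length + 2 * (S.card * linkCount m) + 1 < 2 * m * linkCount m) :
    ∃ a b X₁ X₂, region F {s} = X₁ ∪ X₂ ∧ Disjoint X₁ X₂ ∧ HamPath (live F) X₁ x a ∧
      (live F).Adj a b ∧ HamPath (live F) X₂ b y ∧ copy a = s ∧ copy b = s ∧
      a ∉ exposed F ∧ b ∉ exposed F ∧ cls a ∉ S ∧ cls b ∉ S ∧ cls a ≠ cls b := by
  have h1 := ncard_region hm F s
  have h2 := ncard_region_inter_le hm F s S ∅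
  have h3 : (region F {s} ∩ exposed F).ncard ≤ 2 * F.length := by
    refine le_trans (Set.ncard_le_ncard ?_ (Set.toFinite _)) (ncard_exposed_le hm F s)
    exact fun v hv => ⟨(mem_region_singleton.1 hv.1).1, hv.2⟩
  rw [Set.ncard_empty] at h2
  obtain ⟨a, b, X₁, X₂, e, hd, hp, hab, hq, ha, hb⟩ := h.exists_cut _ (by
    have : 2 * (region F {s} ∩ {v | v ∈ exposed F ∨ cls v ∈ S ∨ v ∈ (∅ : Set _)}).ncard + 1 <
      (region F {s}).ncard := by omega
    exact this)
  simp only [Set.mem_ofPred_eq, not_or] at ha hb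
  have hca : copy a = s := (mem_region_singleton.1 (e ▸ Set.mem_union_left _ hp.right_mem)).1
  have hcb : copy b = s := (mem_region_singleton.1 (e ▸ Set.mem_union_right _ hq.left_mem)).1
  exact ⟨a, b, X₁, X₂, e, hd, hp, hab, hq, hca, hcb, ha.1, hb.1, ha.2.1, hb.2.1,
    cls_ne_of_adj hm (live_adj_adj hab) (hcb.trans hca.symm)⟩

/-- A spanning cycle of a copy has an edge whose ends can both be left along the edges to their
mates, which lie outside the copies in `S` and differ from `z`. -/
theorem HamCycle.exists_cut_link (hm : 0 < m) (h : HamCycle (live F) (region F {s}))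
    (S : Finset (SignedSymbol (m + 1))) (z : SignedPermutation (m + 1))
    (hS : 4 * F.length + 2 * (S.card * linkCount m) + 2 < 2 * m * linkCount m) :
    ∃ a b, HamPath (live F) (region F {s}) a b ∧ copy a = s ∧ copy b = s ∧
      a ∉ exposed F ∧ b ∉ exposed F ∧ cls a ∉ S ∧ cls b ∉ S ∧ cls a ≠ cls b ∧
      mate a ≠ z ∧ mate b ≠ z := by
  have h1 := ncard_region hm F s
  have h2 := ncard_region_inter_le hm F s S {mate z}
  have h3 : (region F {s} ∩ exposed F).ncard ≤ 2 * F.length := by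
    refine le_trans (Set.ncard_le_ncard ?_ (Set.toFinite _)) (ncard_exposed_le hm F s)
    exact fun v hv => ⟨(mem_region_singleton.1 hv.1).1, hv.2⟩
  rw [Set.ncard_singleton] at h2
  obtain ⟨a, b, hp, hab, ha, hb⟩ := h.exists_cut _ (by
    have : 2 * (region F {s} ∩ {v | v ∈ exposed F ∨ cls v ∈ S ∨ v ∈ ({mate z} : Set _)}).ncard <
      (region F {s}).ncard := by omega
    exact this)
  simp only [Set.mem_ofPred_eq, Set.mem_singleton_iff, not_or] at ha hb
  have hca : copy a = s := (mem_region_singleton.1 hp.left_mem).1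
  have hcb : copy b = s := (mem_region_singleton.1 hp.right_mem).1
  exact ⟨a, b, hp, hca, hcb, ha.1, hb.1, ha.2.1, hb.2.1,
    cls_ne_of_adj hm (live_adj_adj hab) (hcb.trans hca.symm),
    fun e => ha.2.2 (mate_eq_comm.1 e), fun e => hb.2.2 (mate_eq_comm.1 e)⟩

end Choice

/-! ### Routes through the copies -/

section Routes

variable {N : ℕ}

/-- A path through the copies in `T` from `p` to `q`. Two copies are linked unless they belong to
a symbol and its bar. -/
inductive Route : Finset (SignedSymbol N) → SignedSymbol N → SignedSymbol N → Prop
  | single (p : SignedSymbol N) : Route {p} p p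
  | cons {T : Finset (SignedSymbol N)} {p p' q : SignedSymbol N} (hp : p ∉ T) (h : p' ≠ p.bar)
      (hr : Route T p' q) : Route (insert p T) p q

variable {T : Finset (SignedSymbol N)} {p q r r' : SignedSymbol N}

theorem Route.left_mem (h : Route T p q) : p ∈ T := by
  cases h <;> simp

theorem Route.pair (hpq : p ≠ q) (h : q ≠ p.bar) : Route {p, q} p q :=
  .cons (by simpa using hpq) h (.single q)

/-- Three elements can be arranged between `p` and `q` so that no two consecutive ones are exchanged
by a given involution. -/
theorem order_three {α : Type*} (f : α → α) (hf : ∀ x, f (f x) = x) {p q a b c : α}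
    (hpq : p ≠ q) (hpa : p ≠ a) (hpb : p ≠ b) (hab : a ≠ b) (hac : a ≠ c)
    (hbc : b ≠ c) (hbq : b ≠ q) (hcq : c ≠ q) :
    (a ≠ f p ∧ b ≠ f a ∧ c ≠ f b ∧ q ≠ f c) ∨ (a ≠ f p ∧ c ≠ f a ∧ b ≠ f c ∧ q ≠ f b) ∨
    (b ≠ f p ∧ a ≠ f b ∧ c ≠ f a ∧ q ≠ f c) ∨ (b ≠ f p ∧ c ≠ f b ∧ a ≠ f c ∧ q ≠ f a) ∨
    (c ≠ f p ∧ a ≠ f c ∧ b ≠ f a ∧ q ≠ f b) ∨ (c ≠ f p ∧ b ≠ f c ∧ a ≠ f b ∧ q ≠ f a) := by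
  have := hf p
  have := hf q
  have := hf a
  have := hf b
  have := hf c
  clear hf
  grind

/-- Between two of five copies there is a path through all of them. -/
theorem exists_five (hT : T.card = 5) (hp : p ∈ T) (hq : q ∈ T) (hpq : p ≠ q) :
    ∃ a b c, T = {p, a, b, c, q} ∧ [p, a, b, c, q].Nodup ∧ a ≠ p.bar ∧ b ≠ a.bar ∧ c ≠ b.bar ∧
      q ≠ c.bar := by
  have h3 : ((T.erase p).erase q).card = 3 := by
    rw [Finset.card_erase_of_mem (by simp [hq, hpq.symm]), Finset.card_erase_of_mem hp, hT]
  obtain ⟨a, b, c, hab, hac, hbc, he⟩ := Finset.card_eq_three.1 h3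
  have hT' : T = insert p (insert q {a, b, c}) := by
    rw [← he, Finset.insert_erase (by simp [hq, hpq.symm]), Finset.insert_erase hp]
  have hne : ∀ x ∈ ({a, b, c} : Finset (SignedSymbol N)), x ≠ p ∧ x ≠ q := by
    intro x hx
    rw [← he] at hx
    simp only [Finset.mem_erase] at hx
    exact ⟨hx.2.1, hx.1⟩
  have ha := hne a (by simp)
  have hb := hne b (by simp)
  have hc := hne c (by simp)
  have hnd : ∀ {x y z : SignedSymbol N}, x ≠ y → x ≠ z → y ≠ z → x ≠ p ∧ x ≠ q → y ≠ p ∧ y ≠ q →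
      z ≠ p ∧ z ≠ q → [p, x, y, z, q].Nodup := by
    intro x y z hxy hxz hyz hx hy hz
    simp only [List.nodup_cons, List.mem_cons, List.not_mem_nil, or_false, not_or]
    exact ⟨⟨hx.1.symm, hy.1.symm, hz.1.symm, hpq⟩, ⟨hxy, hxz, hx.2⟩, ⟨hyz, hy.2⟩, hz.2, by simp⟩
  rcases order_three SignedSymbol.bar bar_bar hpq ha.1.symm hb.1.symm hab hac hbc hb.2 hc.2 with
    h | h | h | h | h | h
  · exact ⟨a, b, c, by rw [hT']; grind, hnd hab hac hbc ha hb hc, h⟩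
  · exact ⟨a, c, b, by rw [hT']; grind, hnd hac hab hbc.symm ha hc hb, h⟩
  · exact ⟨b, a, c, by rw [hT']; grind, hnd hab.symm hbc hac hb ha hc, h⟩
  · exact ⟨b, c, a, by rw [hT']; grind, hnd hbc hab.symm hac.symm hb hc ha, h⟩
  · exact ⟨c, a, b, by rw [hT']; grind, hnd hac.symm hbc.symm hab hc ha hb, h⟩
  · exact ⟨c, b, a, by rw [hT']; grind, hnd hbc.symm hac.symm hab.symm hc hb ha, h⟩

/-- Between two of at least five copies there is a path through all of them. -/
theorem exists_route (hT : 5 ≤ T.card) (hp : p ∈ T) (hq : q ∈ T) (hpq : p ≠ q) :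
    Route T p q := by
  obtain ⟨k, hk⟩ : ∃ k, T.card = k + 5 := ⟨T.card - 5, by omega⟩
  induction k generalizing T p with
  | zero =>
    obtain ⟨a, b, c, rfl, hnd, h1, h2, h3, h4⟩ := exists_five (by simpa using hk) hp hq hpq
    simp only [List.nodup_cons, List.mem_cons, List.not_mem_nil, or_false, not_or] at hnd
    obtain ⟨⟨hpa, hpb, hpc, -⟩, ⟨hab, hac, haq⟩, ⟨hbc, hbq⟩, hcq, -⟩ := hnd
    exact .cons (by simp [*]) h1 (.cons (by simp [*]) h2 (.cons (by simp [*]) h3 (.pair hcq h4)))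
  | succ k ih =>
    obtain ⟨p', hp'⟩ : (((T.erase p).erase q).erase p.bar).Nonempty := by
      rw [← Finset.card_pos]
      have h1 := Finset.pred_card_le_card_erase (s := (T.erase p).erase q) (a := p.bar)
      have h2 := Finset.pred_card_le_card_erase (s := T.erase p) (a := q)
      have h3 := Finset.pred_card_le_card_erase (s := T) (a := p)
      omega
    simp only [Finset.mem_erase] at hp'
    obtain ⟨h1, h2, h3, h4⟩ := hp'
    have hc := Finset.card_erase_of_mem hp
    have := ih (T := T.erase p) (p := p') (by omega) (by simp [h3, h4]) (by simp [hq, hpq.symm])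
      h2 (by omega)
    rw [← Finset.insert_erase hp]
    exact .cons (by simp) h1 this

theorem Route.three (hpr : p ≠ r) (hpq : p ≠ q) (hrq : r ≠ q) (h1 : r ≠ p.bar) (h2 : q ≠ r.bar) :
    Route {p, r, q} p q :=
  .cons (by simp [hpr, hpq]) h1 (.pair hrq h2)

/-- Two linked copies can be passed through, in a suitable order, between two further ones. -/
theorem exists_route_four (hpq : p ≠ q) (hpr : p ≠ r) (hpr' : p ≠ r') (hrr : r ≠ r')
    (hrq : r ≠ q) (hrq' : r' ≠ q) (h : r' ≠ r.bar) : Route {p, r, r', q} p q := by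
  have h' : r ≠ r'.bar := fun e => h (by rw [e, bar_bar])
  have : (r ≠ p.bar ∧ q ≠ r'.bar) ∨ (r' ≠ p.bar ∧ q ≠ r.bar) := by
    have := bar_bar p
    have := bar_bar r
    have := bar_bar r'
    have := bar_bar q
    grind
  rcases this with ⟨h1, h2⟩ | ⟨h1, h2⟩
  · exact .cons (by simp [*]) h1 (.three hrr hrq hrq' h h2)
  · rw [Finset.insert_comm r r']
    exact .cons (by simp [*]) h1 (.three hrr.symm hrq' hrq h' h2)

/-- Four of at least six copies can be joined in pairs by two disjoint paths that together pass
through all the copies; which of two pairings is achieved cannot be prescribed. -/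
theorem exists_two_routes {c e : SignedSymbol N} (hT : 6 ≤ T.card) (hp : p ∈ T) (hq : q ∈ T)
    (hc : c ∈ T) (he : e ∈ T) (hpq : p ≠ q) (hpc : p ≠ c) (hpe : p ≠ e) (hqc : q ≠ c)
    (hqe : q ≠ e) (hce : c ≠ e) :
    ∃ T₁ T₂, T = T₁ ∪ T₂ ∧ Disjoint T₁ T₂ ∧
      ((Route T₁ p c ∧ Route T₂ e q) ∨ (Route T₁ p e ∧ Route T₂ c q)) := by
  have hsub : ∀ {x y : SignedSymbol N}, x ∈ T → y ∈ T → T = {x, y} ∪ T \ {x, y} := fun hx hy => by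
    rw [Finset.union_sdiff_of_subset]
    simp [Finset.insert_subset_iff, hx, hy]
  have hcard : ∀ {x y : SignedSymbol N}, x ∈ T → y ∈ T → x ≠ y →
      (T \ {x, y}).card = T.card - 2 := fun hx hy hxy => by
    rw [Finset.card_sdiff_of_subset (by simp [Finset.insert_subset_iff, hx, hy]),
      Finset.card_pair hxy]
  by_cases h7 : 7 ≤ T.card
  -- `p` is linked directly with one of `c` and `e`, and at least five copies remain for the
  -- other route
  · by_cases h : c = p.bar
    · refine ⟨{p, e}, T \ {p, e}, hsub hp he, Finset.disjoint_sdiff, .inr ⟨.pair hpe ?_, ?_⟩⟩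
      · rw [← h]
        exact hce.symm
      · have := hcard hp he hpe
        exact exists_route (by omega) (by simp [hc, hpc.symm, hce]) (by simp [hq, hpq.symm, hqe])
          hqc.symm
    · refine ⟨{p, c}, T \ {p, c}, hsub hp hc, Finset.disjoint_sdiff, .inl ⟨.pair hpc h, ?_⟩⟩
      have := hcard hp hc hpc
      exact exists_route (by omega) (by simp [*, hpe.symm, hce.symm]) (by simp [*, hpq.symm])
        hqe.symm
  · -- two copies `r` and `r'` remain to be distributed over the two routes
    have h2 : (T \ {p, c, e, q}).card = 2 := by
      rw [Finset.card_sdiff_of_subset (by simp [Finset.insert_subset_iff, *])]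
      have : ({p, c, e, q} : Finset (SignedSymbol N)).card = 4 := by
        rw [Finset.card_insert_of_notMem (by simp [*]), Finset.card_insert_of_notMem
          (by simp [*, hqc.symm]), Finset.card_pair hqe.symm]
      omega
    obtain ⟨r, r', hrr, hZ⟩ := Finset.card_eq_two.1 h2
    have hr : r ∈ T \ {p, c, e, q} := by simp [hZ]
    have hr' : r' ∈ T \ {p, c, e, q} := by simp [hZ]
    have hT' : T = {p, c, e, q} ∪ {r, r'} := by
      rw [← hZ, Finset.union_sdiff_of_subset]
      simp [Finset.insert_subset_iff, *]
    simp only [Finset.mem_sdiff, Finset.mem_insert, Finset.mem_singleton, not_or] at hr hr'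
    obtain ⟨-, hrp, hrc, hre, hrq⟩ := hr
    obtain ⟨-, hrp', hrc', hre', hrq'⟩ := hr'
    have hdisj : ∀ {X Y : Finset (SignedSymbol N)}, (∀ x ∈ X, ∀ y ∈ Y, x ≠ y) → Disjoint X Y :=
      fun h => Finset.disjoint_left.2 fun x hx hx' => h x hx x hx' rfl
    have hpc' := hpc.symm
    have hpe' := hpe.symm
    have hpq' := hpq.symm
    have hqc' := hqc.symm
    have hqe' := hqe.symm
    have hce' := hce.symm
    have hrr' := hrr.symm
    by_cases h : r' = r.bar
    · -- no other copy is the bar of `r` or `r'`, so that one of them fits into each route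
      have hbar : ∀ {x}, x ≠ r' → x ≠ r.bar := fun hx e => hx (by rw [e, h])
      have hbar' : ∀ {x}, x ≠ r → x ≠ r'.bar := fun hx e => hx (by rw [e, h, bar_bar])
      have hb : ∀ {x y : SignedSymbol N}, x ≠ y.bar → y ≠ x.bar := fun hx e =>
        hx (by rw [e, bar_bar])
      refine ⟨{p, r, c}, {e, r', q}, by
        rw [hT']
        ext x
        simp only [Finset.mem_union, Finset.mem_insert, Finset.mem_singleton]
        tauto, ?_, .inl
        ⟨.three (Ne.symm hrp) hpc hrc (hb (hbar (Ne.symm hrp'))) (hbar (Ne.symm hrc')),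
        .three (Ne.symm hre') hqe.symm hrq' (hb (hbar' (Ne.symm hre))) (hbar' (Ne.symm hrq))⟩⟩
      refine hdisj ?_
      simp only [Finset.mem_insert, Finset.mem_singleton, forall_eq_or_imp, forall_eq]
      clear hsub hcard hdisj hZ hT' h2 hT h7
      tauto
    · -- `r` and `r'` are linked and go into the same route
      by_cases hc : c = p.bar
      · refine ⟨{p, e}, {c, r, r', q}, by
        rw [hT']
        ext x
        simp only [Finset.mem_union, Finset.mem_insert, Finset.mem_singleton]
        tauto, ?_, .inr ⟨.pair hpe ?_,
          exists_route_four hqc.symm (Ne.symm hrc) (Ne.symm hrc') hrr hrq hrq' h⟩⟩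
        · refine hdisj ?_
          simp only [Finset.mem_insert, Finset.mem_singleton, forall_eq_or_imp, forall_eq]
          clear hsub hcard hdisj hZ hT' h2 hT h7
          tauto
        · rw [← hc]
          exact hce.symm
      · refine ⟨{p, c}, {e, r, r', q}, by
        rw [hT']
        ext x
        simp only [Finset.mem_union, Finset.mem_insert, Finset.mem_singleton]
        tauto, ?_, .inl ⟨.pair hpc hc,
          exists_route_four hqe.symm (Ne.symm hre) (Ne.symm hre') hrr hrq hrq' h⟩⟩
        refine hdisj ?_
        simp only [Finset.mem_insert, Finset.mem_singleton, forall_eq_or_imp, forall_eq]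
        clear hsub hcard hdisj hZ hT' h2 hT h7
        tauto

end Routes

section Assembly

variable {m : ℕ} {F : List (Fault (SignedPermutation (m + 1)))}
  {S T : Finset (SignedSymbol (m + 1))} {s t p q : SignedSymbol (m + 1)}
  {x y : SignedPermutation (m + 1)}

theorem region_union : region F S ∪ region F T = region F (S ∪ T) := by
  ext v
  simp only [region, Set.mem_union, Set.mem_ofPred_eq, Finset.mem_union]
  tauto

theorem region_disjoint (h : Disjoint S T) : Disjoint (region F S) (region F T) := by
  rw [Set.disjoint_left]
  exact fun v hv hv' => Finset.disjoint_left.1 h hv.1 hv'.1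

theorem region_univ : region F Finset.univ = (deleted F)ᶜ := by
  ext v
  simp [region]

/-- Spanning paths of two disjoint sets of copies are joined by an edge between mates. -/
theorem HamPath.link {a : SignedPermutation (m + 1)} (h : HamPath (live F) (region F S) x a)
    (ha : a ∉ exposed F) (h' : HamPath (live F) (region F T) (mate a) y) (hd : Disjoint S T) :
    HamPath (live F) (region F (S ∪ T)) x y :=
  (h.trans (live_adj_mate ha) h' (region_disjoint hd)).congr region_union

/-- Along a route through Hamiltonian-connected copies there is a spanning path between any two
vertices of the end copies. -/
theorem Route.hamPath (hm : 0 < m) (hF : Valid (burntPancake (m + 1)) F)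
    (hl : F.length + 2 < linkCount m) (h : Route T p q) (hT : ∀ t ∈ T, Good F t)
    (hx : copy x = p) (hy : copy y = q) (hxF : x ∉ deleted F) (hyF : y ∉ deleted F)
    (hxy : x ≠ y) : HamPath (live F) (region F T) x y := by
  induction h generalizing x with
  | single p =>
    exact hT p (by simp) x y hxy (mem_region_singleton.2 ⟨hx, hxF⟩)
      (mem_region_singleton.2 ⟨hy, hyF⟩)
  | @cons T p p' q hp hpp hr ih =>
    have hne : p.1 ≠ p'.1 := by
      intro e
      rcases fst_eq_iff.1 e with e | e
      · exact hp (e ▸ hr.left_mem)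
      · exact hpp (by rw [e, bar_bar])
    obtain ⟨a, ha, ha', hae, haX⟩ := exists_link hm hF hne {x, mate y} (by
      have := Set.ncard_insert_le x {mate y}
      rw [Set.ncard_singleton] at this
      omega)
    simp only [Set.mem_insert_iff, Set.mem_singleton_iff, not_or] at haX
    have h1 := hT p (by simp) x a (Ne.symm haX.1) (mem_region_singleton.2 ⟨hx, hxF⟩)
      (mem_region_singleton.2 ⟨ha, not_mem_deleted hae⟩)
    have h2 := ih (fun t ht => hT t (by simp [ht])) (x := mate a) ha' hy
      (mate_not_mem_deleted hae) (fun e => haX.2 (mate_eq_comm.1 e))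
    exact (h1.link hae h2 (by simpa using hp)).congr (by rw [Finset.insert_eq])

end Assembly

/-! ### Detours, insertions and bridges -/

section Detours

variable {m : ℕ} {F : List (Fault (SignedPermutation (m + 1)))}
  {S T : Finset (SignedSymbol (m + 1))} {s t p q : SignedSymbol (m + 1)}
  {x y a b : SignedPermutation (m + 1)} {X₁ X₂ : Set (SignedPermutation (m + 1))}

/-- Two paths that together span the copies in `S` are joined by a path that spans the copies in
`T`. -/
theorem HamPath.detour (h₁ : HamPath (live F) X₁ x a) (ha : a ∉ exposed F)
    (h : HamPath (live F) (region F T) (mate a) (mate b)) (hb : b ∉ exposed F)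
    (h₂ : HamPath (live F) X₂ b y) (e : region F S = X₁ ∪ X₂) (hd : Disjoint X₁ X₂)
    (hST : Disjoint S T) : HamPath (live F) (region F (S ∪ T)) x y := by
  have hd' : Disjoint (X₁ ∪ X₂) (region F T) := e ▸ region_disjoint hST
  rw [Set.disjoint_union_left] at hd'
  have := h₁.trans (live_adj_mate ha) (h.trans (live_adj_mate hb).symm h₂ hd'.2.symm)
    (Set.disjoint_union_right.2 ⟨hd'.1, hd⟩)
  refine this.congr ?_
  rw [← region_union, e]
  ext v
  simp only [Set.mem_union]
  tauto

/-- The bound behind the choice of exits from a copy. The copy has `2 * m * linkCount m` vertices,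
of which at most `2 * F.length` are exposed and `k * linkCount m` have their mates in `k` given
copies; every vertex to be avoided spoils two edges of a spanning path. -/
theorem four_mul_lt {k : ℕ} (hm : 3 ≤ m) (hl : F.length + 1 ≤ m)
    (hk : k ≤ 2 ∨ k ≤ 3 ∧ 4 ≤ m) :
    4 * F.length + 2 * (k * linkCount m) + 2 < 2 * m * linkCount m := by
  have h1 := le_linkCount hm
  obtain ⟨j, rfl⟩ : ∃ j, m = j + 3 := ⟨m - 3, by omega⟩
  have h2 : 8 * (j + 1) ≤ linkCount (j + 3) := by simpa using h1
  rcases hk with hk | ⟨hk, hm4⟩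
  · have h3 := Nat.mul_le_mul_right (linkCount (j + 3)) hk
    nlinarith
  · have h3 := Nat.mul_le_mul_right (linkCount (j + 3)) hk
    obtain ⟨i, rfl⟩ : ∃ i, j = i + 1 := ⟨j - 1, by omega⟩
    nlinarith

theorem length_add_lt (hm : 3 ≤ m) (hl : F.length + 1 ≤ m) : F.length + 2 < linkCount m := by
  have h1 := le_linkCount hm
  omega

theorem card_symbols (m : ℕ) : Fintype.card (SignedSymbol (m + 1)) = 2 * m + 2 := by
  simp [SignedSymbol]
  omega

theorem card_add_card_compl (S : Finset (SignedSymbol (m + 1))) : S.card + Sᶜ.card = 2 * m + 2 := by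
  rw [Finset.card_add_card_compl, card_symbols]

/-- At least five good copies are spanned by a path between any two vertices in different ones of
them. -/
theorem hamPath_region_of_copy_ne (hm : 3 ≤ m) (hF : Valid (burntPancake (m + 1)) F)
    (hl : F.length + 1 ≤ m) (hT : ∀ t ∈ T, Good F t) (hS : 5 ≤ T.card)
    (hx : x ∈ region F T) (hy : y ∈ region F T) (hxy : copy x ≠ copy y) :
    HamPath (live F) (region F T) x y :=
  (exists_route hS hx.1 hy.1 hxy).hamPath (by omega) hF (length_add_lt hm hl) hT rfl rfl hx.2 hy.2
    fun e => hxy (by rw [e])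

/-- If at most two copies are left out and the others are good, there is a spanning path of them
between any two of their vertices. -/
theorem hamPath_region (hm : 3 ≤ m) (hF : Valid (burntPancake (m + 1)) F)
    (hl : F.length + 1 ≤ m) (hT : ∀ t ∈ T, Good F t) (hS : Tᶜ.card ≤ 2)
    (hx : x ∈ region F T) (hy : y ∈ region F T) (hxy : x ≠ y) :
    HamPath (live F) (region F T) x y := by
  have hcard := card_add_card_compl T
  by_cases hc : copy x = copy y
  · have hg := hT _ hx.1 x y hxy (mem_region_singleton.2 ⟨rfl, hx.2⟩)
      (mem_region_singleton.2 ⟨hc.symm, hy.2⟩)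
    -- the spanning path of the common copy makes a detour through all the other copies
    have hnum := four_mul_lt hm hl (.inl hS)
    obtain ⟨a, b, X₁, X₂, e, hd, h1, -, h2, hca, hcb, hae, hbe, haS, hbS, hab⟩ :=
      hg.exists_cut_link (by omega) Tᶜ (by omega)
    rw [Finset.mem_compl, not_not] at haS hbS
    have hcard' := Finset.card_erase_of_mem hx.1
    have h := hamPath_region_of_copy_ne (T := T.erase (copy x)) (x := mate a) (y := mate b) hm hF hl
      (fun t ht => hT t (Finset.mem_of_mem_erase ht)) (by omega)
      ⟨Finset.mem_erase.2 ⟨hca ▸ cls_ne_copy (by omega) a, haS⟩, mate_not_mem_deleted hae⟩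
      ⟨Finset.mem_erase.2 ⟨hcb ▸ cls_ne_copy (by omega) b, hbS⟩, mate_not_mem_deleted hbe⟩ hab
    refine (h1.detour hae h hbe h2 e hd (by simp)).congr ?_
    rw [← Finset.insert_eq, Finset.insert_erase hx.1]
  · exact hamPath_region_of_copy_ne hm hF hl hT (by omega) hx hy hc

/-- A copy with a spanning cycle can be inserted into a spanning path of good copies. -/
theorem hamPath_insert (hm : 3 ≤ m) (hF : Valid (burntPancake (m + 1)) F)
    (hl : F.length + 1 ≤ m) (hT : ∀ r ∈ T, Good F r) (ht : t ∉ T)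
    (hc : HamCycle (live F) (region F {t})) (hS : Tᶜ.card ≤ 2 ∨ Tᶜ.card ≤ 3 ∧ 4 ≤ m)
    (hx : x ∈ region F T) (hy : y ∈ region F T) (hxy : copy x ≠ copy y) :
    HamPath (live F) (region F (insert t T)) x y := by
  have hcard := card_add_card_compl T
  have hcard' : ((insert (copy y) Tᶜ).erase t).card ≤ Tᶜ.card := by
    rw [Finset.card_erase_of_mem (by simp [ht])]
    have := Finset.card_insert_le (copy y) Tᶜ
    omega
  -- the cycle is opened at an edge whose ends have their mates in copies in `T` other than that
  -- of `y`
  obtain ⟨a, b, hab, hca, hcb, hae, hbe, haS, hbS, hne, hax, hbx⟩ :=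
    hc.exists_cut_link (by omega) ((insert (copy y) Tᶜ).erase t) x
      (four_mul_lt hm hl (by omega))
  have hat : cls a ≠ t := hca ▸ cls_ne_copy (by omega) a
  have hbt : cls b ≠ t := hcb ▸ cls_ne_copy (by omega) b
  simp only [Finset.mem_erase, Finset.mem_insert, Finset.mem_compl, not_and_or, not_or, not_not,
    hat, hbt, false_or, ne_eq] at haS hbS
  have hmem : ∀ {a}, a ∉ exposed F → cls a ∈ T → mate a ∈ region F T := fun hae haT =>
    ⟨haT, mate_not_mem_deleted hae⟩
  -- the copy of `x` is followed by `t`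
  have key : ∀ {a b}, HamPath (live F) (region F {t}) a b → a ∉ exposed F → b ∉ exposed F →
      cls b ≠ copy y → cls b ∈ T → cls a ≠ cls b → mate a ≠ x → cls a = copy x →
      HamPath (live F) (region F (insert t T)) x y := by
    intro a b hab hae hbe hby hbT hne hax hac
    have h1 := hT _ hx.1 x (mate a) (Ne.symm hax) (mem_region_singleton.2 ⟨rfl, hx.2⟩)
      (mem_region_singleton.2 ⟨hac, mate_not_mem_deleted hae⟩)
    have hce := Finset.card_erase_of_mem hx.1
    have h2 := hamPath_region_of_copy_ne (T := T.erase (copy x)) (x := mate b) (y := y) hm hF hl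
      (fun t ht => hT t (Finset.mem_of_mem_erase ht)) (by omega)
      ⟨Finset.mem_erase.2 ⟨fun e => hne (hac.trans e.symm), hbT⟩, mate_not_mem_deleted hbe⟩
      ⟨Finset.mem_erase.2 ⟨hxy.symm, hy.1⟩, hy.2⟩ hby
    have h3 := h1.link (by rwa [mate_mem_exposed]) (by rw [mate_mate]; exact hab)
      (Finset.disjoint_singleton.2 fun e : copy x = t => ht (e ▸ hx.1))
    refine (h3.link hbe h2 ?_).congr ?_
    · rw [Finset.disjoint_left]
      intro r hr hr'
      simp only [Finset.mem_union, Finset.mem_singleton, Finset.mem_erase] at hr hr'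
      rcases hr with rfl | rfl
      · exact hr'.1 rfl
      · exact ht hr'.2
    · rw [Finset.union_comm {copy x}, Finset.union_assoc, ← Finset.insert_eq (copy x),
        Finset.insert_erase hx.1, Finset.insert_eq]
  -- `t` joins a path that starts in `x` and a path that ends in `y`
  have key' : ∀ {a b} {T₁ T₂ : Finset (SignedSymbol (m + 1))},
      HamPath (live F) (region F {t}) a b → a ∉ exposed F → b ∉ exposed F →
      copy x ≠ cls a → cls b ≠ copy y → T = T₁ ∪ T₂ → Disjoint T₁ T₂ → Route T₁ (copy x) (cls a) →
      Route T₂ (cls b) (copy y) → HamPath (live F) (region F (insert t T)) x y := by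
    rintro a b T₁ T₂ hab hae hbe hax hby rfl hd h1 h2
    have h1 := h1.hamPath (by omega) hF (length_add_lt hm hl) (fun t ht => hT t (by simp [ht]))
      rfl (y := mate a) rfl hx.2 (mate_not_mem_deleted hae) (fun e => hax (by rw [e]; rfl))
    have h2 := h2.hamPath (by omega) hF (length_add_lt hm hl) (fun t ht => hT t (by simp [ht]))
      (x := mate b) rfl rfl (mate_not_mem_deleted hbe) hy.2 (fun e => hby (by rw [← e]; rfl))
    simp only [Finset.mem_union, not_or] at ht
    have h3 := h1.link (by rwa [mate_mem_exposed]) (by rw [mate_mate]; exact hab)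
      (Finset.disjoint_singleton_right.2 ht.1)
    refine (h3.link hbe h2 ?_).congr ?_
    · exact Finset.disjoint_union_left.2 ⟨hd, Finset.disjoint_singleton_left.2 ht.2⟩
    · rw [Finset.union_comm T₁, Finset.union_assoc, Finset.insert_eq]
  by_cases h1 : cls a = copy x
  · exact key hab hae hbe hbS.1 hbS.2 hne hax h1
  by_cases h2 : cls b = copy x
  · exact key hab.symm hbe hae haS.1 haS.2 (Ne.symm hne) hbx h2
  obtain ⟨T₁, T₂, hU, hd, h | h⟩ := exists_two_routes (T := T) (by omega) hx.1 hy.1 haS.2 hbS.2 hxy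
    (Ne.symm h1) (Ne.symm h2) (Ne.symm haS.1) (Ne.symm hbS.1) hne
  · exact key' hab hae hbe (Ne.symm h1) hbS.1 hU hd h.1 h.2
  · exact key' hab.symm hbe hae (Ne.symm h2) haS.1 hU hd h.1 h.2

/-- A spanning path with adjacent ends closes to a cycle: there are enough vertices. -/
theorem hamCycle_of_hamPath (hm : 3 ≤ m) (hl : F.length + 1 ≤ m)
    (h : HamPath (live F) (deleted F)ᶜ a b) (hba : (live F).Adj b a) :
    HamCycle (live F) (deleted F)ᶜ := by
  refine ⟨?_, a, b, h, hba⟩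
  have h1 := ncard_region (by omega) F ((0, false) : SignedSymbol (m + 1))
  have h2 := four_mul_lt (k := 0) hm hl (by omega)
  have h3 : (region F {((0, false) : SignedSymbol (m + 1))}).ncard ≤ (deleted F)ᶜ.ncard :=
    Set.ncard_le_ncard (fun v hv => hv.2) (Set.toFinite _)
  omega

/-- A spanning cycle from spanning paths of the copies in `S` and of the other copies. -/
theorem HamPath.hamCycle (hm : 3 ≤ m) (hl : F.length + 1 ≤ m)
    (h : HamPath (live F) (region F S) a b) (ha : a ∉ exposed F) (hb : b ∉ exposed F)
    (h' : HamPath (live F) (region F Sᶜ) (mate a) (mate b)) :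
    HamCycle (live F) (deleted F)ᶜ :=
  hamCycle_of_hamPath hm hl ((h'.symm.link (by rwa [mate_mem_exposed]) (by rw [mate_mate]; exact h)
    disjoint_compl_left).congr (by rw [Finset.union_comm, Finset.union_compl, region_univ]))
    (live_adj_mate hb)

end Detours

section Bridges

variable {m : ℕ} {F : List (Fault (SignedPermutation (m + 1)))}
  {T U : Finset (SignedSymbol (m + 1))} {s p p' : SignedSymbol (m + 1)}
  {y : SignedPermutation (m + 1)}

/-- The copy `s` can be inserted between any two copies in `T` that are linked with it and with
each other. -/
def IsBridge (F : List (Fault (SignedPermutation (m + 1)))) (T : Finset (SignedSymbol (m + 1)))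
    (s : SignedSymbol (m + 1)) : Prop :=
  ∀ c ∈ T, ∀ e ∈ T, c.1 ≠ s.1 → e.1 ≠ s.1 → c.1 ≠ e.1 →
    ∃ g h, HamPath (live F) (region F {s}) g h ∧ cls g = c ∧ cls h = e ∧ g ∉ exposed F ∧
      h ∉ exposed F

theorem IsBridge.mono (h : IsBridge F T s) (hU : U ⊆ T) : IsBridge F U s :=
  fun c hc e he => h c (hU hc) e (hU he)

/-- From every vertex of the copy `p` whose mate is outside the copies in `U` there is a path to
`y` that spans the copies in `T`. -/
def Reach (F : List (Fault (SignedPermutation (m + 1)))) (U T : Finset (SignedSymbol (m + 1)))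
    (p : SignedSymbol (m + 1)) (y : SignedPermutation (m + 1)) : Prop :=
  ∀ x, copy x = p → x ∉ deleted F → x ≠ y → cls x ∉ U → HamPath (live F) (region F T) x y

theorem Reach.single (hp : Good F p) (hy : copy y = p) (hyF : y ∉ deleted F) :
    Reach F ∅ {p} p y := fun x hx hxF hxy _ =>
  hp x y hxy (mem_region_singleton.2 ⟨hx, hxF⟩) (mem_region_singleton.2 ⟨hy, hyF⟩)

theorem Reach.step (hm : 3 ≤ m) (hF : Valid (burntPancake (m + 1)) F)
    (hl : F.length + 1 ≤ m) (h : Reach F U T p' y) (hpU : p ∉ U) (hpT : p ∉ T) (hpp : p.1 ≠ p'.1)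
    (hp : Good F p) : Reach F ∅ (insert p T) p y := by
  intro x hx hxF hxy _
  obtain ⟨a, ha, ha', hae, haX⟩ := exists_link (by omega) hF hpp {x, mate y} (by
    have h1 := Set.ncard_insert_le x {mate y}
    have h2 := length_add_lt hm hl
    rw [Set.ncard_singleton] at h1
    omega)
  simp only [Set.mem_insert_iff, Set.mem_singleton_iff, not_or] at haX
  have h1 := hp x a (Ne.symm haX.1) (mem_region_singleton.2 ⟨hx, hxF⟩)
    (mem_region_singleton.2 ⟨ha, not_mem_deleted hae⟩)
  have h2 := h (mate a) ha' (mate_not_mem_deleted hae) (fun e => haX.2 (mate_eq_comm.1 e))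
    (by rwa [cls_mate, ha])
  exact (h1.link hae h2 (by simpa using hpT)).congr (by rw [Finset.insert_eq])

/-- The path passes through the bridge `s` on its way from the copy `p` to the copy `p'`. -/
theorem Reach.bridge {T' : Finset (SignedSymbol (m + 1))} (h : Reach F U T p' y)
    (hs : IsBridge F T' s) (hpT' : p ∈ T') (hpT'' : p' ∈ T') (hsU : s ∉ U)
    (hsT : s ∉ T) (hsp : p.1 ≠ s.1) (hsp' : p'.1 ≠ s.1) (hy : copy y = p' → cls y ≠ s) (hpT : p ∉ T)
    (hpp : p.1 ≠ p'.1) (hp : Good F p) : Reach F {s} (insert p (insert s T)) p y := by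
  intro x hx hxF hxy hxs
  obtain ⟨g, k, hgk, hg, hk, hge, hke⟩ := hs p hpT' p' hpT'' hsp hsp' hpp
  have hgs : copy g = s := (mem_region_singleton.1 hgk.left_mem).1
  have hks : copy k = s := (mem_region_singleton.1 hgk.right_mem).1
  have h1 := hp x (mate g) (by rintro rfl; exact hxs (by simp [hgs]))
    (mem_region_singleton.2 ⟨hx, hxF⟩) (mem_region_singleton.2 ⟨hg, mate_not_mem_deleted hge⟩)
  have h2 := h (mate k) hk (mate_not_mem_deleted hke)
    (by rintro rfl; exact hy hk (by simp [hks])) (by simpa [hks])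
  have h3 := hgk.link hke h2 (by simpa using hsT)
  refine (h1.link (by rwa [mate_mem_exposed]) (by rw [mate_mate]; exact h3) ?_).congr ?_
  · rw [Finset.disjoint_singleton_left, Finset.mem_union, Finset.mem_singleton]
    rintro (rfl | h)
    · exact hsp rfl
    · exact hpT h
  · rw [Finset.insert_eq, Finset.insert_eq]

/-- In a sequence `p, a, b, c` two different elements can be put into different gaps between
consecutive terms, neither of them next to itself. -/
theorem exists_gaps {α : Type*} {p a b c s t : α} (hpb : p ≠ b) (hpc : p ≠ c)
    (hab : a ≠ b) (hac : a ≠ c) (hbc : b ≠ c) (hst : s ≠ t) :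
    (((p ≠ s ∧ a ≠ s) ∧ (a ≠ t ∧ b ≠ t)) ∨ ((p ≠ s ∧ a ≠ s) ∧ (b ≠ t ∧ c ≠ t)) ∨
      ((a ≠ s ∧ b ≠ s) ∧ (b ≠ t ∧ c ≠ t))) ∨
    (((p ≠ t ∧ a ≠ t) ∧ (a ≠ s ∧ b ≠ s)) ∨ ((p ≠ t ∧ a ≠ t) ∧ (b ≠ s ∧ c ≠ s)) ∨
      ((a ≠ t ∧ b ≠ t) ∧ (b ≠ s ∧ c ≠ s))) := by
  grind

set_option maxHeartbeats 400000 in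
/-- Two bridges can be inserted into a spanning path of five good copies. -/
theorem hamPath_two_bridges {t : SignedSymbol (m + 1)} {x : SignedPermutation (m + 1)}
    (hm : 3 ≤ m) (hF : Valid (burntPancake (m + 1)) F)
    (hl : F.length + 1 ≤ m) (hT : ∀ r ∈ T, Good F r) (hcard : T.card = 5) (hs : IsBridge F T s)
    (ht : IsBridge F T t) (hst : s ≠ t) (hsT : s ∉ T) (htT : t ∉ T)
    (hx : x ∈ region F T) (hy : y ∈ region F T) (hxy : copy x ≠ copy y) (hxs : cls x ≠ s)
    (hxt : cls x ≠ t) : HamPath (live F) (region F (insert s (insert t T))) x y := by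
  obtain ⟨a, b, c, hTe, hnd, h1, h2, h3, h4⟩ := exists_five hcard hx.1 hy.1 hxy
  have hne : ∀ {p q : SignedSymbol (m + 1)}, p ≠ q → q ≠ p.bar → p.1 ≠ q.1 := fun h1 h2 e => by
    rcases fst_eq_iff.1 e with h | h
    · exact h1 h
    · exact h2 (by rw [h, bar_bar])
  have hfst : ∀ {s r}, s ∉ T → r ∈ T → (r.1 = s.1 ↔ r = s.bar) := fun {s r} hs hr => by
    rw [fst_eq_iff]
    exact ⟨fun h => h.resolve_left (by rintro rfl; exact hs hr), .inr⟩
  simp only [List.nodup_cons, List.mem_cons, List.not_mem_nil, or_false, not_or] at hnd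
  obtain ⟨⟨hpa, hpb, hpc, hpq⟩, ⟨hab, hac, haq⟩, ⟨hbc, hbq⟩, hcq, -⟩ := hnd
  have hp' : copy x ∈ T := hx.1
  have ha' : a ∈ T := by simp [hTe]
  have hb' : b ∈ T := by simp [hTe]
  have hc' : c ∈ T := by simp [hTe]
  have hq' : copy y ∈ T := hy.1
  -- the path is built backwards from `y`; the bridge `t` comes later on it than the bridge `s`
  have key : ∀ {s t}, s ∉ T → t ∉ T → IsBridge F T s → IsBridge F T t → s ≠ t → cls x ≠ s →
      cls x ≠ t →
      (((copy x ≠ s.bar ∧ a ≠ s.bar) ∧ (a ≠ t.bar ∧ b ≠ t.bar)) ∨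
      ((copy x ≠ s.bar ∧ a ≠ s.bar) ∧ (b ≠ t.bar ∧ c ≠ t.bar)) ∨
      ((a ≠ s.bar ∧ b ≠ s.bar) ∧ (b ≠ t.bar ∧ c ≠ t.bar))) →
      HamPath (live F) (region F (insert s (insert t T))) x y := by
    intro s t hsT htT hs ht hst hxs hxt h
    have r0 : Reach F ∅ _ (copy y) y := .single (hT _ hq') rfl hy.2
    have r1 := r0.step hm hF hl (p := c) (by simp) (by simpa) (hne hcq h4) (hT c hc')
    simp only [ne_eq, ← hfst hsT, ← hfst htT, hp', ha', hb', hc'] at h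
    have hsT' := hsT
    have htT' := htT
    simp only [hTe, Finset.mem_insert, Finset.mem_singleton, not_or] at hsT' htT'
    obtain ⟨hsp, hsa, hsb, hsc, hsq⟩ := hsT'
    obtain ⟨htp, hta, htb, htc, htq⟩ := htT'
    have hfin : ∀ {U T'}, Reach F U T' (copy x) y → cls x ∉ U → T' = insert s (insert t T) →
        HamPath (live F) (region F (insert s (insert t T))) x y := by
      rintro U _ hr hU rfl
      exact hr x rfl hx.2 (by rintro rfl; exact hxy rfl) hU
    rcases h with ⟨⟨i1, i2⟩, i3, i4⟩ | ⟨⟨i1, i2⟩, i3, i4⟩ | ⟨⟨i1, i2⟩, i3, i4⟩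
    · -- `s` between `copy x` and `a`, and `t` between `a` and `b`
      have r2 := r1.step hm hF hl (p := b) (by simp) (by simp [*]) (hne hbc h3) (hT b hb')
      have r3 := r2.bridge ht ha' hb' (p := a) (by simp) (by simp [*]) i3 i4
        (fun e => absurd e.symm hbq) (by simp [*]) (hne hab h2) (hT a ha')
      have r4 := r3.bridge hs hp' ha' (p := copy x) (by simp [hst]) (by simp [*]) i1 i2
        (fun e => absurd e.symm haq) (by simp [*, Ne.symm htp]) (hne hpa h1) (hT _ hp')
      refine hfin r4 (by simpa) ?_
      rw [hTe]
      simp only [Finset.insert_comm]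
    · -- `s` between `copy x` and `a`, and `t` between `b` and `c`
      have r2 := r1.bridge ht hb' hc' (p := b) (by simp) (by simp [*]) i3 i4
        (fun e => absurd e.symm hcq) (by simp [*]) (hne hbc h3) (hT b hb')
      have r3 := r2.step hm hF hl (p := a) (by simpa using Ne.symm hta) (by simp [*, Ne.symm hta])
        (hne hab h2) (hT a ha')
      have r4 := r3.bridge hs hp' ha' (p := copy x) (by simp) (by simp [*]) i1 i2
        (fun e => absurd e.symm haq) (by simp [*, Ne.symm htp]) (hne hpa h1) (hT _ hp')
      refine hfin r4 (by simpa) ?_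
      rw [hTe]
      simp only [Finset.insert_comm]
    · -- `s` between `a` and `b`, and `t` between `b` and `c`
      have r2 := r1.bridge ht hb' hc' (p := b) (by simp) (by simp [*]) i3 i4
        (fun e => absurd e.symm hcq) (by simp [*]) (hne hbc h3) (hT b hb')
      have r3 := r2.bridge hs ha' hb' (p := a) (by simp [hst]) (by simp [*]) i1 i2
        (fun e => absurd e.symm hbq) (by simp [*, Ne.symm hta]) (hne hab h2) (hT a ha')
      have r4 := r3.step hm hF hl (p := copy x) (by simpa using Ne.symm hsp)
        (by simp [*, Ne.symm htp, Ne.symm hsp]) (hne hpa h1) (hT _ hp')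
      refine hfin r4 (by simp) ?_
      rw [hTe]
      simp only [Finset.insert_comm]
  have hbar : s.bar ≠ t.bar := fun e => hst (bar_inj.1 e)
  have hdich := exists_gaps hpb hpc hab hac hbc (s := s.bar) (t := t.bar)
    fun e => hst (bar_inj.1 e)
  rcases hdich with h | h
  · exact key hsT htT hs ht hst hxs hxt h
  · rw [Finset.insert_comm]
    exact key htT hsT ht hs (Ne.symm hst) hxt hxs h

end Bridges

/-! ### Certificates in dimension three -/

section Certificates

/-- The code of a symbol of `[3]`, a number below six. -/
def symbolCode (s : SignedSymbol 3) : ℕ := 2 * s.1.1 + s.2.toNat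

/-- The code of a signed permutation of length three: its letters are the digits in base six. -/
def code (v : SignedPermutation 3) : ℕ :=
  symbolCode (v.1 0) + 6 * symbolCode (v.1 1) + 36 * symbolCode (v.1 2)

/-- The action on codes of the reversal of the prefix of length `k + 1`. -/
def stepCode (k c : ℕ) : ℕ :=
  match k with
  | 0 => (c % 6 ^^^ 1) + 6 * (c / 6 % 6) + 36 * (c / 36)
  | 1 => (c / 6 % 6 ^^^ 1) + 6 * (c % 6 ^^^ 1) + 36 * (c / 36)
  | _ => (c / 36 ^^^ 1) + 6 * (c / 6 % 6 ^^^ 1) + 36 * (c % 6 ^^^ 1)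

theorem symbolCode_lt (s : SignedSymbol 3) : symbolCode s < 6 := by
  revert s
  decide

theorem symbolCode_bar (s : SignedSymbol 3) : symbolCode s.bar = symbolCode s ^^^ 1 := by
  revert s
  decide

theorem symbolCode_injective : Function.Injective symbolCode := by
  intro s t
  revert s t
  decide

theorem code_digits (v : SignedPermutation 3) : code v % 6 = symbolCode (v.1 0) ∧
    code v / 6 % 6 = symbolCode (v.1 1) ∧ code v / 36 = symbolCode (v.1 2) := by
  have h0 := symbolCode_lt (v.1 0)
  have h1 := symbolCode_lt (v.1 1)
  have h2 := symbolCode_lt (v.1 2)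
  simp only [code]
  omega

theorem code_injective : Function.Injective code := by
  intro v w h
  have hv := code_digits v
  rw [h] at hv
  have hw := code_digits w
  ext1
  funext i
  apply symbolCode_injective
  fin_cases i
  · exact hv.1.symm.trans hw.1
  · exact hv.2.1.symm.trans hw.2.1
  · exact hv.2.2.symm.trans hw.2.2

theorem code_prefixReversal (k : Fin 3) (v : SignedPermutation 3) :
    code (prefixReversal k v) = stepCode k.1 (code v) := by
  obtain ⟨h0, h1, h2⟩ := code_digits v
  fin_cases k
  · change code (prefixReversal 0 v) = stepCode 0 (code v)
    simp only [stepCode, h0, h1, h2]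
    simp [code, prefixReversal, prefixReversalWord, symbolCode_bar]
  · change code (prefixReversal 1 v) = stepCode 1 (code v)
    simp only [stepCode, h0, h1, h2]
    simp [code, prefixReversal, prefixReversalWord, symbolCode_bar]
  · change code (prefixReversal 2 v) = stepCode 2 (code v)
    simp only [stepCode, h0, h1, h2]
    simp [code, prefixReversal, prefixReversalWord, symbolCode_bar]

/-- The base three digits of `w`, read from the last one, are the reversals made along a walk of
length `l` from the vertex with code `c`. The value is `true` if the walk ends in the vertex with
code `d` and visits each vertex whose code is the position of a binary digit `1` of `X` exactly
once, and no other vertices. -/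
def isSpanning : (l w c X d : ℕ) → Bool
  | 0, _, c, X, d => c == d && X == 2 ^ c
  | l + 1, w, c, X, d =>
    X.testBit c && isSpanning l (w / 3) (stepCode (w % 3) c) (X ^^^ 2 ^ c) d

/-- A certificate accepted by `isSpanning` yields a spanning path of the vertices whose codes it
prescribes. -/
theorem hamPath_of_isSpanning {l w X d : ℕ} {x : SignedPermutation 3}
    (h : isSpanning l w (code x) X d = true) :
    ∃ y, code y = d ∧ HamPath (burntPancake 3) {v | X.testBit (code v) = true} x y := by
  induction l generalizing w X x with
  | zero =>
    simp only [isSpanning, Bool.and_eq_true, beq_iff_eq] at h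
    obtain ⟨rfl, rfl⟩ := h
    refine ⟨x, rfl, (HamPath.single x).congr ?_⟩
    ext v
    rw [Set.mem_singleton_iff, Set.mem_ofPred_eq, Nat.testBit_two_pow, decide_eq_true_eq]
    exact ⟨fun h => by rw [h], fun h => code_injective h.symm⟩
  | succ l ih =>
    simp only [isSpanning, Bool.and_eq_true] at h
    have hk : w % 3 < 3 := Nat.mod_lt _ (by norm_num)
    rw [← code_prefixReversal ⟨w % 3, hk⟩ x] at h
    obtain ⟨y, hy, hp⟩ := ih h.2
    have hadj : (burntPancake 3).Adj x (prefixReversal ⟨w % 3, hk⟩ x) := ⟨_, rfl⟩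
    refine ⟨y, hy, (hp.cons hadj ?_).congr ?_⟩
    · simp [Nat.testBit_xor, h.1]
    · ext v
      simp only [Set.mem_insert_iff, Set.mem_ofPred_eq, Nat.testBit_xor, Nat.testBit_two_pow]
      by_cases hv : v = x
      · simp [hv, h.1]
      · have : code x ≠ code v := fun h => hv (code_injective h.symm)
        simp [hv, this]

/-- The signed permutation without bars in increasing order. -/
def identity : SignedPermutation 3 := ⟨fun i => (i, false), fun _ _ h => h⟩

theorem code_identity : code identity = 156 := by decide

/-- The number whose binary digits `1` are in the positions given by the codes of the signed
permutations of length three. -/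
def allCodes : ℕ := 1225230184940107589105405678714994925784245761203290213908480

theorem testBit_allCodes (v : SignedPermutation 3) : allCodes.testBit (code v) = true := by
  have h : ∀ a b c : SignedSymbol 3, a.1 ≠ b.1 → a.1 ≠ c.1 → b.1 ≠ c.1 →
      allCodes.testBit (symbolCode a + 6 * symbolCode b + 36 * symbolCode c) = true := by
    decide +kernel
  exact h _ _ _ (fun h => absurd (letter_eq h) (by decide))
    (fun h => absurd (letter_eq h) (by decide)) (fun h => absurd (letter_eq h) (by decide))

/-- Ends of spanning paths that start in the identity, and the walks to them. -/
def spanningPaths : List (ℕ × ℕ) :=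
  [(192, 18835432429257381499068), (162, 18835435569120674293272),
    (198, 10035083511309224050347), (157, 18835094561901755758894), (193, 9977898128406903766749),
    (163, 18835694757750958466601), (199, 5048314079054435436468), (96, 11072117521075684216737),
    (132, 11202033994791895799274), (102, 21095988516410985985188),
    (138, 21052185342434649620265), (97, 3797757726255827260644), (133, 10627429111755059266743),
    (103, 3369204159945168733581), (139, 21052479966935940780312), (146, 23019306593769950089161),
    (182, 5048311454824023140952), (152, 7028671816140855384558), (188, 10034640078577765996899),
    (147, 18906699311178855993636), (183, 3377319417442907510997), (153, 20086174165047146696559),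
    (189, 3327655122302763712602), (26, 10081125061665980543211), (62, 11444987181840023105328),
    (32, 21051842282099474924388), (68, 7090951884940882350327), (27, 10112654905113145733436),
    (63, 9977897973894400755255), (33, 9978911575937706301149), (69, 3515109115399086312894),
    (76, 22773015532034826118815), (112, 5157272820166492546380), (82, 3651908801436374612322),
    (118, 3369205393986906269841), (77, 20283574309728093714198), (113, 7080893777226433513557),
    (83, 7017314391261241240935), (119, 15141417332270826909414), (16, 3369202769756493974325),
    (52, 5316161482825848434874), (22, 3328668569833566247002), (58, 5055057074459595475713),
    (17, 6278364871135348142208), (53, 15893330432146668119181), (23, 10080417627352691885451),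
    (59, 3327654967790260701108)]

/-- Spanning paths of the vertices other than the identity between two of its neighbours. -/
def puncturedPaths : List (ℕ × ℕ × ℕ) :=
  [(1, 2, 2360297925742144504701), (0, 2, 1109218322596753567036),
    (0, 1, 6695391388349048898853)]

/-- Spanning cycles of the vertices other than the identity and one of its neighbours: the
reversal that gives the neighbour, the start of the cycle, the reversal that leads to its last
vertex, and the walk. -/
def puncturedCycles : List (ℕ × ℕ × ℕ × ℕ) :=
  [(0, 192, 0, 1718840772315182982466), (1, 192, 0, 2229684305210693514640),
    (2, 192, 0, 1109556190077903545648)]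

/-- Spanning paths of the vertices other than the identity: the two ends, which have all pairs of
first letters that are possible for adjacent vertices, and the walk. -/
def typedPaths : List (ℕ × ℕ × ℕ) :=
  [(189, 192, 2530332676748419796982), (198, 188, 1265918977377880099212),
    (182, 199, 1125428566336709021682), (82, 183, 1109818520665467790845),
    (96, 83, 2092854973330052220300), (33, 97, 1217310343664728146247),
    (27, 17, 1686370405256564208366), (23, 26, 1172145391656562811588),
    (157, 23, 3345027837103021302505), (58, 68, 1218187910455576816836),
    (76, 103, 2092789498615481159556), (118, 138, 1229594037247735326696)]

/-- Spanning paths of the vertices other than the identity and a second vertex whose first letter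
is different: the second vertex, the ends of the path and the walk. The first letters of the ends
and of the missing vertices are distinct. -/
def twoHolePaths : List (ℕ × ℕ × ℕ × ℕ) :=
  [(157, 146, 147, 2229442337376898067278), (193, 146, 147, 1706896042987290065452),
    (163, 146, 147, 1764474387092281993286), (199, 146, 147, 1765175384336642804584),
    (97, 146, 147, 1682366997068861490514), (133, 146, 147, 1764474387092282652310),
    (103, 146, 147, 1706896040452399788076), (139, 146, 147, 1764472546798836156460),
    (146, 157, 147, 2231928139159850178467), (182, 157, 147, 722340976806998141213),
    (152, 157, 153, 2342890605380285128186), (188, 157, 147, 2232178151986847198873),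
    (147, 157, 146, 2166935312198369185382), (183, 157, 146, 2557950947507630508550),
    (153, 157, 146, 1187906003866818836926), (189, 157, 146, 1838773675425747125878),
    (26, 157, 147, 2361848776275014736779), (62, 157, 59, 860683020729174003133),
    (32, 157, 147, 373404198156484295027), (68, 157, 147, 2233798091363841007349),
    (27, 157, 146, 2342890654970166877912), (63, 157, 146, 1765284130433716975834),
    (33, 157, 146, 1123577185373216369890), (69, 157, 146, 2253758776260815609836),
    (76, 157, 146, 2099731035667267088656), (112, 157, 146, 1232486718853046142418),
    (82, 157, 146, 2203495632336378602446), (118, 157, 146, 2339395806843405725380),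
    (77, 157, 153, 852566023474363840780), (113, 157, 146, 2100744427911597632536),
    (83, 157, 182, 2161033267230821429173), (119, 157, 146, 1121720702217327040606),
    (16, 157, 146, 2099731038485047421776), (52, 157, 146, 2384516645136997208818),
    (22, 157, 146, 699997670631557133746), (58, 157, 59, 1685019024819865158571),
    (17, 157, 146, 1121463406591340277886), (53, 157, 146, 2107868654663514037726),
    (23, 157, 146, 2544439726079022277186), (59, 157, 146, 1248968599964565660808)]

/-- The symbol with a given code. -/
def decodeSymbol (d : ℕ) : SignedSymbol 3 := (Fin.ofNat 3 (d / 2), d % 2 == 1)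

theorem exists_code_eq {c : ℕ} (hc : allCodes.testBit c = true) : ∃ v, code v = c := by
  have h : ∀ c < 216, allCodes.testBit c = true →
      (Function.Injective fun i => (![decodeSymbol (c % 6), decodeSymbol (c / 6 % 6),
        decodeSymbol (c / 36)] i).1) ∧ symbolCode (decodeSymbol (c % 6)) +
        6 * symbolCode (decodeSymbol (c / 6 % 6)) +
        36 * symbolCode (decodeSymbol (c / 36)) = c := by
    decide +kernel
  have h216 : c < 216 := by
    by_contra h'
    have h1 : allCodes < 2 ^ c :=
      lt_of_lt_of_le (b := 2 ^ 216) (by decide +kernel)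
        (Nat.pow_le_pow_right (by norm_num) (by omega))
    rw [Nat.testBit_lt_two_pow h1] at hc
    cases hc
  obtain ⟨h1, h2⟩ := h c h216 hc
  exact ⟨⟨_, h1⟩, h2⟩

theorem code_lt (v : SignedPermutation 3) : code v < 216 := by
  have h0 := symbolCode_lt (v.1 0)
  have h1 := symbolCode_lt (v.1 1)
  have h2 := symbolCode_lt (v.1 2)
  simp only [code]
  omega

/-- The form in which certificates are used: the walk spans the vertices whose codes are not marked
in `X`, and starts in one of them. -/
theorem exists_of_isSpanning {l w c X d : ℕ}
    (h : isSpanning l w c (allCodes ^^^ X) d = true) (hc : X.testBit c = false) :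
    ∃ x y, code x = c ∧ code y = d ∧
      HamPath (burntPancake 3) {v | X.testBit (code v) = false} x y := by
  have h' : allCodes.testBit c = true := by
    have : (allCodes ^^^ X).testBit c = true := by
      cases l with
      | zero =>
        simp only [isSpanning, Bool.and_eq_true, beq_iff_eq] at h
        simp [h.2]
      | succ l =>
        simp only [isSpanning, Bool.and_eq_true] at h
        exact h.1
    simpa [Nat.testBit_xor, hc] using this
  obtain ⟨x, rfl⟩ := exists_code_eq h'
  obtain ⟨y, hy, hp⟩ := hamPath_of_isSpanning h
  refine ⟨x, y, rfl, hy, hp.congr ?_⟩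
  ext v
  simp [Nat.testBit_xor, testBit_allCodes]

theorem hole_eq {f : SignedPermutation 3} :
    {v | (2 ^ code f).testBit (code v) = false} = {f}ᶜ := by
  ext v
  simp only [Set.mem_ofPred_eq, Nat.testBit_two_pow, decide_eq_false_iff_not, Set.mem_compl_iff,
    Set.mem_singleton_iff, code_injective.eq_iff, eq_comm (a := f)]

theorem holes_eq {f f' : SignedPermutation 3} (h : f ≠ f') :
    {v | (2 ^ code f ^^^ 2 ^ code f').testBit (code v) = false} = {f, f'}ᶜ := by
  ext v
  simp only [Set.mem_ofPred_eq, Nat.testBit_xor, Nat.testBit_two_pow, Set.mem_compl_iff,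
    Set.mem_insert_iff, Set.mem_singleton_iff, code_injective.eq_iff, eq_comm (a := f),
    eq_comm (a := f')]
  by_cases h1 : v = f <;> by_cases h2 : v = f' <;> simp [h1, h2] <;> grind

/-- The graph of dimension three is vertex-transitive, so that one vertex of a certificate can be
taken to be the identity. -/
theorem exists_relabel_identity (v : SignedPermutation 3) : ∃ σ β, relabel σ β identity = v := by
  refine ⟨Equiv.ofBijective (fun i => (v.1 i).1) (Finite.injective_iff_bijective.1 v.2),
    fun i => (v.1 i).2, ?_⟩
  ext1
  funext i
  simp [relabel, relabelSymbol, identity]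

theorem HamPath.relabel {X : Set (SignedPermutation 3)} {x y : SignedPermutation 3}
    (σ : Equiv.Perm (Fin 3)) (β : Fin 3 → Bool) (h : HamPath (burntPancake 3) Xᶜ x y) :
    HamPath (burntPancake 3) (BurntPancake.relabel σ β '' X)ᶜ (BurntPancake.relabel σ β x)
      (BurntPancake.relabel σ β y) :=
  (h.map (relabel_injective σ β) fun _ _ => relabel_adj σ β).congr
    (Set.image_compl_eq (Finite.injective_iff_bijective.1 (relabel_injective σ β)))

/-- The burnt pancake graph of dimension three is Hamiltonian-connected. -/
theorem exists_path_three {x y : SignedPermutation 3} (hxy : x ≠ y) :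
    HamPath (burntPancake 3) Set.univ x y := by
  obtain ⟨σ, β, rfl⟩ := exists_relabel_identity x
  obtain ⟨y, rfl⟩ := (Finite.injective_iff_surjective.1 (relabel_injective σ β)) y
  have key : ∀ c < 216, allCodes.testBit c = true → c ≠ 156 → ∃ t ∈ spanningPaths, t.1 = c ∧
      isSpanning 47 t.2 156 (allCodes ^^^ 0) c = true := by
    decide +kernel
  obtain ⟨t, -, -, ht⟩ := key (code y) (code_lt y) (testBit_allCodes y) (by
    rw [← code_identity, Ne, code_injective.eq_iff]
    rintro rfl
    exact hxy rfl)
  obtain ⟨x', y', hx, hy, h⟩ := exists_of_isSpanning ht (by simp)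
  rw [← code_identity] at hx
  obtain rfl := code_injective hx
  obtain rfl := code_injective hy
  have h := (h.congr (Y := ∅ᶜ) (by simp)).relabel σ β
  simpa using h

/-- For every vertex, the other vertices are spanned by a path between two of its three neighbours,
of which one can be excluded. -/
theorem exists_path_neighbors (x : SignedPermutation 3) (k : Fin 3) :
    ∃ i j, i ≠ k ∧ j ≠ k ∧ i ≠ j ∧
      HamPath (burntPancake 3) {x}ᶜ (prefixReversal i x) (prefixReversal j x) := by
  obtain ⟨σ, β, rfl⟩ := exists_relabel_identity x
  have key : ∀ k : Fin 3, ∃ t ∈ puncturedPaths, ∃ (hi : t.1 < 3) (hj : t.2.1 < 3), t.1 ≠ k ∧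
      t.2.1 ≠ k ∧ t.1 ≠ t.2.1 ∧ isSpanning 46 t.2.2 (stepCode t.1 156)
        (allCodes ^^^ 2 ^ 156) (stepCode t.2.1 156) = true ∧
      (2 ^ 156).testBit (stepCode t.1 156) = false := by
    decide +kernel
  obtain ⟨⟨i, j, w⟩, -, hi, hj, hik, hjk, hij, h, h'⟩ := key k
  refine ⟨⟨i, hi⟩, ⟨j, hj⟩, fun e => hik (by simp [← e]), fun e => hjk (by simp [← e]),
    fun e => hij (by simpa using e), ?_⟩
  obtain ⟨x', y', hx, hy, h⟩ := exists_of_isSpanning h h'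
  rw [← code_identity] at hx hy h
  rw [← code_prefixReversal ⟨i, hi⟩] at hx
  rw [← code_prefixReversal ⟨j, hj⟩] at hy
  obtain rfl := code_injective hx
  obtain rfl := code_injective hy
  have h := (h.congr hole_eq).relabel σ β
  rw [Set.image_singleton] at h
  rwa [prefixReversal_relabel, prefixReversal_relabel]

/-- The vertices outside an edge are spanned by a cycle. -/
theorem exists_cycle_outside_pair (x : SignedPermutation 3) (k : Fin 3) :
    ∃ a b, HamPath (burntPancake 3) {x, prefixReversal k x}ᶜ a b ∧ (burntPancake 3).Adj a b := by
  obtain ⟨σ, β, rfl⟩ := exists_relabel_identity x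
  have key : ∀ k : Fin 3, ∃ t ∈ puncturedCycles, ∃ hl : t.2.2.1 < 3, t.1 = k.1 ∧
      isSpanning 45 t.2.2.2 t.2.1 (allCodes ^^^ (2 ^ 156 ^^^ 2 ^ stepCode k.1 156))
        (stepCode t.2.2.1 t.2.1) = true ∧
      (2 ^ 156 ^^^ 2 ^ stepCode k.1 156).testBit t.2.1 = false := by
    decide +kernel
  obtain ⟨⟨_, c, l, w⟩, -, hl, -, h, h'⟩ := key k
  obtain ⟨x', y', hx, hy, h⟩ := exists_of_isSpanning h h'
  simp only at hx hy hl
  rw [← hx, ← code_prefixReversal ⟨l, hl⟩] at hy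
  obtain rfl := code_injective hy
  rw [← code_identity, ← code_prefixReversal] at h
  have h := (h.congr (holes_eq (prefixReversal_ne k identity).symm)).relabel σ β
  rw [Set.image_pair, ← prefixReversal_relabel] at h
  exact ⟨_, _, h, relabel_adj σ β ⟨_, rfl⟩⟩

theorem exists_relabelSymbol_eq (σ : Equiv.Perm (Fin 3)) (β : Fin 3 → Bool) (s : SignedSymbol 3) :
    ∃ s', relabelSymbol σ β s' = s :=
  (Finite.injective_iff_surjective.1 (relabelSymbol_injective σ β)) s

theorem relabelSymbol_fst_ne {σ : Equiv.Perm (Fin 3)} {β : Fin 3 → Bool} {s t : SignedSymbol 3}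
    (h : (relabelSymbol σ β s).1 ≠ (relabelSymbol σ β t).1) : s.1 ≠ t.1 :=
  fun e => h (by simp [relabelSymbol, e])

/-- The vertices other than `f` are spanned by a cycle that has an edge whose ends have prescribed
first letters. -/
theorem exists_path_typed (f : SignedPermutation 3) {c e : SignedSymbol 3} (hce : c.1 ≠ e.1) :
    ∃ g h, HamPath (burntPancake 3) {f}ᶜ g h ∧ (burntPancake 3).Adj g h ∧ g.1 0 = c ∧
      h.1 0 = e := by
  obtain ⟨σ, β, rfl⟩ := exists_relabel_identity f
  obtain ⟨c, rfl⟩ := exists_relabelSymbol_eq σ β c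
  obtain ⟨e, rfl⟩ := exists_relabelSymbol_eq σ β e
  have key : ∀ c e : SignedSymbol 3, c.1 ≠ e.1 → ∃ t ∈ typedPaths,
      ((t.1 % 6 = symbolCode c ∧ t.2.1 % 6 = symbolCode e) ∨
      (t.1 % 6 = symbolCode e ∧ t.2.1 % 6 = symbolCode c)) ∧
      isSpanning 46 t.2.2 t.1 (allCodes ^^^ 2 ^ 156) t.2.1 = true ∧
      (2 ^ 156).testBit t.1 = false ∧ ∃ l : Fin 3, t.2.1 = stepCode l.1 t.1 := by
    decide +kernel
  obtain ⟨⟨c', e', w⟩, -, ht, hs, h', l, hl⟩ := key c e (relabelSymbol_fst_ne hce)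
  obtain ⟨x, y, rfl, rfl, h⟩ := exists_of_isSpanning hs h'
  rw [← code_identity] at h
  have h := (h.congr hole_eq).relabel σ β
  rw [Set.image_singleton] at h
  rw [← code_prefixReversal, code_injective.eq_iff] at hl
  have hadj := relabel_adj σ β (v := x) (w := y) ⟨l, hl⟩
  simp only [(code_digits _).1, symbolCode_injective.eq_iff] at ht
  rcases ht with ⟨h1, h2⟩ | ⟨h1, h2⟩
  · exact ⟨_, _, h, hadj, congrArg (relabelSymbol σ β) h1, congrArg (relabelSymbol σ β) h2⟩
  · exact ⟨_, _, h.symm, hadj.symm, congrArg (relabelSymbol σ β) h2,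
      congrArg (relabelSymbol σ β) h1⟩

/-- The vertices other than two with different first letters are spanned by a path such that the
first letters of its ends and of the two missing vertices are distinct. -/
theorem exists_path_two_holes {f f' : SignedPermutation 3} (hff : f.1 0 ≠ f'.1 0) :
    ∃ g h, HamPath (burntPancake 3) {f, f'}ᶜ g h ∧ g.1 0 ≠ h.1 0 ∧ g.1 0 ≠ f.1 0 ∧
      g.1 0 ≠ f'.1 0 ∧ h.1 0 ≠ f.1 0 ∧ h.1 0 ≠ f'.1 0 := by
  obtain ⟨σ, β, rfl⟩ := exists_relabel_identity f
  obtain ⟨f, rfl⟩ := (Finite.injective_iff_surjective.1 (relabel_injective σ β)) f'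
  have hf : identity.1 0 ≠ f.1 0 := fun e => hff (congrArg (relabelSymbol σ β) e)
  have key : ∀ c < 216, allCodes.testBit c = true → 0 ≠ c % 6 → ∃ t ∈ twoHolePaths,
      t.1 = c ∧ isSpanning 45 t.2.2.2 t.2.1 (allCodes ^^^ (2 ^ 156 ^^^ 2 ^ c)) t.2.2.1 = true ∧
      (2 ^ 156 ^^^ 2 ^ c).testBit t.2.1 = false ∧
      [t.2.1 % 6, t.2.2.1 % 6, 0, c % 6].Nodup := by
    decide +kernel
  have h0 : (0 : ℕ) = symbolCode (identity.1 0) := by decide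
  obtain ⟨⟨_, c, d, w⟩, -, -, hs, h', ht⟩ := key (code f) (code_lt f) (testBit_allCodes f) (by
    rwa [(code_digits f).1, h0, Ne, symbolCode_injective.eq_iff])
  obtain ⟨x, y, rfl, rfl, h⟩ := exists_of_isSpanning hs h'
  rw [← code_identity] at h
  have h := (h.congr (holes_eq (by rintro rfl; exact hf rfl))).relabel σ β
  rw [Set.image_pair] at h
  rw [h0] at ht
  simp only [(code_digits _).1, List.nodup_cons, List.mem_cons, List.not_mem_nil, or_false, not_or,
    symbolCode_injective.eq_iff] at ht
  have hinj : ∀ {s t : SignedSymbol 3}, s ≠ t → relabelSymbol σ β s ≠ relabelSymbol σ β t :=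
    (relabelSymbol_injective σ β).ne
  exact ⟨_, _, h, hinj ht.1.1, hinj ht.1.2.1, hinj ht.1.2.2, hinj ht.2.1.1, hinj ht.2.1.2⟩

end Certificates

/-! ### Dimension three, and copies with missing vertices -/

section Three

theorem deleted_nil {V : Type*} : deleted ([] : List (Fault V)) = ∅ := by simp [deleted]

theorem cut_nil {V : Type*} : cut ([] : List (Fault V)) = ∅ := by simp [cut]

theorem three_le_ncard_compl {X : Set (SignedPermutation 3)} {a b : SignedPermutation 3}
    (h : X ⊆ {a, b}) : 3 ≤ Xᶜ.ncard := by
  have h1 : 16 ≤ Nat.card (SignedPermutation 3) := le_linkCount (m := 4) (by norm_num)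
  have h2 := Set.ncard_add_ncard_compl X
  have h3 := (Set.ncard_le_ncard h (Set.toFinite _)).trans (Set.ncard_insert_le a {b})
  rw [Set.ncard_singleton] at h3
  omega

theorem pathTolerant_three : PathTolerant 3 := by
  intro F _ hl x y hxy _ _
  obtain rfl : F = [] := List.length_eq_zero_iff.1 (by omega)
  rw [deleted_nil, Set.compl_empty]
  exact (exists_path_three hxy).mono fun u _ v _ h => live_adj.2 ⟨h, by simp [cut_nil]⟩

/-- If the only fault is an edge at `x`, a spanning cycle passes through `x` along the two other
edges. -/
theorem hamCycle_of_cut_subset {F : List (Fault (SignedPermutation 3))}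
    {x y : SignedPermutation 3} (hF : deleted F = ∅) (hc : cut F ⊆ {s(x, y)}) :
    HamCycle (live F) (deleted F)ᶜ := by
  obtain ⟨k, hk⟩ : ∃ k : Fin 3, ∀ i, prefixReversal i x = y → i = k := by
    by_cases h : ∃ k : Fin 3, prefixReversal k x = y
    · obtain ⟨k, rfl⟩ := h
      refine ⟨k, fun i hi => ?_⟩
      -- the first letter determines the length of the reversed prefix
      have h0 := congrArg (fun v : SignedPermutation 3 => (v.1 0).1) hi
      simp only [prefixReversal, prefixReversalWord, Fin.zero_le, if_true, bar_fst] at h0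
      have h1 := congrArg Fin.val (letter_eq h0)
      ext
      simpa using h1
    · exact ⟨0, fun i hi => absurd ⟨i, hi⟩ h⟩
  obtain ⟨i, j, hi, hj, -, h⟩ := exists_path_neighbors x k
  have hlive : ∀ {i}, i ≠ k → (live F).Adj x (prefixReversal i x) := fun {i} hik => by
    refine live_adj.2 ⟨⟨i, rfl⟩, fun h => hik (hk i ?_)⟩
    rcases Sym2.eq_iff.1 (hc h) with ⟨-, h⟩ | ⟨rfl, h⟩
    · exact h
    · exact h
  have h' : HamPath (live F) {x}ᶜ _ _ := h.mono fun u hu v hv huv => live_adj.2 ⟨huv, fun h => by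
    rcases Sym2.eq_iff.1 (hc h) with ⟨h, -⟩ | ⟨-, h⟩
    · exact hu h
    · exact hv h⟩
  refine ⟨three_le_ncard_compl (a := x) (b := x) (by simp [hF]), x, _,
    (h'.cons (hlive hi) (by simp)).congr ?_, (hlive hj).symm⟩
  rw [hF]
  ext v
  simp [em]

theorem cycleTolerant_three : CycleTolerant 3 := by
  intro F hF hl
  match F, hl with
  | [], _ =>
    exact hamCycle_of_cut_subset (x := identity) (y := identity) deleted_nil (by simp [cut_nil])
  | [.edge a b], _ =>
    exact hamCycle_of_cut_subset (x := a) (y := b) (by simp [deleted, Fault.verts])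
      (by simp [cut, Fault.edges])
  | [.vertex f], _ =>
    have hd : deleted [Fault.vertex f] = {f} := by simp [deleted, Fault.verts]
    obtain ⟨g, h, hp, hadj, -⟩ :=
      exists_path_typed f (c := (0, false)) (e := (1, false)) (by decide)
    have hlive : ∀ u v, (burntPancake 3).Adj u v → (live [Fault.vertex f]).Adj u v := fun u v h =>
      live_adj.2 ⟨h, by simp [cut, Fault.edges]⟩
    rw [hd]
    exact ⟨three_le_ncard_compl (a := f) (b := f) (by simp), g, h,
      hp.mono fun u _ v _ => hlive u v, (hlive _ _ hadj).symm⟩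
  | [.pair a b], _ =>
    have hd : deleted [Fault.pair a b] = {a, b} := by
      ext v
      simp [deleted, Fault.verts]
    obtain ⟨k, rfl⟩ : (burntPancake 3).Adj a b := hF.1 (.pair a b) (by simp)
    obtain ⟨g, h, hp, hadj⟩ := exists_cycle_outside_pair a k
    have hlive : ∀ u v, (burntPancake 3).Adj u v →
        (live [Fault.pair a (prefixReversal k a)]).Adj u v := fun u v h =>
      live_adj.2 ⟨h, by simp [cut, Fault.edges]⟩
    rw [hd]
    exact ⟨three_le_ncard_compl subset_rfl, g, h,
      hp.mono fun u _ v _ => hlive u v, (hlive _ _ hadj).symm⟩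
  | _ :: _ :: _, h => simp at h

end Three

section Four

variable {F : List (Fault (SignedPermutation 4))} {s t r : SignedSymbol 4}

/-- A path in a copy from a path in the graph of dimension three. -/
theorem HamPath.extend {X : Set (SignedPermutation 3)} {x y : SignedPermutation 3}
    (h : HamPath (burntPancake 3) Xᶜ x y)
    (hX : ∀ u, BurntPancake.extend s u ∈ deleted F ↔ u ∈ X)
    (hc : ∀ u v, s(BurntPancake.extend s u, BurntPancake.extend s v) ∉ cut F) :
    HamPath (live F) (region F {s}) (BurntPancake.extend s x) (BurntPancake.extend s y) := by
  refine (h.map (extend_injective s) fun u v huv =>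
    live_adj.2 ⟨(extend_adj_iff (by norm_num) s).2 huv, hc u v⟩).congr ?_
  ext v
  rw [mem_region_singleton]
  constructor
  · rintro ⟨u, hu, rfl⟩
    exact ⟨copy_extend s u, fun h => hu ((hX u).1 h)⟩
  · rintro ⟨hv, hvd⟩
    obtain ⟨u, rfl⟩ := exists_extend hv
    exact ⟨u, fun h => hvd ((hX u).2 h), rfl⟩

/-- A copy of dimension three with a single missing vertex is a bridge. -/
theorem isBridge_of_missing {T : Finset (SignedSymbol 4)} {f : SignedPermutation 4}
    (hf : copy f = s)
    (hd : ∀ v, copy v = s → (v ∈ deleted F ↔ v = f))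
    (hc : ∀ u v, copy u = s → copy v = s → s(u, v) ∉ cut F)
    (he : ∀ v, copy v = s → v ∉ deleted F → cls v ∈ T → v ∉ exposed F) : IsBridge F T s := by
  intro c hcT e heT hcs hes hce
  obtain ⟨f, rfl⟩ := exists_extend hf
  obtain ⟨c', hc'⟩ := exists_liftSymbol (s := s) (x := c.bar) hcs
  obtain ⟨e', he'⟩ := exists_liftSymbol (s := s) (x := e.bar) hes
  obtain ⟨g, h, hp, -, hg, hh⟩ := exists_path_typed f (c := c') (e := e') (fun h => hce (by
    rw [← bar_fst c, ← bar_fst e, ← hc', ← he', liftSymbol, liftSymbol, h]))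
  have hp := hp.extend (F := F) (s := s)
    (fun u => by rw [hd _ (copy_extend s u), (extend_injective s).eq_iff, Set.mem_singleton_iff])
    fun u v => hc _ _ (copy_extend s u) (copy_extend s v)
  have hg : cls (BurntPancake.extend s g) = c := by rw [cls_extend, hg, hc', bar_bar]
  have hh : cls (BurntPancake.extend s h) = e := by rw [cls_extend, hh, he', bar_bar]
  exact ⟨_, _, hp, hg, hh, he _ (copy_extend s _) hp.left_mem.2 (hg ▸ hcT),
    he _ (copy_extend s _) hp.right_mem.2 (hh ▸ heT)⟩

/-- A copy of dimension three from which two vertices with mates in different copies are missing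
is spanned by a path whose ends have mates in two further copies. -/
theorem exists_path_two_missing {f f' : SignedPermutation 4} (hf : copy f = s) (hf' : copy f' = s)
    (hff : cls f ≠ cls f') (hd : ∀ v, copy v = s → (v ∈ deleted F ↔ v = f ∨ v = f'))
    (hc : ∀ u v, copy u = s → copy v = s → s(u, v) ∉ cut F) :
    ∃ g h, HamPath (live F) (region F {s}) g h ∧ cls g ≠ cls h ∧ cls g ≠ cls f ∧ cls g ≠ cls f' ∧
      cls h ≠ cls f ∧ cls h ≠ cls f' := by
  obtain ⟨f, rfl⟩ := exists_extend hf
  obtain ⟨f', rfl⟩ := exists_extend hf'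
  simp only [cls_extend, Ne, bar_inj, (liftSymbol_injective s).eq_iff] at hff
  obtain ⟨g, h, hp, hgh⟩ := exists_path_two_holes hff
  refine ⟨_, _, hp.extend (F := F) (s := s) (fun u => by
    rw [hd _ (copy_extend s u), (extend_injective s).eq_iff, (extend_injective s).eq_iff,
      Set.mem_insert_iff, Set.mem_singleton_iff])
    fun u v => hc _ _ (copy_extend s u) (copy_extend s v), ?_⟩
  simpa only [cls_extend, Ne, bar_inj, (liftSymbol_injective s).eq_iff] using hgh

end Four

/-! ### Spanning paths with two bad copies -/

section Exits

variable {m : ℕ} {F : List (Fault (SignedPermutation (m + 1)))}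
  {T : Finset (SignedSymbol (m + 1))} {s t : SignedSymbol (m + 1)}
  {x y a : SignedPermutation (m + 1)}

theorem HamPath.of_region (h : HamPath (live F) (region F T) x y) (hT : ∀ r, r ∈ T) :
    HamPath (live F) (deleted F)ᶜ x y :=
  h.congr (by rw [Finset.eq_univ_of_forall hT, region_univ])

/-- A spanning cycle of a copy can be left next to any of its vertices, towards a copy other than
a given one. -/
theorem HamCycle.exists_exit (hm : 0 < m) (h : HamCycle (live F) (region F {s}))
    (ha : a ∈ region F {s}) (r : SignedSymbol (m + 1)) :
    ∃ w, HamPath (live F) (region F {s}) a w ∧ (burntPancake (m + 1)).Adj a w ∧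
      w ∈ region F {s} ∧ copy w = s ∧ w ∉ deleted F ∧ cls w ≠ cls a ∧ cls w ≠ r := by
  obtain ⟨v, w, hvw, hv, hw, hpv, hpw⟩ := h.exists_two ha
  have hca := (mem_region_singleton.1 ha).1
  have hcv := mem_region_singleton.1 hpv.right_mem
  have hcw := mem_region_singleton.1 hpw.right_mem
  have hne := cls_ne_of_adj_adj hm (live_adj_adj hv) (live_adj_adj hw) (hcv.1.trans hca.symm)
    (hcw.1.trans hca.symm) hvw
  by_cases hr : cls v = r
  · exact ⟨w, hpw, live_adj_adj hw, hpw.right_mem, hcw.1, hcw.2,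
      (cls_ne_of_adj hm (live_adj_adj hw) (hcw.1.trans hca.symm)).symm,
      fun e => hne (hr.trans e.symm)⟩
  · exact ⟨v, hpv, live_adj_adj hv, hpv.right_mem, hcv.1, hcv.2,
      (cls_ne_of_adj hm (live_adj_adj hv) (hcv.1.trans hca.symm)).symm, hr⟩

/-- The copies other than `s` and `t` are good, `s` and `t` have spanning cycles, and every
fault-free vertex can be left along the edge to its mate. This is the situation in which all faults
are pairs of mates in `s` and `t`. -/
structure TwoBad (F : List (Fault (SignedPermutation (m + 1)))) (s t : SignedSymbol (m + 1)) :
    Prop where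
  le : 3 ≤ m
  valid : Valid (burntPancake (m + 1)) F
  length : F.length + 1 ≤ m
  not_mem_exposed : ∀ v, v ∉ deleted F → v ∉ exposed F
  good : ∀ r, r ≠ s → r ≠ t → Good F r
  left : HamCycle (live F) (region F {s})
  right : HamCycle (live F) (region F {t})
  ne : s.1 ≠ t.1

theorem TwoBad.symm (h : TwoBad F s t) : TwoBad F t s :=
  { h with
    good := fun r h1 h2 => h.good r h2 h1
    left := h.right
    right := h.left
    ne := h.ne.symm }

theorem TwoBad.good_of_mem (h : TwoBad F s t) : ∀ r ∈ ({s, t}ᶜ : Finset _), Good F r :=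
  fun r hr => by
    simp only [Finset.mem_compl, Finset.mem_insert, Finset.mem_singleton, not_or] at hr
    exact h.good r hr.1 hr.2

theorem TwoBad.good_of_mem' (h : TwoBad F s t) (p : SignedSymbol (m + 1)) :
    ∀ r ∈ ({p, s, t}ᶜ : Finset _), Good F r := fun r hr => by
  simp only [Finset.mem_compl, Finset.mem_insert, Finset.mem_singleton, not_or] at hr
  exact h.good r hr.2.1 hr.2.2

/-- Both ends of the path are in the bad copies. -/
theorem TwoBad.hamPath_of_left_right (h : TwoBad F s t) (hx : x ∈ region F {s})
    (hy : y ∈ region F {t}) : HamPath (live F) (deleted F)ᶜ x y := by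
  have hm : 0 < m := by have := h.le; omega
  have hst : s ≠ t := fun e => h.ne (by rw [e])
  obtain ⟨w, hw, -, -, hws, hwF, -, hwt⟩ := h.left.exists_exit hm hx t
  obtain ⟨z, hz, -, -, hzt, hzF, -, hzs⟩ := h.right.exists_exit hm hy s
  have hws' : cls w ≠ s := hws ▸ cls_ne_copy hm w
  have hzt' : cls z ≠ t := hzt ▸ cls_ne_copy hm z
  have hwe := h.not_mem_exposed w hwF
  have hze := h.not_mem_exposed z hzF
  have h1 := hamPath_region (T := {s, t}ᶜ) (x := mate w) (y := mate z) h.le h.valid h.length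
    h.good_of_mem (by rw [compl_compl]; exact Finset.card_le_two)
    ⟨by simp [copy_mate, hws', hwt], mate_not_mem_deleted hwe⟩
    ⟨by simp [copy_mate, hzs, hzt'], mate_not_mem_deleted hze⟩
    (fun e => hst (by rw [← hws, ← hzt, mate_inj.1 e]))
  have h2 := hw.link hwe h1 (by simp)
  refine (h2.link (by rwa [mate_mem_exposed]) (by rw [mate_mate]; exact hz.symm) ?_).of_region ?_
  · simp [Ne.symm hst]
  · intro r
    simp only [Finset.mem_union, Finset.mem_compl, Finset.mem_insert, Finset.mem_singleton]
    tauto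

/-- One end of the path is in a bad copy. -/
theorem TwoBad.hamPath_of_left (h : TwoBad F s t) (hx : x ∈ region F {s})
    (hy : y ∈ region F {s, t}ᶜ) : HamPath (live F) (deleted F)ᶜ x y := by
  have hm : 0 < m := by have := h.le; omega
  have hst : s ≠ t := fun e => h.ne (by rw [e])
  obtain ⟨w, hw, -, -, hws, hwF, -, hwy⟩ := h.left.exists_exit hm hx (copy y)
  have hws' : cls w ≠ s := hws ▸ cls_ne_copy hm w
  have hwe := h.not_mem_exposed w hwF
  have hwm := mate_not_mem_deleted hwe
  by_cases hwt : cls w = t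
  · -- the path goes on to `t`, and from there to the good copies
    obtain ⟨z, hz, -, -, hzt, hzF, hzs, hzy⟩ := h.right.exists_exit hm
      (mem_region_singleton.2 ⟨(copy_mate w).trans hwt, hwm⟩) (copy y)
    rw [cls_mate, hws] at hzs
    have hzt' : cls z ≠ t := hzt ▸ cls_ne_copy hm z
    have hze := h.not_mem_exposed z hzF
    have h1 := hamPath_region (T := {s, t}ᶜ) (x := mate z) (y := y) h.le h.valid h.length
      h.good_of_mem (by rw [compl_compl]; exact Finset.card_le_two)
      ⟨by simp [copy_mate, hzs, hzt'], mate_not_mem_deleted hze⟩ hy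
      (fun e => hzy (by rw [← e]; rfl))
    refine ((hw.link hwe hz (by simp [hst])).link hze h1 ?_).of_region ?_
    · rw [← Finset.insert_eq]
      exact disjoint_compl_right
    · intro r
      simp only [Finset.mem_union, Finset.mem_compl, Finset.mem_insert, Finset.mem_singleton]
      tauto
  · -- the path goes on to a good copy, and `t` is inserted later
    have h1 := hamPath_insert (T := {s, t}ᶜ) (t := t) (x := mate w) (y := y) h.le h.valid h.length
      h.good_of_mem (by simp) h.right (.inl (by rw [compl_compl]; exact Finset.card_le_two))
      ⟨by simp [copy_mate, hws', hwt], hwm⟩ hy hwy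
    refine (hw.link hwe h1 ?_).of_region ?_
    · simp [hst]
    · intro r
      simp only [Finset.mem_union, Finset.mem_compl, Finset.mem_insert, Finset.mem_singleton]
      tauto

/-- The path enters the bad copy `s` from the copy of its first vertex. -/
theorem TwoBad.hamPath_of_enter (h : TwoBad F s t) (hm4 : 4 ≤ m) {b w : SignedPermutation (m + 1)}
    (hx : x ∈ region F {s, t}ᶜ) (hy : y ∈ region F {s, t}ᶜ) (hxy : copy x ≠ copy y)
    (hb : copy b = copy x) (hbs : cls b = s) (hbF : b ∉ deleted F) (hbx : b ≠ x)
    (hw : HamPath (live F) (region F {s}) (mate b) w) (hwt : cls w ≠ t) (hwx : cls w ≠ copy x)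
    (hwy : cls w ≠ copy y) : HamPath (live F) (deleted F)ᶜ x y := by
  have hm : 0 < m := by have := h.le; omega
  have hst : s ≠ t := fun e => h.ne (by rw [e])
  have hx1 := hx.1
  have hy1 := hy.1
  simp only [Finset.mem_compl, Finset.mem_insert, Finset.mem_singleton, not_or] at hx1 hy1
  have hws := mem_region_singleton.1 hw.right_mem
  have hws' : cls w ≠ s := hws.1 ▸ cls_ne_copy hm w
  have hwe := h.not_mem_exposed w hws.2
  have h1 := h.good _ hx1.1 hx1.2 x b (Ne.symm hbx) (mem_region_singleton.2 ⟨rfl, hx.2⟩)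
    (mem_region_singleton.2 ⟨hb, hbF⟩)
  have h2 := hamPath_insert (T := {copy x, s, t}ᶜ) (t := t) (x := mate w) (y := y) h.le h.valid
    h.length (h.good_of_mem' _) (by simp) h.right
    (.inr ⟨by rw [compl_compl]; exact Finset.card_le_three, hm4⟩)
    ⟨by simp [copy_mate, hws', hwt, hwx], mate_not_mem_deleted hwe⟩
    ⟨by simp [hy1, Ne.symm hxy], hy.2⟩ hwy
  have h3 := h1.link (h.not_mem_exposed b hbF) hw (by simpa using hx1.1)
  refine (h3.link hwe h2 ?_).of_region ?_
  · rw [Finset.disjoint_left]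
    intro r
    simp only [Finset.mem_union, Finset.mem_compl, Finset.mem_insert, Finset.mem_singleton]
    rintro (rfl | rfl) (h | h)
    · exact hx1.2 h
    · simp at h
    · exact hst h
    · simp at h
  · intro r
    simp only [Finset.mem_union, Finset.mem_compl, Finset.mem_insert, Finset.mem_singleton]
    tauto

/-- Both ends of the path are outside the bad copies and in different copies; the copy of the first
is linked with both bad copies. -/
theorem TwoBad.hamPath_of_fst_ne (h : TwoBad F s t) (hm4 : 4 ≤ m)
    (hx : x ∈ region F {s, t}ᶜ) (hy : y ∈ region F {s, t}ᶜ) (hxy : copy x ≠ copy y)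
    (hs : (copy x).1 ≠ s.1) (ht : (copy x).1 ≠ t.1) : HamPath (live F) (deleted F)ᶜ x y := by
  have hm : 0 < m := by omega
  -- no neighbour of the mate of `b` in `s` has its mate in `t`
  obtain ⟨b, hb, hbs, hbe, hbx, hbt⟩ :=
    exists_link_containing hm h.valid hs ht.symm h.ne.symm {x} (by
      have := le_linkCount h.le
      have := h.length
      rw [Set.ncard_singleton]
      omega)
  have hmem := mem_region_singleton.2 ⟨(copy_mate b).trans hbs, mate_not_mem_deleted hbe⟩
  obtain ⟨w, hw, haw, -, hws, hwF, hwx, hwy⟩ := h.left.exists_exit hm hmem (copy y)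
  refine h.hamPath_of_enter hm4 hx hy hxy hb hbs (not_mem_deleted hbe) hbx hw ?_ ?_ hwy
  · exact cls_ne_of_contains hm (contains_mate.2 (by rwa [bar_bar])) haw
      (hws.trans ((copy_mate b).trans hbs).symm)
  · rwa [cls_mate, hb] at hwx

/-- Both ends of the path are outside the bad copies, in the copies to which the bad copies are not
linked. -/
theorem TwoBad.hamPath_of_bar (h : TwoBad F s t) (hm4 : 4 ≤ m)
    (hx : x ∈ region F {s, t}ᶜ) (hy : y ∈ region F {s, t}ᶜ)
    (hxt : copy x = t.bar) (hys : copy y = s.bar) : HamPath (live F) (deleted F)ᶜ x y := by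
  have hm : 0 < m := by omega
  have hxy : copy x ≠ copy y := fun e => h.ne (by rw [← bar_fst s, ← hys, ← e, hxt, bar_fst])
  obtain ⟨b, hb, hbs, hbe, hbx⟩ := exists_link hm h.valid (s := copy x) (t := s)
    (by rw [hxt, bar_fst]; exact h.ne.symm) {x} (by
    have := length_add_lt h.le h.length
    rw [Set.ncard_singleton]
    omega)
  have hmem := mem_region_singleton.2 ⟨(copy_mate b).trans hbs, mate_not_mem_deleted hbe⟩
  obtain ⟨w, hw, -, -, hws, hwF, hwx, hwt⟩ := h.left.exists_exit hm hmem t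
  refine h.hamPath_of_enter hm4 hx hy hxy hb hbs (not_mem_deleted hbe) hbx hw hwt ?_ ?_
  · rwa [cls_mate, hb] at hwx
  · rw [hys, ← hws]
    exact cls_ne_bar_copy hm w

/-- Both ends of the path are outside the bad copies and in different copies. -/
theorem TwoBad.hamPath_of_copy_ne (h : TwoBad F s t) (hm4 : 4 ≤ m)
    (hx : x ∈ region F {s, t}ᶜ) (hy : y ∈ region F {s, t}ᶜ) (hxy : copy x ≠ copy y) :
    HamPath (live F) (deleted F)ᶜ x y := by
  have hx1 := hx.1
  have hy1 := hy.1
  simp only [Finset.mem_compl, Finset.mem_insert, Finset.mem_singleton, not_or] at hx1 hy1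
  by_cases h1 : (copy x).1 = s.1
  · by_cases h2 : (copy y).1 = t.1
    · rw [Finset.pair_comm] at hx hy
      exact h.symm.hamPath_of_bar hm4 hx hy ((fst_eq_iff.1 h1).resolve_left hx1.1)
        ((fst_eq_iff.1 h2).resolve_left hy1.2)
    · refine (h.hamPath_of_fst_ne hm4 hy hx hxy.symm (fun h3 => ?_) h2).symm
      exact hxy (((fst_eq_iff.1 h1).resolve_left hx1.1).trans
        ((fst_eq_iff.1 h3).resolve_left hy1.1).symm)
  · by_cases h2 : (copy x).1 = t.1
    · by_cases h3 : (copy y).1 = s.1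
      · exact h.hamPath_of_bar hm4 hx hy ((fst_eq_iff.1 h2).resolve_left hx1.2)
          ((fst_eq_iff.1 h3).resolve_left hy1.1)
      · refine (h.hamPath_of_fst_ne hm4 hy hx hxy.symm h3 (fun h4 => ?_)).symm
        exact hxy (((fst_eq_iff.1 h2).resolve_left hx1.2).trans
          ((fst_eq_iff.1 h4).resolve_left hy1.2).symm)
    · exact h.hamPath_of_fst_ne hm4 hx hy hxy h1 h2

/-- Both ends of the path are in one copy, which is linked with the bad copy `s`. -/
theorem TwoBad.hamPath_of_copy_eq (h : TwoBad F s t) (hm4 : 4 ≤ m)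
    (hx : x ∈ region F {s, t}ᶜ) (hy : y ∈ region F {s, t}ᶜ) (hxy : x ≠ y) (hc : copy y = copy x)
    (hs : (copy x).1 ≠ s.1) : HamPath (live F) (deleted F)ᶜ x y := by
  have hm : 0 < m := by omega
  have hst : s ≠ t := fun e => h.ne (by rw [e])
  have hx1 := hx.1
  simp only [Finset.mem_compl, Finset.mem_insert, Finset.mem_singleton, not_or] at hx1
  obtain ⟨b, hb, hbs, hbe, hbx⟩ := exists_link hm h.valid hs {x, y} (by
    have h1 := Set.ncard_insert_le x {y}
    have h2 := length_add_lt h.le h.length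
    rw [Set.ncard_singleton] at h1
    omega)
  simp only [Set.mem_insert_iff, Set.mem_singleton_iff, not_or] at hbx
  have hmem := mem_region_singleton.2 ⟨(copy_mate b).trans hbs, mate_not_mem_deleted hbe⟩
  obtain ⟨w, hw, haw, -, hws, hwF, hwx, hwt⟩ := h.left.exists_exit hm hmem t
  rw [cls_mate, hb] at hwx
  have hws' : cls w ≠ s := hws ▸ cls_ne_copy hm w
  have hwe := h.not_mem_exposed w hwF
  have h1 := h.good _ hx1.1 hx1.2 x y hxy (mem_region_singleton.2 ⟨rfl, hx.2⟩)
    (mem_region_singleton.2 ⟨hc, hy.2⟩)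
  -- the spanning path of the copy of `x` and `y` is interrupted at an edge from `b` to `c`, for a
  -- detour through all the other copies
  have key : ∀ {x y c X₁ X₂}, copy x ∉ ({s, t} : Finset (SignedSymbol (m + 1))) →
      copy b = copy x → cls w ≠ copy x → region F {copy x} = X₁ ∪ X₂ →
      Disjoint X₁ X₂ → HamPath (live F) X₁ x b → (live F).Adj b c → HamPath (live F) X₂ c y →
      cls c ≠ t → HamPath (live F) (deleted F)ᶜ x y := by
    intro x y c X₁ X₂ hx1 hb hwx e hd h2 hbc h3 hct
    simp only [Finset.mem_insert, Finset.mem_singleton, not_or] at hx1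
    have hc := mem_region_singleton.1 (e ▸ Set.mem_union_right X₁ h3.left_mem)
    have hcs : cls c ≠ s := fun e => cls_ne_of_adj hm (live_adj_adj hbc) (hc.1.trans hb.symm)
      (hbs.trans e.symm)
    have hcx : cls c ≠ copy x := hc.1 ▸ cls_ne_copy hm c
    have hce := h.not_mem_exposed c hc.2
    have h4 := hamPath_insert (T := {copy x, s, t}ᶜ) (t := t) (x := mate w) (y := mate c) h.le
      h.valid h.length (h.good_of_mem' _) (by simp) h.right
      (.inr ⟨by rw [compl_compl]; exact Finset.card_le_three, hm4⟩)
      ⟨by simp [copy_mate, hws', hwt, hwx], mate_not_mem_deleted hwe⟩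
      ⟨by simp [copy_mate, hct, hcs, hcx], mate_not_mem_deleted hce⟩
      (cls_ne_cls_across hm (live_adj_adj hbc) (hc.1.trans hb.symm) haw
        (hws.trans ((copy_mate b).trans hbs).symm)).symm
    have h5 := hw.link hwe h4 (by simp [hst])
    refine (h2.detour hbe h5 hce h3 e hd ?_).of_region ?_
    · simp [hx1]
    · intro r
      simp only [Finset.mem_union, Finset.mem_compl, Finset.mem_insert, Finset.mem_singleton]
      tauto
  have hbX : b ∈ region F {copy x} := mem_region_singleton.2 ⟨hb, not_mem_deleted hbe⟩
  obtain ⟨g, k, X₁, X₂, e, hd, h2, hg, hk, h3⟩ := h1.remove_vertex hbX hbx.1 hbx.2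
  have hbn : b ∉ X₁ ∧ b ∉ X₂ := by
    have : b ∉ X₁ ∪ X₂ := e ▸ fun h => h.2 rfl
    simpa using this
  have e' : region F {copy x} = X₁ ∪ X₂ ∪ {b} := by
    rw [← e, Set.sdiff_union_self, Set.union_eq_left.2 (by simpa using hbX)]
  have hgX := mem_region_singleton.1 (e' ▸ .inl (.inl h2.right_mem) : g ∈ region F {copy x})
  have hkX := mem_region_singleton.1 (e' ▸ .inl (.inr h3.left_mem) : k ∈ region F {copy x})
  -- of the two neighbours of `b` on the path, at least one has its mate outside `t`
  by_cases hgt : cls g = t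
  · have hgk : g ≠ k := fun e => Set.disjoint_left.1 hd h2.right_mem (e ▸ h3.left_mem)
    have hkt : cls k ≠ t := fun e => cls_ne_of_adj_adj hm (live_adj_adj hg.symm) (live_adj_adj hk)
      (hgX.1.trans hb.symm) (hkX.1.trans hb.symm) hgk (hgt.trans e.symm)
    exact key (by simp [hx1]) hb hwx (e'.trans (Set.union_right_comm _ _ _))
      (Set.disjoint_union_left.2 ⟨hd, Set.disjoint_singleton_left.2 hbn.2⟩)
      (h2.trans hg (.single b) (Set.disjoint_singleton_right.2 hbn.1)) hk h3 hkt
  · refine (key (y := x) (by simp [hx1, hc]) (hb.trans hc.symm) (by rwa [hc]) (X₁ := X₂ ∪ {b})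
      (X₂ := X₁) ?_ ?_ (h3.symm.trans hk.symm (.single b) (Set.disjoint_singleton_right.2 hbn.2))
      hg.symm h2.symm hgt).symm
    · rw [hc, e', Set.union_assoc, Set.union_comm]
    · exact Set.disjoint_union_left.2 ⟨hd.symm, Set.disjoint_singleton_left.2 hbn.1⟩

end Exits

/-! ### The inductive step for spanning paths -/

section PathStep

variable {m : ℕ} {F : List (Fault (SignedPermutation (m + 1)))} {s t : SignedSymbol (m + 1)}
  {x y : SignedPermutation (m + 1)}

/-- The situation in which all faults hit the copy `s` and the other copies are good. -/
theorem hamPath_of_one_bad (hm : 3 ≤ m) (hF : Valid (burntPancake (m + 1)) F)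
    (hl : F.length + 1 ≤ m) (hg : ∀ r, r ≠ s → Good F r) (hc : HamCycle (live F) (region F {s}))
    (he : ∀ v, copy v = s → v ∉ deleted F → v ∉ exposed F) (hxy : x ≠ y) (hx : x ∉ deleted F)
    (hy : y ∉ deleted F) : HamPath (live F) (deleted F)ᶜ x y := by
  have hm0 : 0 < m := by omega
  have hgT : ∀ r ∈ ({s}ᶜ : Finset _), Good F r := fun r hr => hg r (by simpa using hr)
  have hcard : (({s}ᶜ : Finset (SignedSymbol (m + 1)))ᶜ).card ≤ 2 := by simp
  have hout : ∀ {w}, w ∈ region F {s} → w ∉ exposed F ∧ mate w ∈ region F {s}ᶜ := fun {w} hw => by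
    have hw := mem_region_singleton.1 hw
    have hwe := he w hw.1 hw.2
    exact ⟨hwe, by simpa [copy_mate, ← hw.1] using cls_ne_copy hm0 w, mate_not_mem_deleted hwe⟩
  have one : ∀ {x y}, x ∈ region F {s} → y ∈ region F {s}ᶜ →
      HamPath (live F) (deleted F)ᶜ x y := by
    intro x y hx hy
    obtain ⟨w, hw, -, hwm, -, -, -, hwy⟩ := hc.exists_exit hm0 hx (copy y)
    have h1 := hamPath_region hm hF hl hgT hcard (hout hwm).2 hy (fun e => hwy (by rw [← e]; rfl))
    exact (hw.link (hout hwm).1 h1 (by simp)).of_region (by simp)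
  by_cases hxs : copy x = s <;> by_cases hys : copy y = s
  · -- two arcs of the spanning cycle of `s` are joined outside `s`
    obtain ⟨u, v, X₁, X₂, e, hd, h1, h2⟩ := hc.two_arcs (mem_region_singleton.2 ⟨hxs, hx⟩)
      (mem_region_singleton.2 ⟨hys, hy⟩) hxy.symm
    have hu := hout (e ▸ .inl h1.right_mem : u ∈ region F {s})
    have hv := hout (e ▸ .inr h2.left_mem : v ∈ region F {s})
    have huv : u ≠ v := fun e => Set.disjoint_left.1 hd h1.right_mem (e ▸ h2.left_mem)
    have h3 := hamPath_region hm hF hl hgT hcard hu.2 hv.2 (fun e => huv (mate_inj.1 e))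
    exact (h1.detour hu.1 h3 hv.1 h2 e hd (by simp)).of_region (by simp)
  · exact one (mem_region_singleton.2 ⟨hxs, hx⟩) ⟨by simpa using hys, hy⟩
  · exact (one (mem_region_singleton.2 ⟨hys, hy⟩) ⟨by simpa using hxs, hx⟩).symm
  · by_cases hp : copy x = copy y
    · -- the spanning path of the common copy makes a detour through all the other copies
      have hpath := hg _ hxs x y hxy (mem_region_singleton.2 ⟨rfl, hx⟩)
        (mem_region_singleton.2 ⟨hp.symm, hy⟩)
      have hnum := four_mul_lt (k := 1) hm hl (by omega)
      obtain ⟨a, b, X₁, X₂, e, hd, h1, -, h2, hca, hcb, hae, hbe, haS, hbS, hab⟩ :=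
        hpath.exists_cut_link hm0 {s} (by rw [Finset.card_singleton]; omega)
      rw [Finset.mem_singleton] at haS hbS
      have hax : cls a ≠ copy x := hca ▸ cls_ne_copy hm0 a
      have hbx : cls b ≠ copy x := hcb ▸ cls_ne_copy hm0 b
      have h3 := hamPath_insert (T := {copy x, s}ᶜ) (t := s) (x := mate a) (y := mate b) hm hF hl
        (fun r hr => hg r (by simp at hr; tauto)) (by simp) hc
        (.inl (by rw [compl_compl]; exact Finset.card_le_two))
        ⟨by simp [copy_mate, haS, hax], mate_not_mem_deleted hae⟩
        ⟨by simp [copy_mate, hbS, hbx], mate_not_mem_deleted hbe⟩ hab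
      refine (h1.detour hae h3 hbe h2 e hd (by simp [hxs])).of_region fun r => ?_
      simp only [Finset.mem_union, Finset.mem_compl, Finset.mem_insert, Finset.mem_singleton]
      tauto
    · have h1 := hamPath_insert (t := s) hm hF hl hgT (by simp) hc (.inl hcard)
        (x := x) (y := y) ⟨by simpa using hxs, hx⟩ ⟨by simpa using hys, hy⟩ hp
      exact h1.of_region (by simp)

/-- In dimension four, both ends of the path are outside the bad copies. There are too few copies
for `hamPath_insert`; instead both bad copies are inserted as bridges into a path through the five
good copies other than that of `x`. -/
theorem TwoBad.hamPath_of_bridges (h : TwoBad F s t) (hm3 : m = 3) (hs : IsBridge F {s, t}ᶜ s)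
    (ht : IsBridge F {s, t}ᶜ t) (hx : x ∈ region F {s, t}ᶜ) (hy : y ∈ region F {s, t}ᶜ)
    (hxy : x ≠ y) : HamPath (live F) (deleted F)ᶜ x y := by
  have hm : 0 < m := by omega
  have hst : s ≠ t := fun e => h.ne (by rw [e])
  have hx1 := hx.1
  have hy1 := hy.1
  simp only [Finset.mem_compl, Finset.mem_insert, Finset.mem_singleton, not_or] at hx1 hy1
  have hcard : ({copy x, s, t}ᶜ : Finset (SignedSymbol (m + 1))).card = 5 := by
    have h1 := card_add_card_compl ({copy x, s, t} : Finset (SignedSymbol (m + 1)))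
    rw [Finset.card_eq_three.2 ⟨copy x, s, t, hx1.1, hx1.2, hst, rfl⟩] at h1
    omega
  have hsub : ({copy x, s, t}ᶜ : Finset (SignedSymbol (m + 1))) ⊆ {s, t}ᶜ :=
    Finset.compl_subset_compl.2 (Finset.subset_insert _ _)
  have key : ∀ {a y}, copy a = copy x → a ∉ exposed F → cls a ≠ s → cls a ≠ t →
      y ∈ region F {copy x, s, t}ᶜ → cls a ≠ copy y →
      HamPath (live F) (region F (insert s (insert t {copy x, s, t}ᶜ))) (mate a) y :=
    fun {a y} ha hae has hat hy hay => hamPath_two_bridges h.le h.valid h.length (h.good_of_mem' _)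
      hcard (hs.mono hsub) (ht.mono hsub) hst (by simp) (by simp)
      ⟨by simp [copy_mate, has, hat, ← ha, cls_ne_copy hm a], mate_not_mem_deleted hae⟩ hy hay
      (by rw [cls_mate, ha]; exact hx1.1) (by rw [cls_mate, ha]; exact hx1.2)
  have hdisj : Disjoint ({copy x} : Finset (SignedSymbol (m + 1)))
      (insert s (insert t {copy x, s, t}ᶜ)) := by simp [hx1]
  have hcover : ∀ r, r ∈ ({copy x} : Finset (SignedSymbol (m + 1))) ∪
      insert s (insert t {copy x, s, t}ᶜ) := fun r => by
    simp only [Finset.mem_union, Finset.mem_compl, Finset.mem_insert, Finset.mem_singleton]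
    tauto
  by_cases hc : copy y = copy x
  · have hpath := h.good _ hx1.1 hx1.2 x y hxy (mem_region_singleton.2 ⟨rfl, hx.2⟩)
      (mem_region_singleton.2 ⟨hc, hy.2⟩)
    have hnum := four_mul_lt (k := 2) h.le h.length (by omega)
    obtain ⟨a, b, X₁, X₂, e, hd, h1, -, h2, hca, hcb, hae, hbe, haS, hbS, hab⟩ :=
      hpath.exists_cut_link hm {s, t} (by rw [Finset.card_pair hst]; omega)
    simp only [Finset.mem_insert, Finset.mem_singleton, not_or] at haS hbS
    have h3 := key (y := mate b) hca hae haS.1 haS.2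
      ⟨by simp [copy_mate, hbS, ← hcb, cls_ne_copy hm b], mate_not_mem_deleted hbe⟩ hab
    exact (h1.detour hae h3 hbe h2 e hd hdisj).of_region hcover
  · -- the copy of `x` is left first, for a copy `r` other than that of `y`
    obtain ⟨r, hr⟩ : (({copy x, (copy x).bar, s, t, copy y} : Finset _)ᶜ).Nonempty := by
      rw [← Finset.card_pos]
      have h1 := card_add_card_compl ({copy x, (copy x).bar, s, t, copy y} : Finset _)
      have h2 := Finset.card_le_five (a := copy x) (b := (copy x).bar) (c := s) (d := t)
        (e := copy y)
      omega
    simp only [Finset.mem_compl, Finset.mem_insert, Finset.mem_singleton, not_or] at hr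
    obtain ⟨a, ha, har, hae, hax⟩ := exists_link hm h.valid (s := copy x) (t := r)
      (fun e => (fst_eq_iff.1 e.symm).elim hr.1 hr.2.1) {x} (by
      have := length_add_lt h.le h.length
      rw [Set.ncard_singleton]
      omega)
    have h1 := h.good _ hx1.1 hx1.2 x a (fun e => hax e.symm) (mem_region_singleton.2 ⟨rfl, hx.2⟩)
      (mem_region_singleton.2 ⟨ha, not_mem_deleted hae⟩)
    have h2 := key (y := y) ha hae (har ▸ hr.2.2.1) (har ▸ hr.2.2.2.1)
      ⟨by simp [hy1, hc], hy.2⟩ (har ▸ hr.2.2.2.2)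
    exact (h1.link hae h2 hdisj).of_region hcover

/-- Both ends of the path are in the bad copy `s`, which becomes good without the fault
`{f, mate f}`: a spanning path that passes through `f` is interrupted there for a detour through
all the other copies. -/
theorem TwoBad.hamPath_of_left_left (h : TwoBad F s t)
    {F' : List (Fault (SignedPermutation (m + 1)))}
    {i : Fault (SignedPermutation (m + 1))} {f : SignedPermutation (m + 1)} (hF' : F.Perm (i :: F'))
    (hi : i.verts = {f, mate f}) (hie : i.edges = ∅) (hf : copy f = s) (hft : cls f = t)
    (hg : Good F' s) (hx : x ∈ region F {s}) (hy : y ∈ region F {s}) (hxy : x ≠ y) :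
    HamPath (live F) (deleted F)ᶜ x y := by
  have hm : 0 < m := by have := h.le; omega
  have hst : s ≠ t := fun e => h.ne (by rw [e])
  have hd : deleted F = {f, mate f} ∪ deleted F' := by rw [deleted_perm hF', deleted_cons, hi]
  have hlive : live F = live F' := by rw [live, live, cut_perm hF', cut_cons, hie, Set.empty_union]
  have hff : f ∉ deleted F' := fun h' => by
    have h1 := (h.valid.perm hF').disjoint
    rw [hi] at h1
    exact Set.disjoint_left.1 h1 (by simp) h'
  have hreg : region F {s} = region F' {s} \ {f} := by
    ext v
    simp only [mem_region_singleton, hd, Set.mem_union, Set.mem_insert_iff, Set.mem_singleton_iff,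
      Set.mem_sdiff]
    constructor
    · tauto
    · rintro ⟨⟨h1, h2⟩, h3⟩
      refine ⟨h1, ?_⟩
      rintro ((h4 | rfl) | h4)
      · exact h3 h4
      · rw [copy_mate, hft] at h1
        exact hst h1.symm
      · exact h2 h4
  have hfX : f ∈ region F' {s} := mem_region_singleton.2 ⟨hf, hff⟩
  rw [hreg] at hx hy
  obtain ⟨g, k, X₁, X₂, e, hdX, h1, hgf, hfk, h2⟩ := (hg x y hxy hx.1 hy.1).remove_vertex hfX
    (fun e => hx.2 e.symm) (fun e => hy.2 e.symm)
  rw [← hreg] at e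
  rw [← hlive] at h1 hgf hfk h2
  have hgX := mem_region_singleton.1 (e ▸ .inl h1.right_mem : g ∈ region F {s})
  have hkX := mem_region_singleton.1 (e ▸ .inr h2.left_mem : k ∈ region F {s})
  have hgk : g ≠ k := fun e => Set.disjoint_left.1 hdX h1.right_mem (e ▸ h2.left_mem)
  have hgt : cls g ≠ t := hft ▸ cls_ne_of_adj hm (live_adj_adj hgf) (hf.trans hgX.1.symm)
  have hkt : cls k ≠ t := hft ▸ (cls_ne_of_adj hm (live_adj_adj hfk) (hkX.1.trans hf.symm)).symm
  have hgs : cls g ≠ s := hgX.1 ▸ cls_ne_copy hm g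
  have hks : cls k ≠ s := hkX.1 ▸ cls_ne_copy hm k
  have hge := h.not_mem_exposed g hgX.2
  have hke := h.not_mem_exposed k hkX.2
  have h3 := hamPath_insert (T := {s, t}ᶜ) (t := t) (x := mate g) (y := mate k) h.le h.valid
    h.length h.good_of_mem (by simp) h.right (.inl (by rw [compl_compl]; exact Finset.card_le_two))
    ⟨by simp [copy_mate, hgs, hgt], mate_not_mem_deleted hge⟩
    ⟨by simp [copy_mate, hks, hkt], mate_not_mem_deleted hke⟩
    (cls_ne_of_adj_adj hm (live_adj_adj hgf.symm) (live_adj_adj hfk) (hgX.1.trans hf.symm)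
      (hkX.1.trans hf.symm) hgk)
  refine (h1.detour hge h3 hke h2 e hdX (by simp [hst])).of_region fun r => ?_
  simp only [Finset.mem_union, Finset.mem_compl, Finset.mem_insert, Finset.mem_singleton]
  tauto

/-- In dimension four, a copy hit by a single fault is a bridge if that fault is a pair of mates. -/
theorem isBridge_of_pair {F : List (Fault (SignedPermutation 4))}
    {i : Fault (SignedPermutation 4)} {s : SignedSymbol 4} {T : Finset (SignedSymbol 4)}
    {f : SignedPermutation 4} (hF : ∀ j ∈ F, Hits j s → j = i) (hiF : i ∈ F)
    (hi : i.verts = {f, mate f}) (hie : i.edges = ∅) (hf : copy f = s)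
    (he : ∀ v, copy v = s → v ∉ deleted F → cls v ∈ T → v ∉ exposed F) : IsBridge F T s := by
  refine isBridge_of_missing hf (fun v hv => ⟨?_, ?_⟩) ?_ he
  · rintro ⟨j, hj, hvj⟩
    rw [hF j hj (.inl ⟨v, hvj, hv⟩), hi] at hvj
    rcases hvj with h | h
    · exact h
    · rw [h] at hv
      exact absurd (hv.trans hf.symm) (cls_ne_copy (by norm_num) f)
  · rintro rfl
    exact ⟨i, hiF, by rw [hi]; simp⟩
  · rintro u v hu hv ⟨j, hj, huv⟩
    rw [hF j hj (.inr ⟨u, v, huv, hu, hv⟩), hie] at huv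
    exact huv

/-- Hamiltonian connectivity of the burnt pancake graph with faults, one dimension up. -/
theorem PathTolerant.succ (hm : 3 ≤ m) (hP : PathTolerant m) (hC : CycleTolerant m) :
    PathTolerant (m + 1) := by
  intro F hF hl x y hxy hx hy
  have hm0 : 0 < m := by omega
  have hcyc : ∀ s, HamCycle (live F) (region F {s}) := fun s => hC.hamCycle hm0 hF (by
    have := hitCount_le_length (F := F) (s := s)
    omega)
  -- a copy that is not good is hit by all the faults
  have hbad : ∀ {s}, ¬ Good F s → hitCount F s = F.length ∧ F.length + 2 = m := fun {s} hs => by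
    have h1 := hitCount_le_length (F := F) (s := s)
    have h2 : ¬ hitCount F s + 3 ≤ m := fun h => hs (hP.good hm0 hF h)
    omega
  by_cases hA : ∀ s, Good F s
  · have := hamPath_region (T := Finset.univ) (x := x) (y := y) hm hF (by omega) (fun t _ => hA t)
      (by simp) ⟨by simp, hx⟩ ⟨by simp, hy⟩ hxy
    rwa [region_univ] at this
  · push Not at hA
    obtain ⟨s, hs⟩ := hA
    have hsF := hitCount_eq_length.1 (hbad hs).1
    by_cases hB : ∀ r, r ≠ s → Good F r
    · exact hamPath_of_one_bad hm hF (by omega) hB (hcyc s)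
        (fun v hv hvF => not_mem_exposed_of_hits hm0 hF.1 hsF hvF hv) hxy hx hy
    push Not at hB
    obtain ⟨t, hts, ht⟩ := hB
    have htF := hitCount_eq_length.1 (hbad ht).1
    -- two copies are hit by all the faults, which are therefore pairs of mates in these copies
    have hcross := fun i hi => (hsF i hi).exists_mate (hF.1 i hi) (htF i hi) hts.symm
    obtain ⟨i, hi⟩ : ∃ i, i ∈ F := List.exists_mem_of_ne_nil F (by
      rintro rfl
      have := (hbad hs).2
      simp at this
      omega)
    obtain ⟨f, hfs, hft, hiv, hie⟩ := hcross i hi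
    have hT : TwoBad F s t := {
      le := hm
      valid := hF
      length := by omega
      not_mem_exposed := fun v => not_mem_exposed_of_mates fun i hi => by
        obtain ⟨f, -, -, hf⟩ := hcross i hi
        exact ⟨f, hf⟩
      good := fun r hrs hrt => hP.good hm0 hF (by
        rw [hitCount_eq_zero.2]
        · omega
        · intro i hi hr
          obtain ⟨f, hfs, hft, hf⟩ := hcross i hi
          rw [hits_mate_iff hf.1 hf.2, hfs, hft] at hr
          tauto)
      left := hcyc s
      right := hcyc t
      ne := by
        rw [← hfs, ← hft]
        exact (cls_fst_ne hm0 f).symm }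
    obtain ⟨F', hF'⟩ := exists_perm_cons hi
    have hhit : ∀ r, Hits i r → hitCount F' r + 3 ≤ m := fun r hr => by
      have h1 := hitCount_perm (s := r) hF'
      rw [hitCount_cons_pos hr] at h1
      have h2 := hitCount_le_length (F := F) (s := r)
      omega
    have hF'v := (hF.perm hF').tail
    have hgs : Good F' s := hP.good hm0 hF'v (hhit s (hsF i hi))
    have hgt : Good F' t := hP.good hm0 hF'v (hhit t (htF i hi))
    have hst := hts.symm
    have hmem : ∀ {v r}, v ∉ deleted F → copy v = r → v ∈ region F {r} := fun hv hr =>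
      mem_region_singleton.2 ⟨hr, hv⟩
    have hmem' : ∀ {v}, v ∉ deleted F → copy v ≠ s → copy v ≠ t → v ∈ region F {s, t}ᶜ :=
      fun hv h1 h2 => ⟨by simp [h1, h2], hv⟩
    have hswap : region F {t, s}ᶜ = region F {s, t}ᶜ := by rw [Finset.pair_comm]
    by_cases hxs : copy x = s
    · by_cases hys : copy y = s
      · exact hT.hamPath_of_left_left hF' hiv hie hfs hft hgs (hmem hx hxs) (hmem hy hys) hxy
      by_cases hyt : copy y = t
      · exact hT.hamPath_of_left_right (hmem hx hxs) (hmem hy hyt)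
      · exact hT.hamPath_of_left (hmem hx hxs) (hmem' hy hys hyt)
    by_cases hxt : copy x = t
    · by_cases hys : copy y = s
      · exact hT.symm.hamPath_of_left_right (hmem hx hxt) (hmem hy hys)
      by_cases hyt : copy y = t
      · refine hT.symm.hamPath_of_left_left (f := mate f) hF' ?_ hie hft (by rw [cls_mate, hfs]) hgt
          (hmem hx hxt) (hmem hy hyt) hxy
        rw [hiv, mate_mate, Set.pair_comm]
      · exact hT.symm.hamPath_of_left (hmem hx hxt) (hswap ▸ hmem' hy hys hyt)
    by_cases hys : copy y = s
    · exact (hT.hamPath_of_left (hmem hy hys) (hmem' hx hxs hxt)).symm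
    by_cases hyt : copy y = t
    · exact (hT.symm.hamPath_of_left (hmem hy hyt) (hswap ▸ hmem' hx hxs hxt)).symm
    have hx' := hmem' hx hxs hxt
    have hy' := hmem' hy hys hyt
    -- both ends are outside `s` and `t`
    by_cases hm4 : 4 ≤ m
    · by_cases hc : copy x = copy y
      · by_cases hxs' : (copy x).1 = s.1
        · exact hT.symm.hamPath_of_copy_eq hm4 (hswap ▸ hx') (hswap ▸ hy') hxy hc.symm
            (fun e => hT.ne (hxs'.symm.trans e))
        · exact hT.hamPath_of_copy_eq hm4 hx' hy' hxy hc.symm hxs'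
      · exact hT.hamPath_of_copy_ne hm4 hx' hy' hc
    · -- in dimension four there is a single fault, and `s` and `t` miss one vertex each
      obtain rfl : m = 3 := by omega
      have hone : ∀ j ∈ F, j = i := by
        have h1 := (hbad hs).2
        obtain ⟨j, rfl⟩ := List.length_eq_one_iff.1 (show F.length = 1 by omega)
        simp only [List.mem_singleton] at hi ⊢
        exact fun k hk => hk.trans hi.symm
      refine hT.hamPath_of_bridges rfl
        (isBridge_of_pair (fun j hj _ => hone j hj) hi hiv hie hfs
          fun v _ h _ => hT.not_mem_exposed v h)
        (isBridge_of_pair (f := mate f) (fun j hj _ => hone j hj) hi ?_ hie hft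
          fun v _ h _ => hT.not_mem_exposed v h) hx' hy' hxy
      rw [hiv, mate_mate, Set.pair_comm]

end PathStep

/-! ### Closing two paths to a spanning cycle -/

section Closing

variable {m : ℕ} {F : List (Fault (SignedPermutation (m + 1)))}
  {S T T₁ T₂ : Finset (SignedSymbol (m + 1))} {s t c : SignedSymbol (m + 1)}
  {a b a₁ a₂ b₁ b₂ r : SignedPermutation (m + 1)} {A B : Set (SignedPermutation (m + 1))}

/-- Two paths that together span the copies in `S` are joined to a cycle by two further paths. -/
theorem hamCycle_of_two_links (hm : 3 ≤ m) (hl : F.length + 1 ≤ m) (hA : HamPath (live F) A a₁ a₂)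
    (hB : HamPath (live F) B b₁ b₂) (e : region F S = A ∪ B) (hAB : Disjoint A B)
    (ha₁ : a₁ ∉ exposed F) (ha₂ : a₂ ∉ exposed F) (hb₁ : b₁ ∉ exposed F) (hb₂ : b₂ ∉ exposed F)
    (h₁ : HamPath (live F) (region F T₁) (mate a₁) (mate b₁))
    (h₂ : HamPath (live F) (region F T₂) (mate a₂) (mate b₂)) (hS₁ : Disjoint S T₁)
    (hS₂ : Disjoint S T₂) (hT : Disjoint T₁ T₂) (hall : ∀ r, r ∈ S ∪ T₁ ∪ T₂) :
    HamCycle (live F) (deleted F)ᶜ := by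
  have d1 := e ▸ region_disjoint (F := F) hS₁
  have d2 := e ▸ region_disjoint (F := F) hS₂
  have d3 := region_disjoint (F := F) hT
  rw [Set.disjoint_union_left] at d1 d2
  have p1 := hA.symm.trans (live_adj_mate ha₁) h₁ d1.1
  have p2 := p1.trans (live_adj_mate hb₁).symm hB (Set.disjoint_union_left.2 ⟨hAB, d1.2.symm⟩)
  have p3 := p2.trans (live_adj_mate hb₂) h₂.symm
    (Set.disjoint_union_left.2 ⟨Set.disjoint_union_left.2 ⟨d2.1, d3⟩, d2.2⟩)
  refine hamCycle_of_hamPath hm hl (p3.congr ?_) (live_adj_mate ha₂).symm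
  rw [← region_univ, ← Finset.eq_univ_of_forall hall, ← region_union, ← region_union, e]
  ext v
  simp only [Set.mem_union]
  tauto

/-- The copies other than `s` are good, and the fault-free vertices with mates outside `s` can be
left along the edges to their mates. This is the situation in which all faults hit `s` and no other
copy is hit by many of them. -/
structure OneBad (F : List (Fault (SignedPermutation (m + 1)))) (s : SignedSymbol (m + 1)) :
    Prop where
  le : 3 ≤ m
  valid : Valid (burntPancake (m + 1)) F
  length : F.length + 1 ≤ m
  not_mem_exposed : ∀ v, v ∉ deleted F → cls v ≠ s → v ∉ exposed F
  good : ∀ r, r ≠ s → Good F r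

theorem OneBad.of_mem (h : OneBad F s) (ha : a ∈ region F {s}) :
    a ∉ exposed F ∧ mate a ∉ deleted F ∧ cls a ≠ s := by
  have ha := mem_region_singleton.1 ha
  have hm : 0 < m := by have := h.le; omega
  have h1 : cls a ≠ s := ha.1 ▸ cls_ne_copy hm a
  have h2 := h.not_mem_exposed a ha.2 h1
  exact ⟨h2, mate_not_mem_deleted h2, h1⟩

theorem OneBad.good_of_mem (h : OneBad F s) (hs : s ∈ S) : ∀ r ∈ Sᶜ, Good F r := fun r hr =>
  h.good r (by rintro rfl; exact Finset.mem_compl.1 hr hs)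

/-- One end of each path has its mate in the copy `cls a₁`, which joins these two ends; the other
ends are joined through the remaining copies. -/
theorem OneBad.hamCycle_of_eq (h : OneBad F s) (hA : HamPath (live F) A a₁ a₂)
    (hB : HamPath (live F) B b₁ b₂) (e : region F {s} = A ∪ B) (hAB : Disjoint A B)
    (ha : cls a₁ ≠ cls b₁) (hb : cls a₂ ≠ cls b₂) (hc : cls a₁ = cls b₂) :
    HamCycle (live F) (deleted F)ᶜ := by
  obtain ⟨e1, d1, n1⟩ := h.of_mem (e ▸ .inl hA.left_mem : a₁ ∈ region F {s})
  obtain ⟨e2, d2, n2⟩ := h.of_mem (e ▸ .inl hA.right_mem : a₂ ∈ region F {s})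
  obtain ⟨e3, d3, n3⟩ := h.of_mem (e ▸ .inr hB.left_mem : b₁ ∈ region F {s})
  obtain ⟨e4, d4, n4⟩ := h.of_mem (e ▸ .inr hB.right_mem : b₂ ∈ region F {s})
  have hne : ∀ {a b}, a ∈ A → b ∈ B → mate a ≠ mate b := fun ha hb e =>
    Set.disjoint_left.1 hAB ha (mate_inj.1 e ▸ hb)
  have h1 := h.good _ n1 (mate a₁) (mate b₂) (hne hA.left_mem hB.right_mem)
    (mem_region_singleton.2 ⟨rfl, d1⟩) (mem_region_singleton.2 ⟨hc.symm, d4⟩)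
  have h2 := hamPath_region (T := {s, cls a₁}ᶜ) (x := mate a₂) (y := mate b₁) h.le h.valid h.length
    (h.good_of_mem (by simp)) (by rw [compl_compl]; exact Finset.card_le_two)
    ⟨by simp [copy_mate, n2, hc, hb], d2⟩ ⟨by simp [copy_mate, n3, Ne.symm ha], d3⟩
    (hne hA.right_mem hB.left_mem)
  refine hamCycle_of_two_links h.le h.length hA hB.symm e hAB e1 e2 e4 e3 h1 h2 ?_ ?_ ?_ ?_
  · simpa using n1.symm
  · simp
  · simp
  · intro r
    simp only [Finset.mem_union, Finset.mem_compl, Finset.mem_insert, Finset.mem_singleton]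
    tauto

/-- Two disjoint paths whose four ends have their mates in distinct copies. -/
theorem hamCycle_of_ne (hm : 3 ≤ m) (hF : Valid (burntPancake (m + 1)) F) (hl : F.length + 1 ≤ m)
    (hg : ∀ r ∈ Sᶜ, Good F r) (hS : 6 ≤ Sᶜ.card)
    (hA : HamPath (live F) A a₁ a₂) (hB : HamPath (live F) B b₁ b₂) (e : region F S = A ∪ B)
    (hAB : Disjoint A B) (ha₁ : a₁ ∉ exposed F) (ha₂ : a₂ ∉ exposed F) (hb₁ : b₁ ∉ exposed F)
    (hb₂ : b₂ ∉ exposed F) (ha₁S : cls a₁ ∉ S) (ha₂S : cls a₂ ∉ S) (hb₁S : cls b₁ ∉ S)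
    (hb₂S : cls b₂ ∉ S) (h12 : cls a₁ ≠ cls a₂) (h13 : cls a₁ ≠ cls b₁) (h14 : cls a₁ ≠ cls b₂)
    (h23 : cls a₂ ≠ cls b₁) (h24 : cls a₂ ≠ cls b₂) (h34 : cls b₁ ≠ cls b₂) :
    HamCycle (live F) (deleted F)ᶜ := by
  rw [← Finset.mem_compl] at ha₁S ha₂S hb₁S hb₂S
  obtain ⟨T₁, T₂, hU, hd, h⟩ := exists_two_routes hS ha₁S ha₂S hb₁S hb₂S h12 h13 h14 h23 h24 h34
  have hroute : ∀ {T x y}, T ⊆ Sᶜ → Route T (cls x) (cls y) → x ∉ exposed F → y ∉ exposed F →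
      cls x ≠ cls y → HamPath (live F) (region F T) (mate x) (mate y) :=
    fun {T x y} hT hr hx hy hxy => hr.hamPath (by omega) hF (length_add_lt hm hl)
      (fun t ht => hg t (hT ht)) rfl rfl (mate_not_mem_deleted hx) (mate_not_mem_deleted hy)
      fun e => hxy (by rw [mate_inj.1 e])
  have hT₁ : T₁ ⊆ Sᶜ := hU ▸ Finset.subset_union_left
  have hT₂ : T₂ ⊆ Sᶜ := hU ▸ Finset.subset_union_right
  have hS₁ : Disjoint S T₁ := disjoint_compl_right.mono_right hT₁
  have hS₂ : Disjoint S T₂ := disjoint_compl_right.mono_right hT₂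
  have hall : ∀ r, r ∈ S ∪ T₁ ∪ T₂ := fun r => by
    rw [Finset.union_assoc, ← hU]
    simp
  rcases h with ⟨h1, h2⟩ | ⟨h1, h2⟩
  · exact hamCycle_of_two_links hm hl hA hB e hAB ha₁ ha₂ hb₁ hb₂ (hroute hT₁ h1 ha₁ hb₁ h13)
      (hroute hT₂ h2 hb₂ ha₂ h24.symm).symm hS₁ hS₂ hd hall
  · exact hamCycle_of_two_links hm hl hA hB.symm e hAB ha₁ ha₂ hb₂ hb₁ (hroute hT₁ h1 ha₁ hb₂ h14)
      (hroute hT₂ h2 hb₁ ha₂ h23.symm).symm hS₁ hS₂ hd hall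

/-- The ends of one of the paths have their mates in one copy. -/
theorem OneBad.hamCycle_of_left_eq (h : OneBad F s) (hA : HamPath (live F) A a₁ a₂)
    (hB : HamPath (live F) B b₁ b₂) (e : region F {s} = A ∪ B) (hAB : Disjoint A B)
    (haa : a₁ ≠ a₂) (ha : cls a₁ = cls a₂) (hb₁ : cls b₁ ≠ cls a₁) (hb₂ : cls b₂ ≠ cls a₁)
    (hbb : cls b₁ ≠ cls b₂) : HamCycle (live F) (deleted F)ᶜ := by
  have hm : 0 < m := by have := h.le; omega
  obtain ⟨e1, d1, n1⟩ := h.of_mem (e ▸ .inl hA.left_mem : a₁ ∈ region F {s})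
  obtain ⟨e2, d2, n2⟩ := h.of_mem (e ▸ .inl hA.right_mem : a₂ ∈ region F {s})
  obtain ⟨e3, d3, n3⟩ := h.of_mem (e ▸ .inr hB.left_mem : b₁ ∈ region F {s})
  obtain ⟨e4, d4, n4⟩ := h.of_mem (e ▸ .inr hB.right_mem : b₂ ∈ region F {s})
  have hpath := h.good _ n1 (mate a₁) (mate a₂) (fun e => haa (mate_inj.1 e))
    (mem_region_singleton.2 ⟨rfl, d1⟩) (mem_region_singleton.2 ⟨ha.symm, d2⟩)
  have hnum := four_mul_lt (k := 2) h.le h.length (by omega)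
  obtain ⟨u, v, X₁, X₂, eX, dX, q1, -, q2, hcu, hcv, hue, hve, huS, hvS, huv⟩ :=
    hpath.exists_cut_link hm {s, cls b₁} (by
      have := Finset.card_pair n3.symm
      rw [this]
      omega)
  simp only [Finset.mem_insert, Finset.mem_singleton, not_or] at huS hvS
  have huc : cls u ≠ cls a₁ := hcu ▸ cls_ne_copy hm u
  have hvc : cls v ≠ cls a₁ := hcv ▸ cls_ne_copy hm v
  -- the first path and the copy of the mates of its ends form a cycle, which is cut elsewhere
  have dsc := region_disjoint (F := F) (S := {s}) (T := {cls a₁}) (by simpa using n1.symm)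
  rw [e, eX, Set.disjoint_union_left, Set.disjoint_union_right, Set.disjoint_union_right] at dsc
  have hA' := (q1.symm.trans (live_adj_mate e1).symm hA dsc.1.1.symm).trans (live_adj_mate e2)
    q2.symm (Set.disjoint_union_left.2 ⟨dX, dsc.1.2⟩)
  have e' : region F {s, cls a₁} = (X₁ ∪ A ∪ X₂) ∪ B := by
    rw [Finset.insert_eq, ← region_union, e, eX]
    ext v
    simp only [Set.mem_union]
    tauto
  have hd' : Disjoint (X₁ ∪ A ∪ X₂) B := Set.disjoint_union_left.2
    ⟨Set.disjoint_union_left.2 ⟨dsc.2.1.symm, hAB⟩, dsc.2.2.symm⟩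
  have hcard := card_add_card_compl ({s, cls a₁} : Finset (SignedSymbol (m + 1)))
  rw [Finset.card_pair n1.symm] at hcard
  have key : ∀ {A' u v}, HamPath (live F) A' u v → region F {s, cls a₁} = A' ∪ B → Disjoint A' B →
      u ∉ exposed F → v ∉ exposed F → copy u = cls a₁ → cls v ≠ s → cls v ≠ cls b₁ →
      cls v ≠ cls a₁ → cls u ≠ cls v → cls u = cls b₂ → HamCycle (live F) (deleted F)ᶜ := by
    intro A' u v hA' e' hd' hue hve hcu hvs hvb hvc huv hu
    have h1 := h.good _ n4 (mate u) (mate b₂) (fun e => Set.disjoint_left.1 hd' hA'.left_mem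
      (mate_inj.1 e ▸ hB.right_mem)) (mem_region_singleton.2 ⟨hu, mate_not_mem_deleted hue⟩)
      (mem_region_singleton.2 ⟨rfl, d4⟩)
    have hcard' := card_add_card_compl ({s, cls a₁, cls b₂} : Finset (SignedSymbol (m + 1)))
    have hle := Finset.card_le_three (a := s) (b := cls a₁) (c := cls b₂)
    have h2 := hamPath_region_of_copy_ne (T := {s, cls a₁, cls b₂}ᶜ) (x := mate v) (y := mate b₁)
      h.le h.valid h.length (h.good_of_mem (by simp)) (by have := h.le; omega)
      ⟨by simp [copy_mate, hvs, hvc, ← hu, Ne.symm huv], mate_not_mem_deleted hve⟩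
      ⟨by simp [copy_mate, n3, hb₁, hbb], d3⟩ hvb
    refine hamCycle_of_two_links h.le h.length hA' hB.symm e' hd' hue hve e4 e3 h1 h2 ?_ ?_ ?_ ?_
    · simp [n4, hb₂]
    · rw [Finset.disjoint_left]
      intro r
      simp only [Finset.mem_compl, Finset.mem_insert, Finset.mem_singleton]
      tauto
    · simp
    · intro r
      simp only [Finset.mem_union, Finset.mem_compl, Finset.mem_insert, Finset.mem_singleton]
      tauto
  by_cases hu : cls u = cls b₂
  · exact key hA' e' hd' hue hve hcu hvS.1 hvS.2 hvc huv hu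
  by_cases hv : cls v = cls b₂
  · exact key hA'.symm e' hd' hve hue hcv huS.1 huS.2 huc huv.symm hv
  · exact hamCycle_of_ne h.le h.valid h.length (h.good_of_mem (by simp)) (by have := h.le; omega)
      hA' hB e' hd' hue hve e3 e4 (by simp [huS, huc]) (by simp [hvS, hvc]) (by simp [n3, hb₁])
      (by simp [n4, hb₂]) huv huS.2 hu hvS.2 hv hbb

/-- A path with both ends linked to the copy `c` and this copy form a cycle, which is cut next to
a vertex `r`. -/
theorem OneBad.exists_loop (h : OneBad F s) (hA : HamPath (live F) A a₁ a₂) (hAs : A ⊆ region F {s})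
    (haa : a₁ ≠ a₂) (ha₁ : cls a₁ = c) (ha₂ : cls a₂ = c) (hr : r ∈ region F {c})
    (hr₁ : r ≠ mate a₁) (hr₂ : r ≠ mate a₂) :
    ∃ w, HamPath (live F) (A ∪ region F {c}) w r ∧ (burntPancake (m + 1)).Adj r w ∧ copy w = c ∧
      w ∉ deleted F ∧ cls w ≠ s := by
  have hm : 0 < m := by have := h.le; omega
  have hA1 := hAs hA.left_mem
  have hA2 := hAs hA.right_mem
  obtain ⟨e1, d1, n1⟩ := h.of_mem hA1
  obtain ⟨e2, d2, n2⟩ := h.of_mem hA2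
  have hpath := h.good c (ha₁ ▸ n1) (mate a₁) (mate a₂) (fun e => haa (mate_inj.1 e))
    (mem_region_singleton.2 ⟨ha₁, d1⟩) (mem_region_singleton.2 ⟨ha₂, d2⟩)
  obtain ⟨g, k, X₁, X₂, eX, dX, q1, hg, hk, q2⟩ := hpath.remove_vertex hr hr₁ hr₂
  have hgk : g ≠ k := fun e => Set.disjoint_left.1 dX q1.right_mem (e ▸ q2.left_mem)
  have hgX := mem_region_singleton.1 (show g ∈ region F {c} from
    (eX ▸ .inl q1.right_mem : g ∈ region F {c} \ {r}).1)
  have hkX := mem_region_singleton.1 (show k ∈ region F {c} from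
    (eX ▸ .inr q2.left_mem : k ∈ region F {c} \ {r}).1)
  have hrc := (mem_region_singleton.1 hr).1
  have hrX : r ∉ X₁ ∪ X₂ := eX ▸ fun h => h.2 rfl
  have eX' : region F {c} = X₁ ∪ X₂ ∪ {r} := by
    rw [← eX, Set.sdiff_union_self, Set.union_eq_left.2 (by simpa using hr)]
  have dA : Disjoint A (region F {c}) := Disjoint.mono_left hAs
    (region_disjoint (by simpa using fun e => n1 (ha₁.trans e.symm)))
  rw [eX', Set.disjoint_union_right, Set.disjoint_union_right] at dA
  rw [Set.mem_union, not_or] at hrX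
  -- one of the two neighbours of `r` on the path has its mate outside `s`; the edge to it is cut
  by_cases hgs : cls g = s
  · have hks : cls k ≠ s := fun e => cls_ne_of_adj_adj hm (live_adj_adj hg.symm) (live_adj_adj hk)
      (hgX.1.trans hrc.symm) (hkX.1.trans hrc.symm) hgk (hgs.trans e.symm)
    refine ⟨k, ?_, live_adj_adj hk, hkX.1, hkX.2, hks⟩
    have p := ((q2.trans (live_adj_mate e2).symm hA.symm dA.1.2.symm).trans (live_adj_mate e1) q1
      (Set.disjoint_union_left.2 ⟨dX.symm, dA.1.1⟩)).trans hg (.single r) (by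
        simpa [hrX] using Set.disjoint_singleton_right.1 dA.2)
    refine p.congr ?_
    rw [eX']
    ext v
    simp only [Set.mem_union]
    tauto
  · refine ⟨g, ?_, (live_adj_adj hg).symm, hgX.1, hgX.2, hgs⟩
    have p := ((q1.symm.trans (live_adj_mate e1).symm hA dA.1.1.symm).trans (live_adj_mate e2)
      q2.symm (Set.disjoint_union_left.2 ⟨dX, dA.1.2⟩)).trans hk.symm (.single r) (by
        simpa [hrX] using Set.disjoint_singleton_right.1 dA.2)
    refine p.congr ?_
    rw [eX']
    ext v
    simp only [Set.mem_union]
    tauto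

/-- The ends of each path have their mates in one copy. -/
theorem OneBad.hamCycle_of_eq_eq (h : OneBad F s) (hA : HamPath (live F) A a₁ a₂)
    (hB : HamPath (live F) B b₁ b₂) (e : region F {s} = A ∪ B) (hAB : Disjoint A B)
    (haa : a₁ ≠ a₂) (hbb : b₁ ≠ b₂) (ha : cls a₁ = cls a₂) (hb : cls b₁ = cls b₂)
    (hab : (cls a₁).1 ≠ (cls b₁).1) : HamCycle (live F) (deleted F)ᶜ := by
  have hm : 0 < m := by have := h.le; omega
  have hA1 : a₁ ∈ region F {s} := e ▸ .inl hA.left_mem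
  have hB1 : b₁ ∈ region F {s} := e ▸ .inr hB.left_mem
  have hB2 : b₂ ∈ region F {s} := e ▸ .inr hB.right_mem
  obtain ⟨e1, d1, n1⟩ := h.of_mem hA1
  obtain ⟨e3, d3, n3⟩ := h.of_mem hB1
  have hcd : cls a₁ ≠ cls b₁ := fun e => hab (by rw [e])
  obtain ⟨r, hrc, hrd, hre, hrX⟩ := exists_link hm h.valid hab {mate a₁, mate a₂} (by
    have h1 := Set.ncard_insert_le (mate a₁) {mate a₂}
    have h2 := length_add_lt h.le h.length
    rw [Set.ncard_singleton] at h1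
    omega)
  simp only [Set.mem_insert_iff, Set.mem_singleton_iff, not_or] at hrX
  have hrs : copy r ≠ s := hrc ▸ n1
  have hne : ∀ {b}, b ∈ region F {s} → mate r ≠ mate b := fun hb e =>
    hrs (mate_inj.1 e ▸ (mem_region_singleton.1 hb).1)
  obtain ⟨w, hw, hrw, hwc, hwF, hws⟩ := h.exists_loop hA (by rw [e]; exact Set.subset_union_left)
    haa rfl ha.symm (mem_region_singleton.2 ⟨hrc, not_mem_deleted hre⟩) hrX.1 hrX.2
  obtain ⟨z, hz, hrz, hzc, hzF, hzs⟩ := h.exists_loop hB (by rw [e]; exact Set.subset_union_right)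
    hbb rfl hb.symm (mem_region_singleton.2 ⟨(copy_mate r).trans hrd, mate_not_mem_deleted hre⟩)
    (hne hB1) (hne hB2)
  -- the two loops are joined along the edge from `r` to its mate, and the remaining ends `w` and
  -- `z` have mates in different copies
  have hwz := cls_ne_cls_across hm hrw (hwc.trans hrc.symm) hrz
    (hzc.trans ((copy_mate r).trans hrd).symm)
  have hwc' : cls w ≠ cls a₁ := hwc ▸ cls_ne_copy hm w
  have hzc' : cls z ≠ cls b₁ := hzc ▸ cls_ne_copy hm z
  have hwd : cls w ≠ cls b₁ := hrd ▸ (cls_ne_of_adj hm hrw (hwc.trans hrc.symm)).symm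
  have hzd : cls z ≠ cls a₁ := by
    have := (cls_ne_of_adj hm hrz (hzc.trans ((copy_mate r).trans hrd).symm)).symm
    rwa [cls_mate, hrc] at this
  have hwe := h.not_mem_exposed w hwF hws
  have hze := h.not_mem_exposed z hzF hzs
  have dcd := region_disjoint (F := F) (S := {cls a₁}) (T := {cls b₁}) (by simpa using hcd)
  have dsc := region_disjoint (F := F) (S := {s}) (T := {cls a₁}) (by simpa using n1.symm)
  have dsd := region_disjoint (F := F) (S := {s}) (T := {cls b₁}) (by simpa using n3.symm)
  rw [e, Set.disjoint_union_left] at dsc dsd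
  have hp := hw.trans (live_adj_mate hre) hz.symm (Set.disjoint_union_left.2
    ⟨Set.disjoint_union_right.2 ⟨hAB, dsd.1⟩, Set.disjoint_union_right.2 ⟨dsc.2.symm, dcd⟩⟩)
  have hcard := card_add_card_compl ({s, cls a₁, cls b₁} : Finset (SignedSymbol (m + 1)))
  have hle := Finset.card_le_three (a := s) (b := cls a₁) (c := cls b₁)
  have h1 := hamPath_region_of_copy_ne (T := {s, cls a₁, cls b₁}ᶜ) (x := mate w) (y := mate z)
    h.le h.valid h.length (h.good_of_mem (by simp)) (by have := h.le; omega)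
    ⟨by simp [copy_mate, hws, hwc', hwd], mate_not_mem_deleted hwe⟩
    ⟨by simp [copy_mate, hzs, hzc', hzd], mate_not_mem_deleted hze⟩ hwz
  refine (hp.congr (Y := region F {s, cls a₁, cls b₁}) ?_).hamCycle h.le h.length hwe hze h1
  rw [Finset.insert_eq, Finset.insert_eq, ← region_union, ← region_union, e]
  ext v
  simp only [Set.mem_union]
  tauto

/-- Two paths that together span the only bad copy extend to a spanning cycle. The proof depends on
which of the four ends have their mates in a common copy. -/
theorem OneBad.hamCycle_of_two_paths (h : OneBad F s) (hA : HamPath (live F) A a₁ a₂)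
    (hB : HamPath (live F) B b₁ b₂) (e : region F {s} = A ∪ B) (hAB : Disjoint A B)
    (haa : a₁ ≠ a₂) (hbb : b₁ ≠ b₂) (hab : (cls a₁).1 ≠ (cls b₁).1) (hab' : cls a₂ ≠ cls b₂) :
    HamCycle (live F) (deleted F)ᶜ := by
  have hab1 : cls a₁ ≠ cls b₁ := fun e => hab (by rw [e])
  by_cases h1 : cls a₁ = cls b₂
  · exact h.hamCycle_of_eq hA hB e hAB hab1 hab' h1
  by_cases h2 : cls a₂ = cls b₁
  · exact h.hamCycle_of_eq hA.symm hB.symm e hAB hab' hab1 h2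
  by_cases h3 : cls a₁ = cls a₂
  · by_cases h4 : cls b₁ = cls b₂
    · exact h.hamCycle_of_eq_eq hA hB e hAB haa hbb h3 h4 hab
    · exact h.hamCycle_of_left_eq hA hB e hAB haa h3 hab1.symm (Ne.symm h1) h4
  by_cases h4 : cls b₁ = cls b₂
  · exact h.hamCycle_of_left_eq hB hA (by rw [e, Set.union_comm]) hAB.symm hbb h4 hab1
      (by rwa [h4]) h3
  obtain ⟨e1, d1, n1⟩ := h.of_mem (e ▸ .inl hA.left_mem : a₁ ∈ region F {s})
  obtain ⟨e2, d2, n2⟩ := h.of_mem (e ▸ .inl hA.right_mem : a₂ ∈ region F {s})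
  obtain ⟨e3, d3, n3⟩ := h.of_mem (e ▸ .inr hB.left_mem : b₁ ∈ region F {s})
  obtain ⟨e4, d4, n4⟩ := h.of_mem (e ▸ .inr hB.right_mem : b₂ ∈ region F {s})
  have hcard := card_add_card_compl ({s} : Finset (SignedSymbol (m + 1)))
  rw [Finset.card_singleton] at hcard
  exact hamCycle_of_ne h.le h.valid h.length (h.good_of_mem (by simp)) (by have := h.le; omega)
    hA hB e hAB e1 e2 e3 e4 (by simpa) (by simpa) (by simpa) (by simpa) h3 hab1 h1 h2 hab' h4

end Closing

/-! ### Spanning cycles with one or two bad copies -/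

section Counting

variable {m : ℕ} {F F' : List (Fault (SignedPermutation (m + 1)))}
  {i : Fault (SignedPermutation (m + 1))} {s t r : SignedSymbol (m + 1)}

/-- No fault hits three copies. -/
theorem Hits.not_three (hi : i.Admissible (burntPancake (m + 1))) (hs : Hits i s) (ht : Hits i t)
    (hst : s ≠ t) (hrs : r ≠ s) (hrt : r ≠ t) : ¬ Hits i r := by
  obtain ⟨f, hfs, hft, hv, he⟩ := hs.exists_mate hi ht hst
  rw [hits_mate_iff hv he, hfs, hft]
  tauto

open Classical in
theorem sum_hitCount_cons (U : Finset (SignedSymbol (m + 1))) :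
    ∑ c ∈ U, hitCount (i :: F) c = (U.filter fun c => Hits i c).card + ∑ c ∈ U, hitCount F c := by
  rw [Finset.card_filter, ← Finset.sum_add_distrib]
  refine Finset.sum_congr rfl fun c _ => ?_
  by_cases h : Hits i c
  · rw [hitCount_cons_pos h, if_pos h, add_comm]
  · rw [hitCount_cons_neg h, if_neg h, zero_add]

/-- A fault hits at most two copies. -/
theorem sum_hitCount_le (hF : ∀ i ∈ F, i.Admissible (burntPancake (m + 1)))
    (U : Finset (SignedSymbol (m + 1))) : ∑ c ∈ U, hitCount F c ≤ 2 * F.length := by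
  classical
  induction F with
  | nil => simp [hitCount]
  | cons i F ih =>
    have h1 : (U.filter fun c => Hits i c).card ≤ 2 := by
      by_contra! h
      obtain ⟨a, b, c, ha, hb, hc, hab, hac, hbc⟩ := Finset.two_lt_card_iff.1 h
      exact (Finset.mem_filter.1 ha).2.not_three (hF i (by simp)) (Finset.mem_filter.1 hb).2 hab
        hac.symm hbc.symm (Finset.mem_filter.1 hc).2
    have h2 := ih fun i hi => hF i (by simp [hi])
    rw [sum_hitCount_cons, List.length_cons]
    omega

/-- If the faults hit as many copies as possible, each of them hits two. -/
theorem exists_two_hits (hF : ∀ i ∈ F, i.Admissible (burntPancake (m + 1))) (hi : i ∈ F)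
    {U : Finset (SignedSymbol (m + 1))} (hU : 2 * F.length ≤ ∑ c ∈ U, hitCount F c) :
    ∃ c ∈ U, ∃ c' ∈ U, c ≠ c' ∧ Hits i c ∧ Hits i c' := by
  classical
  obtain ⟨F', hF'⟩ := exists_perm_cons hi
  have h1 : ∑ c ∈ U, hitCount F c = ∑ c ∈ U, hitCount (i :: F') c :=
    Finset.sum_congr rfl fun c _ => hitCount_perm hF'
  have h2 := sum_hitCount_le (F := F') (fun j hj => hF j (hF'.mem_iff.2 (by simp [hj]))) U
  rw [h1, sum_hitCount_cons, hF'.length_eq, List.length_cons] at hU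
  obtain ⟨a, ha, b, hb, hab⟩ := Finset.one_lt_card.1
    (show 1 < (U.filter fun c => Hits i c).card by omega)
  exact ⟨a, (Finset.mem_filter.1 ha).1, b, (Finset.mem_filter.1 hb).1, hab,
    (Finset.mem_filter.1 ha).2, (Finset.mem_filter.1 hb).2⟩

theorem exists_hits (h : 0 < hitCount F s) : ∃ i ∈ F, Hits i s := by
  by_contra! hc
  exact h.ne' (hitCount_eq_zero.2 hc)

theorem eq_of_hitCount_le_one {j : Fault (SignedPermutation (m + 1))} (h : hitCount F s ≤ 1)
    (hi : i ∈ F) (his : Hits i s) (hj : j ∈ F) (hjs : Hits j s) : j = i := by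
  obtain ⟨F', hF'⟩ := exists_perm_cons hi
  rw [hitCount_perm hF', hitCount_cons_pos his] at h
  by_contra hne
  have hj' : j ∈ F' := by simpa [hne] using hF'.mem_iff.1 hj
  exact hitCount_eq_zero.1 (by omega) j hj' hjs

/-- The effect of a fault on a copy that it hits: one missing vertex, one missing edge, or two
missing adjacent vertices. -/
theorem Hits.cases (hi : i.Admissible (burntPancake (m + 1))) (hs : Hits i s) :
    (∃ f, copy f = s ∧ i.edges = ∅ ∧ ∀ v, copy v = s → (v ∈ i.verts ↔ v = f)) ∨
    (i.verts = ∅ ∧ ∃ a b, i.edges = {s(a, b)}) ∨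
    ∃ a b, i.verts = {a, b} ∧ i.edges = ∅ ∧ copy a = s ∧ copy b = s ∧
      (burntPancake (m + 1)).Adj a b := by
  cases i with
  | vertex v =>
    left
    simp only [Hits, Fault.verts, Fault.edges, Set.mem_singleton_iff, exists_eq_left,
      Set.mem_empty_iff_false, false_and, exists_false, or_false] at hs
    exact ⟨v, hs, rfl, fun w _ => Iff.rfl⟩
  | edge a b => exact .inr (.inl ⟨rfl, a, b, rfl⟩)
  | pair a b =>
    have hab : (burntPancake (m + 1)).Adj a b := hi
    simp only [Hits, Fault.verts, Fault.edges, Set.mem_insert_iff, Set.mem_singleton_iff,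
      Set.mem_empty_iff_false, false_and, exists_false, or_false, exists_eq_or_imp,
      exists_eq_left] at hs
    by_cases ha : copy a = s
    · by_cases hb : copy b = s
      · exact .inr (.inr ⟨a, b, rfl, rfl, ha, hb, hab⟩)
      · refine .inl ⟨a, ha, rfl, fun v hv => ?_⟩
        simp only [Fault.verts, Set.mem_insert_iff, Set.mem_singleton_iff]
        exact ⟨fun h => h.resolve_right (by rintro rfl; exact hb hv), .inl⟩
    · have hb := hs.resolve_left ha
      refine .inl ⟨b, hb, rfl, fun v hv => ?_⟩
      simp only [Fault.verts, Set.mem_insert_iff, Set.mem_singleton_iff]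
      exact ⟨fun h => h.resolve_left (by rintro rfl; exact ha hv), .inr⟩

theorem live_eq_of_perm (hF' : F.Perm (i :: F')) (hi : i.edges = ∅) : live F = live F' := by
  rw [live, live, cut_perm hF', cut_cons, hi, Set.empty_union]

/-- A copy with one vertex restored. -/
theorem region_of_perm {f : SignedPermutation (m + 1)} (hF : Valid (burntPancake (m + 1)) F)
    (hF' : F.Perm (i :: F')) (hf : copy f = s) (hi : ∀ v, copy v = s → (v ∈ i.verts ↔ v = f)) :
    f ∈ region F' {s} ∧ region F {s} = region F' {s} \ {f} := by
  have hd : deleted F = i.verts ∪ deleted F' := by rw [deleted_perm hF', deleted_cons]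
  refine ⟨mem_region_singleton.2 ⟨hf, fun h' =>
    Set.disjoint_left.1 (hF.perm hF').disjoint ((hi f hf).2 rfl) h'⟩, ?_⟩
  ext v
  simp only [mem_region_singleton, hd, Set.mem_union, Set.mem_singleton_iff, Set.mem_sdiff]
  have := hi v
  tauto

/-- A spanning path of a copy with a missing vertex `f`, from a spanning cycle of the copy with `f`
restored. -/
theorem exists_path_of_restored {f : SignedPermutation (m + 1)} (hm : 0 < m)
    (hF : Valid (burntPancake (m + 1)) F) (hF' : F.Perm (i :: F')) (hf : copy f = s)
    (hi : ∀ v, copy v = s → (v ∈ i.verts ↔ v = f)) (hie : i.edges = ∅)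
    (hC : HamCycle (live F') (region F' {s})) :
    ∃ g k, HamPath (live F) (region F {s}) g k ∧ (burntPancake (m + 1)).Adj f g ∧
      (burntPancake (m + 1)).Adj f k ∧ g ∈ region F {s} ∧ k ∈ region F {s} ∧ cls g ≠ cls k ∧
      cls g ≠ cls f ∧ cls k ≠ cls f := by
  obtain ⟨hfX, hreg⟩ := region_of_perm hF hF' hf hi
  obtain ⟨g, k, hgk, hg, hk, hp⟩ := hC.delete_vertex hfX
  rw [← hreg, ← live_eq_of_perm hF' hie] at hp
  have hgX := mem_region_singleton.1 hp.left_mem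
  have hkX := mem_region_singleton.1 hp.right_mem
  have hg := live_adj_adj hg
  have hk := live_adj_adj hk
  exact ⟨g, k, hp, hg, hk, hp.left_mem, hp.right_mem,
    cls_ne_of_adj_adj hm hg hk (hgX.1.trans hf.symm) (hkX.1.trans hf.symm) hgk,
    (cls_ne_of_adj hm hg (hgX.1.trans hf.symm)).symm,
    (cls_ne_of_adj hm hk (hkX.1.trans hf.symm)).symm⟩

end Counting

section MostlyHit

variable {m : ℕ} {F F' : List (Fault (SignedPermutation (m + 1)))}
  {i : Fault (SignedPermutation (m + 1))} {s t r : SignedSymbol (m + 1)}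
  {a b f g k : SignedPermutation (m + 1)}

/-- A spanning path of the only bad copy extends to a spanning cycle. -/
theorem hamCycle_of_one_bad (hm : 3 ≤ m) (hF : Valid (burntPancake (m + 1)) F)
    (hl : F.length + 1 ≤ m) (hg : ∀ r, r ≠ s → Good F r) (h : HamPath (live F) (region F {s}) a b)
    (hab : a ≠ b) (ha : a ∉ exposed F) (hb : b ∉ exposed F) : HamCycle (live F) (deleted F)ᶜ := by
  have hm0 : 0 < m := by omega
  have hca := (mem_region_singleton.1 h.left_mem).1
  have hcb := (mem_region_singleton.1 h.right_mem).1
  exact h.hamCycle hm hl ha hb (hamPath_region hm hF hl (fun r hr => hg r (by simpa using hr))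
    (by simp) ⟨by simpa [copy_mate, ← hca] using cls_ne_copy hm0 a, mate_not_mem_deleted ha⟩
    ⟨by simpa [copy_mate, ← hcb] using cls_ne_copy hm0 b, mate_not_mem_deleted hb⟩
    fun e => hab (mate_inj.1 e))

/-- A spanning path of one of two bad copies extends to a spanning cycle. -/
theorem hamCycle_of_two_bad (hm : 3 ≤ m) (hF : Valid (burntPancake (m + 1)) F)
    (hl : F.length + 1 ≤ m) (hg : ∀ r, r ≠ s → r ≠ t → Good F r) (hst : s ≠ t)
    (h : HamPath (live F) (region F {s}) a b)
    (hab : cls a ≠ cls b) (ha : a ∉ exposed F) (hb : b ∉ exposed F) (hat : cls a ≠ t)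
    (hbt : cls b ≠ t) (hC : HamCycle (live F) (region F {t})) :
    HamCycle (live F) (deleted F)ᶜ := by
  have hm0 : 0 < m := by omega
  have hca := (mem_region_singleton.1 h.left_mem).1
  have hcb := (mem_region_singleton.1 h.right_mem).1
  have has : cls a ≠ s := hca ▸ cls_ne_copy hm0 a
  have hbs : cls b ≠ s := hcb ▸ cls_ne_copy hm0 b
  have h1 := hamPath_insert (T := {s, t}ᶜ) (t := t) (x := mate a) (y := mate b) hm hF hl
    (fun r hr => by simp at hr; exact hg r (by tauto) (by tauto)) (by simp) hC
    (.inl (by rw [compl_compl]; exact Finset.card_le_two))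
    ⟨by simp [copy_mate, has, hat], mate_not_mem_deleted ha⟩
    ⟨by simp [copy_mate, hbs, hbt], mate_not_mem_deleted hb⟩ hab
  refine h.hamCycle hm hl ha hb (h1.congr ?_)
  congr 1
  ext r
  simp only [Finset.mem_insert, Finset.mem_compl, Finset.mem_singleton]
  have : r = t → r ≠ s := by rintro rfl; exact hst.symm
  tauto

/-- One of the faults is a pair of adjacent vertices of the only bad copy `s`. The spanning cycle of
`s` with this pair restored is broken into one or two paths when the pair is removed. -/
theorem OneBad.hamCycle_of_pair (h : OneBad F s) (hF' : F.Perm (i :: F')) (hi : i.verts = {a, b})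
    (hie : i.edges = ∅) (ha : copy a = s) (hb : copy b = s) (hab : (burntPancake (m + 1)).Adj a b)
    (hC : HamCycle (live F') (region F' {s})) : HamCycle (live F) (deleted F)ᶜ := by
  have hm : 0 < m := by have := h.le; omega
  have hd : deleted F = {a, b} ∪ deleted F' := by rw [deleted_perm hF', deleted_cons, hi]
  have hdis := (h.valid.perm hF').disjoint
  rw [hi, Set.disjoint_left] at hdis
  have hreg : region F {s} = (region F' {s} \ {a}) \ {b} := by
    ext v
    simp only [mem_region_singleton, hd, Set.mem_union, Set.mem_singleton_iff, Set.mem_sdiff,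
      Set.mem_insert_iff]
    tauto
  have haX : a ∈ region F' {s} := mem_region_singleton.2 ⟨ha, hdis (by simp)⟩
  have hbX : b ∈ region F' {s} \ {a} :=
    ⟨mem_region_singleton.2 ⟨hb, hdis (by simp)⟩, fun e => hab.ne e.symm⟩
  obtain ⟨g, k, hgk, hag, hak, hp⟩ := hC.delete_vertex haX
  rw [← live_eq_of_perm hF' hie] at hag hak hp
  have hag := live_adj_adj hag
  have hak := live_adj_adj hak
  have hin : ∀ {v}, v ∈ region F' {s} \ {a} → copy v = s := fun hv =>
    (mem_region_singleton.1 hv.1).1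
  have hgs := hin hp.left_mem
  have hks := hin hp.right_mem
  have htri : ∀ {v}, copy v = s → (burntPancake (m + 1)).Adj a v →
      ¬ (burntPancake (m + 1)).Adj v b := fun hv h1 h2 =>
    no_triangle hm h1 hab (hv.trans ha.symm) (hb.trans ha.symm) h2
  -- the two vertices of the pair are consecutive on the cycle
  have end_case : ∀ {g k}, HamPath (live F) (region F' {s} \ {a}) g k → g ≠ k → b = g →
      (burntPancake (m + 1)).Adj a k → copy k = s → HamCycle (live F) (deleted F)ᶜ := by
    rintro g k hp hgk rfl hak hks
    obtain ⟨w, X₁, X₂, e, hdX, h1, hw, h2⟩ := hp.split_after hp.left_mem hgk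
    rw [h1.eq_singleton] at hdX e
    have e' : region F {s} = X₂ := by
      rw [hreg, e, Set.union_sdiff_left, sdiff_eq_left]
      exact hdX.symm
    rw [← e'] at h2
    refine hamCycle_of_one_bad h.le h.valid h.length h.good h2 ?_ (h.of_mem h2.left_mem).1
      (h.of_mem h2.right_mem).1
    rintro rfl
    exact htri hks hak (live_adj_adj hw).symm
  by_cases hbg : b = g
  · exact end_case hp hgk hbg hak hks
  by_cases hbk : b = k
  · exact end_case hp.symm hgk.symm hbk hag hgs
  obtain ⟨u, v, X₁, X₂, e, hdX, h1, hu, hv, h2⟩ := hp.remove_vertex hbX hbg hbk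
  rw [← hreg] at e
  have hu := live_adj_adj hu
  have hv := live_adj_adj hv
  have hus := (mem_region_singleton.1 (e ▸ .inl h1.right_mem : u ∈ region F {s})).1
  have hvs := (mem_region_singleton.1 (e ▸ .inr h2.left_mem : v ∈ region F {s})).1
  refine h.hamCycle_of_two_paths h1 h2.symm e hdX ?_ ?_ ?_ ?_
  · rintro rfl
    exact htri hgs hag hu
  · rintro rfl
    exact htri hks hak hv.symm
  · exact cls_fst_ne_of_adj_adj hm hag hak (hgs.trans ha.symm) (hks.trans ha.symm) hgk
  · exact cls_ne_of_adj_adj hm hu.symm hv (hus.trans hb.symm) (hvs.trans hb.symm)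
      fun e => Set.disjoint_left.1 hdX h1.right_mem (e ▸ h2.left_mem)

/-- All faults hit the copy `s`, and the other copies are good. -/
theorem hamCycle_of_hits_one (hm : 3 ≤ m) (hF : Valid (burntPancake (m + 1)) F)
    (hl : F.length + 1 ≤ m) (hlen : F ≠ []) (hg : ∀ r, r ≠ s → Good F r) (hs : ∀ i ∈ F, Hits i s)
    (hC : ∀ i F', F.Perm (i :: F') → HamCycle (live F') (region F' {s})) :
    HamCycle (live F) (deleted F)ᶜ := by
  have hm0 : 0 < m := by omega
  have hexp : ∀ {v}, v ∈ region F {s} → v ∉ exposed F := fun hv =>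
    not_mem_exposed_of_hits hm0 hF.1 hs (mem_region_singleton.1 hv).2 (mem_region_singleton.1 hv).1
  -- a fault that is not a pair inside `s` is preferred, since restoring it leads to a single path
  by_cases hpair : ∀ i ∈ F, ∃ a b, i.verts = {a, b} ∧ i.edges = ∅ ∧ copy a = s ∧ copy b = s ∧
      (burntPancake (m + 1)).Adj a b
  · obtain ⟨i, hi⟩ := List.exists_mem_of_ne_nil F hlen
    obtain ⟨F', hF'⟩ := exists_perm_cons hi
    have hT : OneBad F s := ⟨hm, hF, hl, fun v hv hvs =>
      not_mem_exposed_of_not_hits (fun i hi => ⟨s, hs i hi⟩) hv (fun i hi hh => by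
        obtain ⟨a, b, hv, he, ha, hb, -⟩ := hpair i hi
        rcases hh with ⟨w, hw, hwc⟩ | ⟨w, w', hw, -⟩
        · rw [hv] at hw
          rcases hw with rfl | hw
          · exact hvs (hwc.symm.trans ha)
          · rw [Set.mem_singleton_iff.1 hw] at hwc
            exact hvs (hwc.symm.trans hb)
        · rw [he] at hw
          exact hw) hm0, hg⟩
    obtain ⟨a, b, hv, he, ha, hb, hab⟩ := hpair i hi
    exact hT.hamCycle_of_pair hF' hv he ha hb hab (hC i F' hF')
  · push Not at hpair
    obtain ⟨i, hi, hpair⟩ := hpair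
    obtain ⟨F', hF'⟩ := exists_perm_cons hi
    rcases (hs i hi).cases (hF.1 i hi) with ⟨f, hf, he, hv⟩ | ⟨hv, a, b, he⟩ |
      ⟨a, b, hv, he, ha, hb, hab⟩
    · obtain ⟨g, k, hp, -, -, hgX, hkX, hgk, -⟩ :=
        exists_path_of_restored hm0 hF hF' hf hv he (hC i F' hF')
      exact hamCycle_of_one_bad hm hF hl hg hp (fun e => hgk (by rw [e])) (hexp hgX) (hexp hkX)
    · have hreg : region F {s} = region F' {s} := by
        ext v
        simp [region, deleted_perm hF', deleted_cons, hv]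
      obtain ⟨g, k, hp, hgk⟩ := (hC i F' hF').delete_edge (A' := live F) s(a, b) (by
        intro u v huv
        rw [live_adj] at huv ⊢
        rw [cut_perm hF', cut_cons, he]
        simp only [Set.mem_union, Set.mem_singleton_iff]
        tauto)
      rw [← hreg] at hp
      exact hamCycle_of_one_bad hm hF hl hg hp hgk.ne (hexp hp.left_mem) (hexp hp.right_mem)
    · exact absurd hab (hpair a b hv he ha hb)

/-- All faults are pairs of mates in the copies `s` and `t`. When one pair is restored, both copies
have spanning cycles; removing it again leaves two paths, whose four ends have their mates in
distinct copies. -/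
theorem hamCycle_of_hits_both (hm : 3 ≤ m) (hF : Valid (burntPancake (m + 1)) F)
    (hl : F.length + 1 ≤ m) (hlen : F ≠ []) (hst : s ≠ t) (hg : ∀ r, r ≠ s → r ≠ t → Good F r)
    (hs : ∀ i ∈ F, Hits i s) (ht : ∀ i ∈ F, Hits i t)
    (hCs : ∀ i F', F.Perm (i :: F') → HamCycle (live F') (region F' {s}))
    (hCt : ∀ i F', F.Perm (i :: F') → HamCycle (live F') (region F' {t})) :
    HamCycle (live F) (deleted F)ᶜ := by
  have hm0 : 0 < m := by omega
  have hexp : ∀ {v r}, v ∈ region F {r} → v ∉ exposed F := fun hv =>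
    not_mem_exposed_of_mates (fun i hi => by
      obtain ⟨f, -, -, h⟩ := (hs i hi).exists_mate (hF.1 i hi) (ht i hi) hst
      exact ⟨f, h⟩) (mem_region_singleton.1 hv).2
  obtain ⟨i, hi⟩ := List.exists_mem_of_ne_nil F hlen
  obtain ⟨F', hF'⟩ := exists_perm_cons hi
  obtain ⟨f, hfs, hft, hv, he⟩ := (hs i hi).exists_mate (hF.1 i hi) (ht i hi) hst
  obtain ⟨g, k, hp, hfg, hfk, hgX, hkX, hgk, hgf, hkf⟩ := exists_path_of_restored hm0 hF hF' hfs
    (fun v hvs => by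
      rw [hv]
      simp only [Set.mem_insert_iff, Set.mem_singleton_iff, or_iff_left_iff_imp]
      rintro rfl
      exact absurd (hvs.symm.trans hft) hst) he (hCs i F' hF')
  obtain ⟨g', k', hp', hfg', hfk', hgX', hkX', hgk', hgf', hkf'⟩ :=
    exists_path_of_restored (f := mate f) hm0 hF hF' hft (fun v hvt => by
      rw [hv]
      simp only [Set.mem_insert_iff, Set.mem_singleton_iff, or_iff_right_iff_imp]
      rintro rfl
      exact absurd (hfs.symm.trans hvt) hst) he (hCt i F' hF')
  have hgs := (mem_region_singleton.1 hgX).1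
  have hks := (mem_region_singleton.1 hkX).1
  have hgt := (mem_region_singleton.1 hgX').1
  have hkt := (mem_region_singleton.1 hkX').1
  rw [hft] at hgf hkf
  rw [cls_mate, hfs] at hgf' hkf'
  have hne : ∀ {v w}, (burntPancake (m + 1)).Adj f v → copy v = s →
      (burntPancake (m + 1)).Adj (mate f) w → copy w = t → cls v ≠ cls w := fun h1 h2 h3 h4 =>
    cls_ne_cls_across hm0 h1 (h2.trans hfs.symm) h3 (h4.trans hft.symm)
  have hcard := card_add_card_compl ({s, t} : Finset (SignedSymbol (m + 1)))
  rw [Finset.card_pair hst] at hcard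
  exact hamCycle_of_ne (S := {s, t}) hm hF hl (fun r hr => by
      simp at hr
      exact hg r (by tauto) (by tauto)) (by omega) hp hp'
    (by rw [Finset.insert_eq, ← region_union]) (region_disjoint (by simpa using hst)) (hexp hgX)
    (hexp hkX) (hexp hgX') (hexp hkX')
    (by simp [hgf, ← hgs, cls_ne_copy hm0 g]) (by simp [hkf, ← hks, cls_ne_copy hm0 k])
    (by simp [hgf', ← hgt, cls_ne_copy hm0 g']) (by simp [hkf', ← hkt, cls_ne_copy hm0 k'])
    hgk (hne hfg hgs hfg' hgt) (hne hfg hgs hfk' hkt) (hne hfk hks hfg' hgt) (hne hfk hks hfk' hkt)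
    hgk'

end MostlyHit

/-! ### Spanning cycles with three or four bad copies -/

section SeveralBad

variable {m : ℕ} {F : List (Fault (SignedPermutation (m + 1)))}
  {i j : Fault (SignedPermutation (m + 1))} {s t r q : SignedSymbol (m + 1)}
  {T : Finset (SignedSymbol (m + 1))}

/-- Three bad copies with spanning cycles, and all faults are pairs of mates. The cycles of `s` and
`t` are joined to a path along an edge between mates, and the copy `r` is inserted into the path
that closes it. -/
theorem hamCycle_of_three_bad (hm : 4 ≤ m) (hF : Valid (burntPancake (m + 1)) F)
    (hl : F.length + 1 ≤ m) (hg : ∀ c, c ≠ s → c ≠ t → c ≠ r → Good F c) (hst : s.1 ≠ t.1)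
    (hsr : s ≠ r) (htr : t ≠ r) (he : ∀ v, v ∉ deleted F → v ∉ exposed F)
    (hs : HamCycle (live F) (region F {s})) (ht : HamCycle (live F) (region F {t}))
    (hr : HamCycle (live F) (region F {r})) : HamCycle (live F) (deleted F)ᶜ := by
  have hm0 : 0 < m := by omega
  have hne : s ≠ t := fun e => hst (by rw [e])
  obtain ⟨w, hws, hwt, hwe, -⟩ := exists_link hm0 hF hst ∅ (by
    have := length_add_lt (by omega) hl
    rw [Set.ncard_empty]
    omega)
  obtain ⟨u, hu, hwu, -, hus, huF, huw, hur⟩ := hs.exists_exit hm0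
    (mem_region_singleton.2 ⟨hws, not_mem_deleted hwe⟩) r
  obtain ⟨v, hv, hwv, -, hvt, hvF, hvw, hvr⟩ := ht.exists_exit hm0
    (mem_region_singleton.2 ⟨(copy_mate w).trans hwt, mate_not_mem_deleted hwe⟩) r
  rw [hwt] at huw
  rw [cls_mate, hws] at hvw
  have hus' : cls u ≠ s := hus ▸ cls_ne_copy hm0 u
  have hvt' : cls v ≠ t := hvt ▸ cls_ne_copy hm0 v
  have h1 := hamPath_insert (T := {s, t, r}ᶜ) (t := r) (x := mate u) (y := mate v) (by omega) hF hl
    (fun c hc => by simp at hc; exact hg c (by tauto) (by tauto) (by tauto)) (by simp) hr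
    (.inr ⟨by rw [compl_compl]; exact Finset.card_le_three, hm⟩)
    ⟨by simp [copy_mate, hus', huw, hur], mate_not_mem_deleted (he u huF)⟩
    ⟨by simp [copy_mate, hvt', hvw, hvr], mate_not_mem_deleted (he v hvF)⟩
    (cls_ne_cls_across hm0 hwu (hus.trans hws.symm) hwv (hvt.trans ((copy_mate w).trans hwt).symm))
  have h2 := hu.symm.link hwe hv (by simpa using hne)
  refine h2.hamCycle (by omega) hl (he u huF) (he v hvF) (h1.congr ?_)
  congr 1
  ext c
  simp only [Finset.mem_insert, Finset.mem_compl, Finset.mem_singleton, Finset.mem_union]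
  have : c = r → c ≠ s ∧ c ≠ t := by rintro rfl; exact ⟨hsr.symm, htr.symm⟩
  tauto

/-- In dimension four, a spanning path of one bad copy is closed by a path through the five good
copies into which two bridges are inserted. -/
theorem hamCycle_of_path_and_bridges {a b : SignedPermutation (m + 1)} (hm : m = 3)
    (hF : Valid (burntPancake (m + 1)) F)
    (hl : F.length + 1 ≤ m) (hg : ∀ c, c ≠ r → c ≠ s → c ≠ t → Good F c) (hst : s ≠ t)
    (hrs : r ≠ s) (hrt : r ≠ t) (hs : IsBridge F {r, s, t}ᶜ s) (ht : IsBridge F {r, s, t}ᶜ t)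
    (h : HamPath (live F) (region F {r}) a b) (ha : a ∉ exposed F) (hb : b ∉ exposed F)
    (hab : cls a ≠ cls b) (has : cls a ≠ s) (hat : cls a ≠ t) (hbs : cls b ≠ s) (hbt : cls b ≠ t) :
    HamCycle (live F) (deleted F)ᶜ := by
  have hm0 : 0 < m := by omega
  have hca := (mem_region_singleton.1 h.left_mem).1
  have hcb := (mem_region_singleton.1 h.right_mem).1
  have har : cls a ≠ r := hca ▸ cls_ne_copy hm0 a
  have hbr : cls b ≠ r := hcb ▸ cls_ne_copy hm0 b
  have hcard : ({r, s, t}ᶜ : Finset (SignedSymbol (m + 1))).card = 5 := by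
    have h1 := card_add_card_compl ({r, s, t} : Finset (SignedSymbol (m + 1)))
    rw [Finset.card_eq_three.2 ⟨r, s, t, hrs, hrt, hst, rfl⟩] at h1
    omega
  have h1 := hamPath_two_bridges (T := {r, s, t}ᶜ) (x := mate a) (y := mate b) (by omega) hF hl
    (fun c hc => by simp at hc; exact hg c (by tauto) (by tauto) (by tauto)) hcard hs ht hst
    (by simp) (by simp)
    ⟨by simp [copy_mate, har, has, hat], mate_not_mem_deleted ha⟩
    ⟨by simp [copy_mate, hbr, hbs, hbt], mate_not_mem_deleted hb⟩ hab
    (by rwa [cls_mate, hca]) (by rwa [cls_mate, hca])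
  refine h.hamCycle (by omega) hl ha hb (h1.congr ?_)
  congr 1
  ext c
  simp only [Finset.mem_insert, Finset.mem_compl, Finset.mem_singleton]
  have h2 : c = s → c ≠ r := by rintro rfl; exact hrs.symm
  have h3 : c = t → c ≠ r := by rintro rfl; exact hrt.symm
  tauto

/-- In dimension four, a spanning cycle in which four bridges alternate with four good copies. -/
theorem hamCycle_of_alternating {g₁ g₂ g₃ g₄ b₁ b₂ b₃ b₄ : SignedSymbol (m + 1)} (hm : m = 3)
    (hl : F.length + 1 ≤ m)
    (hnd : [g₁, g₂, g₃, g₄, b₁, b₂, b₃, b₄].Nodup)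
    (hg : ∀ c, c ≠ b₁ → c ≠ b₂ → c ≠ b₃ → c ≠ b₄ → c ∈ T ∧ Good F c)
    (hb₁ : IsBridge F T b₁) (hb₂ : IsBridge F T b₂) (hb₃ : IsBridge F T b₃) (hb₄ : IsBridge F T b₄)
    (hgg : g₂ ≠ g₁.bar ∧ g₃ ≠ g₂.bar ∧ g₄ ≠ g₃.bar ∧ g₁ ≠ g₄.bar)
    (h₁ : g₁ ≠ b₁.bar ∧ g₂ ≠ b₁.bar) (h₂ : g₂ ≠ b₂.bar ∧ g₃ ≠ b₂.bar)
    (h₃ : g₃ ≠ b₃.bar ∧ g₄ ≠ b₃.bar) (h₄ : g₄ ≠ b₄.bar ∧ g₁ ≠ b₄.bar) :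
    HamCycle (live F) (deleted F)ᶜ := by
  have hfst : ∀ {p q : SignedSymbol (m + 1)}, p ≠ q → p ≠ q.bar → p.1 ≠ q.1 := fun h1 h2 e =>
    (fst_eq_iff.1 e).elim h1 h2
  have huniv := Finset.eq_univ_of_card [g₁, g₂, g₃, g₄, b₁, b₂, b₃, b₄].toFinset (by
    rw [List.toFinset_card_of_nodup hnd, card_symbols]
    simp only [List.length_cons, List.length_nil]
    omega)
  have hall : ∀ c, c = g₁ ∨ c = g₂ ∨ c = g₃ ∨ c = g₄ ∨ c = b₁ ∨ c = b₂ ∨ c = b₃ ∨ c = b₄ :=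
    fun c => by
      have := Finset.mem_univ c
      rw [← huniv] at this
      simpa using this
  simp only [List.nodup_cons, List.mem_cons, List.not_mem_nil, or_false, not_or] at hnd
  obtain ⟨⟨n12, n13, n14, n15, n16, n17, n18⟩, ⟨n23, n24, n25, n26, n27, n28⟩,
    ⟨n34, n35, n36, n37, n38⟩, ⟨n45, n46, n47, n48⟩, ⟨n56, n57, n58⟩, ⟨n67, n68⟩, n78, -⟩ := hnd
  have G1 := hg g₁ n15 n16 n17 n18
  have G2 := hg g₂ n25 n26 n27 n28
  have G3 := hg g₃ n35 n36 n37 n38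
  have G4 := hg g₄ n45 n46 n47 n48
  -- `b₄` closes the cycle; the rest of it is built backwards from `g₄`
  obtain ⟨k, h, hp, hk, hh, hke, hhe⟩ := hb₄ g₁ G1.1 g₄ G4.1 (hfst n18 h₄.2) (hfst n48 h₄.1)
    (hfst n14 hgg.2.2.2)
  have hck := (mem_region_singleton.1 hp.left_mem).1
  have hch := (mem_region_singleton.1 hp.right_mem).1
  have r0 : Reach F ∅ {g₄} g₄ (mate h) := .single G4.2 hh (mate_not_mem_deleted hhe)
  have r1 := r0.bridge (p := g₃) hb₃ G3.1 G4.1 (by simp) (by simp [Ne.symm n47]) (hfst n37 h₃.1)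
    (hfst n47 h₃.2) (fun _ => by rw [cls_mate, hch]; exact Ne.symm n78) (by simp [n34])
    (hfst (Ne.symm n34) hgg.2.2.1).symm G3.2
  have r2 := r1.bridge (p := g₂) hb₂ G2.1 G3.1 (by simp [n67])
    (by simp [n67, Ne.symm n46, Ne.symm n36]) (hfst n26 h₂.1) (hfst n36 h₂.2)
    (fun e => absurd (e.symm.trans hh) n34)
    (by simp [n23, n24, n27]) (hfst (Ne.symm n23) hgg.2.1).symm G2.2
  have r3 := r2.bridge (p := g₁) hb₁ G1.1 G2.1 (by simp [n56])
    (by simp [n56, n57, Ne.symm n25, Ne.symm n35, Ne.symm n45]) (hfst n15 h₁.1) (hfst n25 h₁.2)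
    (fun e => absurd (e.symm.trans hh) n24)
    (by simp [n12, n13, n14, n16, n17]) (hfst (Ne.symm n12) hgg.1).symm G1.2
  have n81 := Ne.symm n18
  have n82 := Ne.symm n28
  have n83 := Ne.symm n38
  have n84 := Ne.symm n48
  have n85 := Ne.symm n58
  have n86 := Ne.symm n68
  have n87 := Ne.symm n78
  have h1 := r3 (mate k) hk (mate_not_mem_deleted hke)
    (fun e => n14 (hk.symm.trans ((congrArg copy e).trans hh))) (by
      rw [cls_mate, hck]
      simpa using Ne.symm n58)
  refine hp.hamCycle (by omega) hl hke hhe (h1.congr ?_)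
  congr 1
  ext c
  simp only [Finset.mem_insert, Finset.mem_compl, Finset.mem_singleton]
  rcases hall c with rfl | rfl | rfl | rfl | rfl | rfl | rfl | rfl <;> simp [*]

/-- There are eight copies in dimension four. -/
theorem exists_not_mem (hm : m = 3) (U : Finset (SignedSymbol (m + 1))) (hU : U.card ≤ 7) :
    ∃ c, c ∉ U := by
  obtain ⟨c, hc⟩ : (Uᶜ).Nonempty := by
    rw [← Finset.card_pos]
    have := card_add_card_compl U
    omega
  exact ⟨c, Finset.mem_compl.1 hc⟩

/-- In dimension four, all copies are good or bridges, and there are four bridges. They are placed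
between the four good copies so that no bridge and no good copy is next to its bar. -/
theorem hamCycle_of_four_bridges (hm : m = 3)
    (hl : F.length + 1 ≤ m) (hnd : [s, t, r, q].Nodup)
    (hg : ∀ c, c ≠ s → c ≠ t → c ≠ r → c ≠ q → c ∈ T ∧ Good F c)
    (hs : IsBridge F T s) (ht : IsBridge F T t) (hr : IsBridge F T r) (hq : IsBridge F T q) :
    HamCycle (live F) (deleted F)ᶜ := by
  -- the case of two bridges that belong to a symbol and its bar
  have key : ∀ {s r q : SignedSymbol (m + 1)}, [s, s.bar, r, q].Nodup →
      (∀ c, c ≠ s → c ≠ s.bar → c ≠ r → c ≠ q → c ∈ T ∧ Good F c) →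
      IsBridge F T s → IsBridge F T s.bar → IsBridge F T r → IsBridge F T q →
      HamCycle (live F) (deleted F)ᶜ := by
    intro s r q hnd hg hs ht hr hq
    have i1 := bar_bar s
    have i2 := bar_bar r
    have i3 := bar_bar q
    have j1 := bar_ne s
    have j2 := bar_ne r
    have j3 := bar_ne q
    simp only [List.nodup_cons, List.mem_cons, List.not_mem_nil, or_false, not_or,
      List.nodup_nil, and_true, not_false_eq_true] at hnd
    by_cases hrq : q = r.bar
    -- then the good copies also form two pairs of bars, which alternate on the cycle
    · obtain ⟨u, hu⟩ := exists_not_mem hm {s, s.bar, r, q} (Finset.card_le_four.trans (by norm_num))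
      obtain ⟨v, hv⟩ := exists_not_mem hm {s, s.bar, r, q, u, u.bar}
        (Finset.card_le_six.trans (by norm_num))
      simp only [Finset.mem_insert, Finset.mem_singleton, not_or] at hu hv
      have i4 := bar_bar u
      have i5 := bar_bar v
      have j4 := bar_ne u
      have j5 := bar_ne v
      refine hamCycle_of_alternating (g₁ := u) (g₂ := v) (g₃ := u.bar) (g₄ := v.bar) (b₁ := s)
        (b₂ := s.bar) (b₃ := r) (b₄ := q) hm hl ?_ hg hs ht hr hq ?_ ?_ ?_ ?_ ?_
      · simp only [List.nodup_cons, List.mem_cons, List.not_mem_nil, or_false, not_or,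
          List.nodup_nil, and_true, not_false_eq_true]
        clear hg hs ht hr hq
        constructorm* _ ∧ _ <;> grind
      all_goals
        clear hg hs ht hr hq
        grind
    -- otherwise they are the bars of `r` and `q` and a further pair of bars
    · obtain ⟨u, hu⟩ := exists_not_mem hm {s, s.bar, r, q, r.bar, q.bar}
        (Finset.card_le_six.trans (by norm_num))
      simp only [Finset.mem_insert, Finset.mem_singleton, not_or] at hu
      have i4 := bar_bar u
      have j4 := bar_ne u
      refine hamCycle_of_alternating (g₁ := r.bar) (g₂ := u) (g₃ := q.bar) (g₄ := u.bar) (b₁ := q)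
        (b₂ := r) (b₃ := s) (b₄ := s.bar) hm hl ?_ (fun c h1 h2 h3 h4 => hg c h3 h4 h2 h1) hq hr
        hs ht ?_ ?_ ?_ ?_ ?_
      · simp only [List.nodup_cons, List.mem_cons, List.not_mem_nil, or_false, not_or,
          List.nodup_nil, and_true, not_false_eq_true]
        clear hg hs ht hr hq
        constructorm* _ ∧ _ <;> grind
      all_goals
        clear hg hs ht hr hq
        grind
  simp only [List.nodup_cons, List.mem_cons, List.not_mem_nil, or_false, not_or,
    List.nodup_nil, and_true, not_false_eq_true] at hnd
  obtain ⟨⟨hst, hsr, hsq⟩, ⟨htr, htq⟩, hrq⟩ := hnd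
  by_cases h1 : t = s.bar
  · subst h1
    exact key (by simp [*]) hg hs ht hr hq
  by_cases h2 : r = s.bar
  · subst h2
    exact key (q := q) (r := t) (by simp [*, Ne.symm htr]) (fun c a b d e => hg c a d b e)
      hs hr ht hq
  by_cases h3 : q = s.bar
  · subst h3
    exact key (q := r) (r := t) (by simp [*, Ne.symm htq, Ne.symm hrq])
      (fun c a b d e => hg c a d e b) hs hq ht hr
  by_cases h4 : r = t.bar
  · subst h4
    exact key (q := q) (r := s) (by simp [*, Ne.symm hst, Ne.symm hsr])
      (fun c a b d e => hg c d a b e) ht hr hs hq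
  by_cases h5 : q = t.bar
  · subst h5
    exact key (q := r) (r := s) (by simp [*, Ne.symm hst, Ne.symm hsq, Ne.symm hrq])
      (fun c a b d e => hg c d a e b) ht hq hs hr
  by_cases h6 : q = r.bar
  · subst h6
    exact key (q := t) (r := s) (by simp [*, Ne.symm hsr, Ne.symm hsq, Ne.symm htr, Ne.symm htq])
      (fun c a b d e => hg c d e a b) hr hq hs ht
  have i1 := bar_bar s
  have i2 := bar_bar t
  have i3 := bar_bar r
  have i4 := bar_bar q
  have j1 := bar_ne s
  have j2 := bar_ne t
  have j3 := bar_ne r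
  have j4 := bar_ne q
  -- no two bridges are bars of each other, so that the good copies are the bars of the bridges
  refine hamCycle_of_alternating (g₁ := s.bar) (g₂ := t.bar) (g₃ := r.bar) (g₄ := q.bar) (b₁ := r)
    (b₂ := q) (b₃ := s) (b₄ := t) hm hl ?_ (fun c h1 h2 h3 h4 => hg c h3 h4 h1 h2) hr hq hs
    ht ?_ ?_ ?_ ?_ ?_
  · simp only [List.nodup_cons, List.mem_cons, List.not_mem_nil, or_false, not_or,
      List.nodup_nil, and_true, not_false_eq_true]
    clear hg hs ht hr hq key
    constructorm* _ ∧ _ <;> grind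
  all_goals
    clear hg hs ht hr hq key
    grind

end SeveralBad

/-! ### The inductive step for spanning cycles -/

section CycleStep

variable {m : ℕ} {F : List (Fault (SignedPermutation (m + 1)))}
  {s t r q : SignedSymbol (m + 1)}

theorem good_of_hitCount_eq_zero (hm : 3 ≤ m) (hP : PathTolerant m)
    (hF : Valid (burntPancake (m + 1)) F) (h : ∀ i ∈ F, ¬ Hits i s) : Good F s :=
  hP.good (by omega) hF (by rw [hitCount_eq_zero.2 h]; omega)

/-- In dimension four, one copy is hit by both faults and two others by one fault each. Both faults
are then pairs of mates, and the two other copies are bridges. -/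
theorem hamCycle_of_two_pairs (hm : m = 3) (hP : PathTolerant m)
    (hF : Valid (burntPancake (m + 1)) F) (hl : F.length = 2) (hs : ∀ i ∈ F, Hits i s)
    (hts : t ≠ s) (hrs : r ≠ s) (htr : t ≠ r) (ht : 0 < hitCount F t) (hr : 0 < hitCount F r) :
    HamCycle (live F) (deleted F)ᶜ := by
  subst hm
  obtain ⟨x, hx, hxt⟩ := exists_hits ht
  obtain ⟨y, hy, hyr⟩ := exists_hits hr
  have hxr := Hits.not_three (hF.1 x hx) (hs x hx) hxt hts.symm hrs htr.symm
  have hyt := Hits.not_three (hF.1 y hy) (hs y hy) hyr hrs.symm hts htr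
  have hxy : x ≠ y := fun e => hxr (e ▸ hyr)
  have hall : ∀ i ∈ F, i = x ∨ i = y := by
    obtain ⟨u, v, rfl⟩ := List.length_eq_two.1 hl
    simp only [List.mem_cons, List.not_mem_nil, or_false] at hx hy ⊢
    rintro i hi
    clear hF hs ht hr
    grind
  obtain ⟨f, hfs, hft, hfv, hfe⟩ := (hs x hx).exists_mate (hF.1 x hx) hxt hts.symm
  obtain ⟨f', hfs', hft', hfv', hfe'⟩ := (hs y hy).exists_mate (hF.1 y hy) hyr hrs.symm
  have hexp : ∀ v, v ∉ deleted F → v ∉ exposed F := fun v =>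
    not_mem_exposed_of_mates fun i hi => (hall i hi).elim
      (fun e => ⟨f, by rw [e]; exact hfv, by rw [e]; exact hfe⟩)
      (fun e => ⟨f', by rw [e]; exact hfv', by rw [e]; exact hfe'⟩)
  have hdel : ∀ v, v ∈ deleted F ↔ v ∈ x.verts ∨ v ∈ y.verts := fun v =>
    ⟨fun ⟨i, hi, hv⟩ => (hall i hi).imp (fun e : i = x => e ▸ hv) (fun e : i = y => e ▸ hv),
      fun h => h.elim (fun h => ⟨x, hx, h⟩) fun h => ⟨y, hy, h⟩⟩
  have hcut : ∀ e, e ∉ cut F := by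
    rintro e ⟨i, hi, he⟩
    rcases hall i hi with rfl | rfl
    · rw [hfe] at he
      exact he
    · rw [hfe'] at he
      exact he
  obtain ⟨g, h, hp, hgh, hgt, hgr, hht, hhr⟩ := exists_path_two_missing (F := F) hfs hfs'
    (by rw [hft, hft']; exact htr) (fun v hv => by
      have h1 : v ≠ mate f := by
        rintro rfl
        rw [copy_mate, hft] at hv
        exact hts hv
      have h2 : v ≠ mate f' := by
        rintro rfl
        rw [copy_mate, hft'] at hv
        exact hrs hv
      simp [hdel, hfv, hfv', h1, h2]) (fun u v _ _ => hcut _)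
  have hg := (mem_region_singleton.1 hp.left_mem).2
  have hh := (mem_region_singleton.1 hp.right_mem).2
  rw [hft] at hgt hht
  rw [hft'] at hgr hhr
  refine hamCycle_of_path_and_bridges (r := s) (s := t) (t := r) rfl hF (by omega)
    (fun c hcs hct hcr => good_of_hitCount_eq_zero le_rfl hP hF fun i hi => ?_)
    htr hts.symm hrs.symm
    (isBridge_of_pair (f := mate f) (fun j hj hjt => (hall j hj).resolve_right ?_) hx ?_ hfe hft
      fun v _ hv _ => hexp v hv)
    (isBridge_of_pair (f := mate f') (fun j hj hjr => (hall j hj).resolve_left ?_) hy ?_ hfe' hft'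
      fun v _ hv _ => hexp v hv)
    hp (hexp g hg) (hexp h hh) hgh hgt hgr hht hhr
  · rcases hall i hi with rfl | rfl
    · exact Hits.not_three (hF.1 i hi) (hs i hi) hxt hts.symm hcs hct
    · exact Hits.not_three (hF.1 i hi) (hs i hi) hyr hrs.symm hcs hcr
  · rintro rfl
    exact hyt hjt
  · rw [hfv, mate_mate, Set.pair_comm]
  · rintro rfl
    exact hxr hjr
  · rw [hfv', mate_mate, Set.pair_comm]

/-- In dimension four, three bad copies, two of which are hit by the same fault. These two are
bridges, and the third has a spanning cycle, which is opened at a suitable edge. -/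
theorem hamCycle_of_shared_fault {i : Fault (SignedPermutation (m + 1))} (hm : m = 3)
    (hP : PathTolerant m) (hF : Valid (burntPancake (m + 1)) F) (hl : F.length = 2)
    (hst : s ≠ t) (hsr : s ≠ r) (htr : t ≠ r) (hi : i ∈ F) (his : Hits i s) (hit : Hits i t)
    (hs : hitCount F s ≤ 1) (ht : hitCount F t ≤ 1) (hr : 0 < hitCount F r)
    (hC : HamCycle (live F) (region F {r}))
    (hc : ∀ c, c ≠ s → c ≠ t → c ≠ r → hitCount F c = 0) : HamCycle (live F) (deleted F)ᶜ := by
  subst hm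
  obtain ⟨j, hj, hjr⟩ := exists_hits hr
  have hir := Hits.not_three (hF.1 i hi) his hit hst hsr.symm htr.symm
  have hij : i ≠ j := fun e => hir (e ▸ hjr)
  have hall : ∀ k ∈ F, ∃ c, Hits k c := by
    obtain ⟨u, v, rfl⟩ := List.length_eq_two.1 hl
    simp only [List.mem_cons, List.not_mem_nil, or_false] at hi hj ⊢
    rintro k (rfl | rfl) <;> rcases hi with rfl | rfl <;> rcases hj with rfl | rfl <;>
      first | exact ⟨_, his⟩ | exact ⟨_, hjr⟩ | exact absurd rfl hij
  have hexp : ∀ v, v ∉ deleted F → cls v ∈ ({r, s, t}ᶜ : Finset (SignedSymbol 4)) →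
      v ∉ exposed F := by
    intro v hv hvc
    simp only [Finset.mem_compl, Finset.mem_insert, Finset.mem_singleton, not_or] at hvc
    exact not_mem_exposed_of_not_hits hall hv
      (hitCount_eq_zero.1 (hc _ hvc.2.1 hvc.2.2 hvc.1)) (by norm_num)
  obtain ⟨f, hfs, hft, hfv, hfe⟩ := his.exists_mate (hF.1 i hi) hit hst
  have hbs : IsBridge F {r, s, t}ᶜ s :=
    isBridge_of_pair (fun k hk hks => eq_of_hitCount_le_one hs hi his hk hks) hi hfv hfe hfs
      fun v _ hv => hexp v hv
  have hbt : IsBridge F {r, s, t}ᶜ t :=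
    isBridge_of_pair (f := mate f) (fun k hk hkt => eq_of_hitCount_le_one ht hi hit hk hkt) hi
      (by rw [hfv, mate_mate, Set.pair_comm]) hfe hft fun v _ hv => hexp v hv
  obtain ⟨a, b, hab, ha, hb, hae, hbe, has, hbs', hne, -, -⟩ := hC.exists_cut_link (by norm_num)
    {s, t} f (four_mul_lt le_rfl (by omega) (.inl Finset.card_le_two))
  simp only [Finset.mem_insert, Finset.mem_singleton, not_or] at has hbs'
  exact hamCycle_of_path_and_bridges rfl hF (by omega)
    (fun c h1 h2 h3 => good_of_hitCount_eq_zero le_rfl hP hF (hitCount_eq_zero.1 (hc c h2 h3 h1)))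
    hst hsr.symm htr.symm hbs hbt hab hae hbe hne has.1 has.2 hbs'.1 hbs'.2

/-- In dimension four, three bad copies that are hit once each. -/
theorem hamCycle_of_three_bad_four (hm : m = 3)
    (hP : PathTolerant m) (hF : Valid (burntPancake (m + 1)) F) (hl : F.length = 2)
    (hst : s ≠ t) (hsr : s ≠ r) (htr : t ≠ r) (hs : hitCount F s = 1) (ht : hitCount F t = 1)
    (hr : hitCount F r = 1) (hC : ∀ c, HamCycle (live F) (region F {c}))
    (hc : ∀ c, c ≠ s → c ≠ t → c ≠ r → hitCount F c = 0) : HamCycle (live F) (deleted F)ᶜ := by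
  obtain ⟨i, hi, his⟩ := exists_hits (hs ▸ one_pos)
  obtain ⟨j, hj, hjt⟩ := exists_hits (ht ▸ one_pos)
  obtain ⟨k, hk, hkr⟩ := exists_hits (hr ▸ one_pos)
  have : i = j ∨ i = k ∨ j = k := by
    obtain ⟨u, v, rfl⟩ := List.length_eq_two.1 hl
    simp only [List.mem_cons, List.not_mem_nil, or_false] at hi hj hk
    rcases hi with rfl | rfl <;> rcases hj with rfl | rfl <;> rcases hk with rfl | rfl <;> simp
  rcases this with rfl | rfl | rfl
  · exact hamCycle_of_shared_fault hm hP hF hl hst hsr htr hi his hjt hs.le ht.le (hr ▸ one_pos)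
      (hC r) hc
  · exact hamCycle_of_shared_fault hm hP hF hl hsr hst htr.symm hi his hkr hs.le hr.le
      (ht ▸ one_pos) (hC t) fun c h1 h2 h3 => hc c h1 h3 h2
  · exact hamCycle_of_shared_fault hm hP hF hl htr hst.symm hsr.symm hj hjt hkr ht.le hr.le
      (hs ▸ one_pos) (hC s) fun c h1 h2 h3 => hc c h3 h1 h2

/-- In dimension four, four bad copies that are hit once each. Both faults are then pairs of mates,
and all four copies are bridges. -/
theorem hamCycle_of_four_bad (hm : m = 3) (hP : PathTolerant m)
    (hF : Valid (burntPancake (m + 1)) F) (hl : F.length = 2) (hnd : [s, t, r, q].Nodup)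
    (h1 : ∀ c ∈ ({s, t, r, q} : Finset (SignedSymbol (m + 1))), hitCount F c = 1)
    (h0 : ∀ c, c ∉ ({s, t, r, q} : Finset (SignedSymbol (m + 1))) → hitCount F c = 0) :
    HamCycle (live F) (deleted F)ᶜ := by
  subst hm
  have hcard : ({s, t, r, q} : Finset (SignedSymbol (3 + 1))).card = 4 := by
    have := List.toFinset_card_of_nodup hnd
    simpa using this
  have htwo : ∀ i ∈ F, ∃ c ∈ ({s, t, r, q} : Finset (SignedSymbol (3 + 1))),
      ∃ c' ∈ ({s, t, r, q} : Finset (SignedSymbol (3 + 1))), c ≠ c' ∧ Hits i c ∧ Hits i c' :=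
    fun i hi => exists_two_hits hF.1 hi (by rw [Finset.sum_congr rfl h1]; simp [hcard, hl])
  have hexp : ∀ v, v ∉ deleted F → v ∉ exposed F := fun v =>
    not_mem_exposed_of_mates fun i hi => by
      obtain ⟨c, -, c', -, hne, hc, hc'⟩ := htwo i hi
      obtain ⟨f, -, -, h⟩ := hc.exists_mate (hF.1 i hi) hc' hne
      exact ⟨f, h⟩
  have hbr : ∀ c ∈ ({s, t, r, q} : Finset (SignedSymbol (3 + 1))),
      IsBridge F ({s, t, r, q} : Finset (SignedSymbol (3 + 1)))ᶜ c := by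
    intro c hc
    obtain ⟨i, hi, hic⟩ := exists_hits (h1 c hc ▸ one_pos)
    obtain ⟨d, -, d', -, hne, hd, hd'⟩ := htwo i hi
    obtain ⟨e, hec, hie⟩ : ∃ e, c ≠ e ∧ Hits i e := by
      by_cases h : c = d
      · exact ⟨d', h ▸ hne, hd'⟩
      · exact ⟨d, h, hd⟩
    obtain ⟨f, hfc, -, hfv, hfe⟩ := hic.exists_mate (hF.1 i hi) hie hec
    exact isBridge_of_pair (fun j hj hjc => eq_of_hitCount_le_one (h1 c hc).le hi hic hj hjc) hi hfv
      hfe hfc fun v _ hv _ => hexp v hv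
  refine hamCycle_of_four_bridges rfl (by omega) hnd (fun c h2 h3 h4 h5 => ?_) (hbr s (by simp))
    (hbr t (by simp)) (hbr r (by simp)) (hbr q (by simp))
  have hc : c ∉ ({s, t, r, q} : Finset (SignedSymbol (3 + 1))) := by simp [*]
  exact ⟨Finset.mem_compl.2 hc,
    good_of_hitCount_eq_zero le_rfl hP hF (hitCount_eq_zero.1 (h0 c hc))⟩

/-- Some copy is hit by all the `m - 1` faults, so that it need not have a spanning cycle; but it
has one after any of the faults is restored. -/
theorem hamCycle_of_hits_all (hm : 3 ≤ m) (hP : PathTolerant m) (hC : CycleTolerant m)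
    (hF : Valid (burntPancake (m + 1)) F) (hl : F.length + 1 = m) (hs : ∀ i ∈ F, Hits i s) :
    HamCycle (live F) (deleted F)ᶜ := by
  have hm0 : 0 < m := by omega
  have hnil : F ≠ [] := by
    rintro rfl
    simp at hl
    omega
  -- a copy hit by all the faults has a spanning cycle after one of them is restored
  have hres : ∀ i F' c, (∀ i ∈ F, Hits i c) → F.Perm (i :: F') →
      HamCycle (live F') (region F' {c}) := fun i F' c hc hp =>
    hC.hamCycle hm0 (hF.perm hp).tail (by
      have h1 := hp.length_eq
      have h2 := hitCount_le_length (F := F') (s := c)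
      simp only [List.length_cons] at h1
      omega)
  by_cases hg : ∀ r, r ≠ s → hitCount F r + 3 ≤ m
  · exact hamCycle_of_hits_one hm hF hl.le hnil (fun r hr => hP.good hm0 hF (hg r hr)) hs
      fun i F' => hres i F' s hs
  by_cases hV : ∃ t, t ≠ s ∧ ∀ i ∈ F, Hits i t
  · obtain ⟨t, hts, ht⟩ := hV
    exact hamCycle_of_hits_both hm hF hl.le hnil hts.symm
      (fun r hrs hrt => good_of_hitCount_eq_zero hm hP hF fun i hi =>
        Hits.not_three (hF.1 i hi) (hs i hi) (ht i hi) hts.symm hrs hrt) hs ht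
      (fun i F' => hres i F' s hs) fun i F' => hres i F' t ht
  push Not at hg hV
  -- all but one of the faults hit the copy `t`, which therefore has a spanning cycle
  obtain ⟨t, hts, ht⟩ := hg
  have htl : hitCount F t + 2 ≤ m := by
    have h1 := hitCount_le_length (F := F) (s := t)
    have h2 : hitCount F t ≠ F.length := fun h => by
      obtain ⟨i, hi, h3⟩ := hV t hts
      exact h3 (hitCount_eq_length.1 h i hi)
    omega
  have hsl := hitCount_eq_length.2 hs
  by_cases hg : ∀ r, r ≠ s → r ≠ t → hitCount F r + 3 ≤ m
  · obtain ⟨i, hi, hit⟩ := exists_hits (F := F) (s := t) (by omega)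
    obtain ⟨F', hF'⟩ := exists_perm_cons hi
    obtain ⟨f, hfs, hft, hfv, hfe⟩ := (hs i hi).exists_mate (hF.1 i hi) hit hts.symm
    obtain ⟨g, k, hp, -, -, hg', hk, hgk, hgf, hkf⟩ := exists_path_of_restored hm0 hF hF' hfs
      (fun v hv => by
        have h1 : v ≠ mate f := by
          rintro rfl
          rw [copy_mate, hft] at hv
          exact hts hv
        simp [hfv, h1]) hfe (hres i F' s hs hF')
    rw [mem_region_singleton] at hg' hk
    rw [hft] at hgf hkf
    exact hamCycle_of_two_bad hm hF hl.le (fun r h1 h2 => hP.good hm0 hF (hg r h1 h2)) hts.symm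
      hp hgk (not_mem_exposed_of_hits hm0 hF.1 hs hg'.2 hg'.1)
      (not_mem_exposed_of_hits hm0 hF.1 hs hk.2 hk.1) hgf hkf (hC.hamCycle hm0 hF htl)
  push Not at hg
  -- a third bad copy, which by counting is possible in dimension four only
  obtain ⟨r, hrs, hrt, hr⟩ := hg
  have hsum := sum_hitCount_le hF.1 {s, t, r}
  rw [Finset.sum_insert (by simp [hts.symm, hrs.symm]), Finset.sum_insert (by simp [hrt.symm]),
    Finset.sum_singleton] at hsum
  exact hamCycle_of_two_pairs (by omega) hP hF (by omega) hs hts hrs hrt.symm (by omega) (by omega)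

/-- Every copy has a spanning cycle. -/
theorem hamCycle_of_hitCount_add_two_le (hm : 3 ≤ m) (hP : PathTolerant m) (hC : CycleTolerant m)
    (hF : Valid (burntPancake (m + 1)) F) (hl : F.length + 1 ≤ m)
    (hh : ∀ c, hitCount F c + 2 ≤ m) : HamCycle (live F) (deleted F)ᶜ := by
  have hm0 : 0 < m := by omega
  have hcyc : ∀ c, HamCycle (live F) (region F {c}) := fun c => hC.hamCycle hm0 hF (hh c)
  -- the set of bad copies; they are hit by exactly `m - 2` faults each, so that there are at most
  -- four of them
  obtain ⟨U, hU⟩ : ∃ U : Finset (SignedSymbol (m + 1)), ∀ c, c ∈ U ↔ ¬ hitCount F c + 3 ≤ m :=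
    ⟨Finset.univ.filter fun c => ¬ hitCount F c + 3 ≤ m, by simp⟩
  have hg : ∀ c, c ∉ U → Good F c := fun c hc =>
    hP.good hm0 hF (by rw [hU] at hc; omega)
  have hcount : ∀ c ∈ U, hitCount F c = m - 2 := fun c hc => by
    have h1 := hh c
    rw [hU] at hc
    omega
  have hsum := sum_hitCount_le hF.1 U
  have hsum' := hsum
  rw [Finset.sum_congr rfl hcount, Finset.sum_const, smul_eq_mul] at hsum'
  obtain ⟨k, rfl⟩ : ∃ k, m = k + 3 := ⟨m - 3, by omega⟩
  have hk : U.card * (k + 1) ≤ 2 * (k + 2) := hsum'.trans (by omega)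
  have hU4 : U.card ≤ 4 := by nlinarith
  have hU0 : ∀ c, k = 0 → c ∉ U → hitCount F c = 0 := fun c hk hc => by
    rw [hU] at hc
    omega
  interval_cases hc : U.card
  · -- no bad copy: a spanning path between two mates is closed
    have hg' : ∀ c, Good F c := fun c => hg c (by rw [Finset.card_eq_zero.1 hc]; simp)
    obtain ⟨a, -, -, ha, -⟩ := exists_link hm0 hF (s := (⟨0, by omega⟩, true))
      (t := (⟨1, by omega⟩, true)) (by simp) ∅ (by
        have := length_add_lt (by omega) hl
        rw [Set.ncard_empty]
        omega)
    have h1 := hamPath_region (T := Finset.univ) (x := a) (y := mate a) hm hF hl (fun c _ => hg' c)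
      (by simp) ⟨by simp, not_mem_deleted ha⟩ ⟨by simp, mate_not_mem_deleted ha⟩ (adj_mate a).ne
    rw [region_univ] at h1
    exact hamCycle_of_hamPath hm hl h1 (live_adj_mate ha).symm
  · obtain ⟨s, rfl⟩ := Finset.card_eq_one.1 hc
    simp only [Finset.mem_singleton] at hg
    obtain ⟨-, z, -⟩ := hcyc s
    obtain ⟨a, b, hp, -, -, ha, hb, -, -, hab, -⟩ := (hcyc s).exists_cut_link hm0 ∅
      z (four_mul_lt hm hl (by simp))
    exact hamCycle_of_one_bad hm hF hl hg hp (fun e => hab (by rw [e])) ha hb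
  · obtain ⟨s, t, hst, rfl⟩ := Finset.card_eq_two.1 hc
    simp only [Finset.mem_insert, Finset.mem_singleton, not_or, and_imp] at hg
    obtain ⟨-, z, -⟩ := hcyc s
    obtain ⟨a, b, hp, -, -, ha, hb, hat, hbt, hab, -⟩ := (hcyc s).exists_cut_link hm0 {t}
      z (four_mul_lt hm hl (by simp))
    rw [Finset.mem_singleton] at hat hbt
    exact hamCycle_of_two_bad hm hF hl hg hst hp hab ha hb hat hbt (hcyc t)
  · obtain ⟨s, t, r, hst, hsr, htr, rfl⟩ := Finset.card_eq_three.1 hc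
    -- three bad copies require `m = 3` or `m = 4`
    obtain rfl | rfl : k = 0 ∨ k = 1 := by omega
    · simp only [Finset.mem_insert, Finset.mem_singleton, not_or, and_imp, forall_eq_or_imp,
        forall_eq] at hU0 hcount
      exact hamCycle_of_three_bad_four rfl hP hF (by omega) hst hsr htr hcount.1 hcount.2.1
        hcount.2.2 hcyc fun c => hU0 c trivial
    · -- for `m = 4` each of the three faults has to hit two of the bad copies
      have hexp : ∀ v, v ∉ deleted F → v ∉ exposed F := fun v =>
        not_mem_exposed_of_mates fun i hi => by
          obtain ⟨c, -, c', -, hne, hc, hc'⟩ := exists_two_hits hF.1 hi (U := {s, t, r}) (by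
            rw [Finset.sum_congr rfl hcount, Finset.sum_const, smul_eq_mul, hc]
            omega)
          obtain ⟨f, -, -, h⟩ := hc.exists_mate (hF.1 i hi) hc' hne
          exact ⟨f, h⟩
      simp only [Finset.mem_insert, Finset.mem_singleton, not_or, and_imp] at hg
      -- among three copies there are two that are not bars of each other
      by_cases h1 : s.1 = t.1
      · have h2 : s.1 ≠ r.1 := fun h2 => by
          rcases (fst_eq_iff.1 h1) with h3 | h3
          · exact hst h3
          rcases (fst_eq_iff.1 h2) with h4 | h4
          · exact hsr h4
          exact htr (by rw [← bar_bar t, ← h3, h4, bar_bar])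
        exact hamCycle_of_three_bad le_rfl hF hl (fun c a b d => hg c a d b) h2 hst htr.symm hexp
          (hcyc s) (hcyc r) (hcyc t)
      · exact hamCycle_of_three_bad le_rfl hF hl hg h1 hsr htr hexp (hcyc s) (hcyc t) (hcyc r)
  · -- four bad copies require `m = 3`
    obtain rfl : k = 0 := by omega
    obtain ⟨s, V, hs, rfl, hV⟩ := Finset.card_eq_succ.1 hc
    obtain ⟨t, r, q, htr, htq, hrq, rfl⟩ := Finset.card_eq_three.1 hV
    refine hamCycle_of_four_bad rfl hP hF (by omega) ?_ hcount fun c => hU0 c rfl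
    simp only [Finset.mem_insert, Finset.mem_singleton, not_or] at hs
    simp [*]

/-- The burnt pancake graph keeps a spanning cycle after faults, one dimension up. -/
theorem CycleTolerant.succ (hm : 3 ≤ m) (hP : PathTolerant m) (hC : CycleTolerant m) :
    CycleTolerant (m + 1) := by
  intro F hF hl
  by_cases hh : ∀ c, hitCount F c + 2 ≤ m
  · exact hamCycle_of_hitCount_add_two_le hm hP hC hF (by omega) hh
  push Not at hh
  obtain ⟨s, hs⟩ := hh
  have h1 := hitCount_le_length (F := F) (s := s)
  exact hamCycle_of_hits_all hm hP hC hF (by omega)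
    (hitCount_eq_length.1 (show hitCount F s = _ by omega))

end CycleStep

/-- The two statements are proved together by induction on the dimension. -/
theorem tolerant {n : ℕ} (hn : 3 ≤ n) : PathTolerant n ∧ CycleTolerant n := by
  induction n, hn using Nat.le_induction with
  | base => exact ⟨pathTolerant_three, cycleTolerant_three⟩
  | succ m hm ih => exact ⟨ih.1.succ hm ih.2, .succ hm ih.1 ih.2⟩

/-! ### Hybrid fault sets and tightness -/

open HybridFault

section Conversion

variable {V : Type*} [DecidableEq V] {A : SimpleGraph V} {X : Set V} {x y : V}

theorem HamPath.exists_isHamiltonian (h : HamPath A X x y) :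
    ∃ p : (A.induce X).Walk ⟨x, h.left_mem⟩ ⟨y, h.right_mem⟩, p.IsHamiltonian := by
  obtain ⟨p, hp, hX⟩ := h
  refine ⟨p.induce X fun v hv => (hX v).1 hv, Walk.IsPath.isHamiltonian_of_mem ?_ ?_⟩
  · refine .of_map (f := (Embedding.induce X).toHom) ?_
    rwa [Walk.map_induce]
  · rintro ⟨v, hv⟩
    simpa [Walk.support_induce] using (hX v).2 hv

theorem HamCycle.isHamiltonian [Fintype X] (h : HamCycle A X) : (A.induce X).IsHamiltonian := by
  obtain ⟨h3, a, b, hab, hba⟩ := h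
  obtain ⟨p, hp⟩ := hab.exists_isHamiltonian
  have hadj : (A.induce X).Adj ⟨b, hab.right_mem⟩ ⟨a, hab.left_mem⟩ := hba
  refine fun _ => ⟨_, .cons hadj p, ?_, fun v => by simpa using hp v⟩
  refine (Walk.cons_isCycle_iff p hadj).2 ⟨hp.isPath, fun he => ?_⟩
  have h1 := hp.isPath.length_eq_one_of_mem_edges (by rwa [Sym2.eq_swap])
  have h2 := hp.length_eq
  rw [Set.ncard_eq_toFinset_card', Set.toFinset_card] at h3
  omega

theorem hamPath_univ_of_isHamiltonian {p : A.Walk x y} (hp : p.IsHamiltonian) :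
    HamPath A Set.univ x y := ⟨p, hp.isPath, fun v => by simp [hp.mem_support v]⟩

/-- In a graph with a Hamiltonian cycle, no vertex has a single neighbour. -/
theorem not_isHamiltonian [Fintype V] {u v : V} (hvu : v ≠ u)
    (h : ∀ x y, A.Adj u x → A.Adj u y → x = y) : ¬ A.IsHamiltonian := by
  intro hA
  have : Nontrivial V := ⟨v, u, hvu⟩
  obtain ⟨p, hp⟩ := hA.exists_isHamiltonianCycle u
  have hn := hp.isCycle.not_nil
  exact hp.isCycle.snd_ne_penultimate (h _ _ (p.adj_snd hn) (p.adj_penultimate hn).symm)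

/-- A Hamiltonian path between the only two neighbours of a vertex has no further vertices. -/
theorem not_isHamiltonianConnected {u v x y : V} (hxy : x ≠ y)
    (h : ∀ z, A.Adj u z → z = x ∨ z = y) (hx : A.Adj u x) (hy : A.Adj u y) (hvu : v ≠ u)
    (hvx : v ≠ x) (hvy : v ≠ y) : ¬ IsHamiltonianConnected A := by
  intro hA
  obtain ⟨p, hp⟩ := hA x y hxy
  obtain ⟨g, k, X₁, X₂, e, hd, h1, hg, hk, h2⟩ :=
    (hamPath_univ_of_isHamiltonian hp).remove_vertex (u := u) trivial hx.ne hy.ne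
  have hgx : g = x := (h g hg.symm).resolve_right fun hgy =>
    Set.disjoint_left.1 hd h1.right_mem (hgy ▸ h2.right_mem)
  have hky : k = y := (h k hk).resolve_left fun hkx =>
    Set.disjoint_left.1 hd h1.left_mem (hkx ▸ h2.left_mem)
  subst hgx hky
  have hv : v ∈ (Set.univ : Set V) \ {u} := ⟨trivial, hvu⟩
  rw [e, h1.eq_singleton, h2.eq_singleton] at hv
  exact hv.elim hvx hvy

end Conversion

/-- The list of faults of a hybrid fault set. -/
theorem exists_faults {V : Type*} {G : SimpleGraph V} {Fmv Fe : Finset (Sym2 V)}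
    (h : IsFaultSet G Fmv Fe) :
    ∃ F : List (Fault V), Valid G F ∧ F.length = Fmv.card + Fe.card ∧
      (deleted F)ᶜ = faultFree Fmv ∧ cut F = Fe := by
  have hs : ∀ e : Sym2 V, ∃ a b, e = s(a, b) := fun e => e.ind fun a b => ⟨a, b, rfl⟩
  choose a b hab using hs
  have hpair : ∀ e v, v ∈ (Fault.pair (a e) (b e)).verts ↔ v ∈ e := fun e v => by
    conv_rhs => rw [hab e]
    simp [Fault.verts]
  refine ⟨Fmv.toList.map (fun e => .pair (a e) (b e)) ++ Fe.toList.map fun e => .edge (a e) (b e),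
    ⟨?_, ?_⟩, by simp, ?_, ?_⟩
  · intro i hi
    simp only [List.mem_append, List.mem_map, Finset.mem_toList] at hi
    rcases hi with ⟨e, he, rfl⟩ | ⟨e, -, rfl⟩
    · have := h.matching.1 e he
      rwa [hab e] at this
    · trivial
  · refine List.pairwise_append.2 ⟨?_, ?_, ?_⟩
    · rw [List.pairwise_map]
      refine Fmv.nodup_toList.imp_of_mem fun {e f} he hf hne =>
        Set.disjoint_left.2 fun v hv hv' => ?_
      rw [hpair] at hv hv'
      exact h.matching.2 e (Finset.mem_toList.1 he) f (Finset.mem_toList.1 hf) hne v hv hv'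
    · rw [List.pairwise_map]
      exact List.pairwise_of_forall fun _ _ => by simp [Fault.verts]
    · intro i _ j hj
      obtain ⟨e, -, rfl⟩ := List.mem_map.1 hj
      simp [Fault.verts]
  · ext v
    simp only [deleted, faultFree, Set.mem_compl_iff, Set.mem_ofPred_eq, List.mem_append,
      List.mem_map, Finset.mem_toList, not_exists, not_and]
    constructor
    · exact fun hv e he hve => hv _ (.inl ⟨e, he, rfl⟩) ((hpair e v).2 hve)
    · rintro hv i (⟨e, he, rfl⟩ | ⟨e, -, rfl⟩) hvi
      · exact hv e he ((hpair e v).1 hvi)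
      · exact hvi
  · ext e
    simp only [cut, Set.mem_ofPred_eq, List.mem_append, List.mem_map, Finset.mem_toList,
      Finset.mem_coe]
    constructor
    · rintro ⟨i, ⟨f, -, rfl⟩ | ⟨f, hf, rfl⟩, he⟩
      · exact he.elim
      · rw [Fault.edges, Set.mem_singleton_iff, ← hab f] at he
        exact he ▸ hf
    · exact fun he => ⟨_, .inr ⟨e, he, rfl⟩, by
        rw [Fault.edges, Set.mem_singleton_iff, ← hab e]⟩

variable {n : ℕ}

theorem CycleTolerant.isFaultHamiltonian (hn : 3 ≤ n) (h : CycleTolerant n) :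
    IsFaultHamiltonian (burntPancake n) (n - 2) := by
  intro Fmv Fe hF hc
  obtain ⟨F, hv, hl, hd, hcut⟩ := exists_faults hF
  have h1 := (h F hv (by omega)).congr hd
  rw [live, hcut] at h1
  exact h1.isHamiltonian

theorem PathTolerant.isFaultHamiltonianConnected (hn : 3 ≤ n) (h : PathTolerant n) :
    IsFaultHamiltonianConnected (burntPancake n) (n - 3) := by
  rintro Fmv Fe hF hc ⟨x, hx⟩ ⟨y, hy⟩ hxy
  obtain ⟨F, hv, hl, hd, hcut⟩ := exists_faults hF
  have h1 := (h F hv (by omega) x y (fun e => hxy (Subtype.ext e))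
    (by rwa [← hd] at hx) (by rwa [← hd] at hy)).congr hd
  rw [live, hcut] at h1
  exact h1.exists_isHamiltonian

theorem prefixReversal_left_injective (u : SignedPermutation n) :
    Function.Injective fun k => prefixReversal k u := by
  intro k l h
  have hlt : ∀ {k l : Fin n}, k < l → prefixReversal k u ≠ prefixReversal l u := by
    intro k l hkl h
    have h1 := congrFun (congrArg Subtype.val h) l
    simp only [prefixReversal, prefixReversalWord, le_refl, not_le.2 hkl, if_true, if_false,
      Nat.sub_self] at h1
    have h2 : l = ⟨0, by omega⟩ :=
      u.2 (show (u.1 l).1 = (u.1 ⟨0, by omega⟩).1 by rw [h1]; rfl)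
    rw [h2, Fin.lt_def] at hkl
    exact absurd hkl (Nat.not_lt_zero _)
  rcases lt_trichotomy k l with hkl | hkl | hkl
  · exact absurd h (hlt hkl)
  · exact hkl
  · exact absurd h.symm (hlt hkl)

theorem edge_prefixReversal_injective (u : SignedPermutation n) :
    Function.Injective fun k => s(u, prefixReversal k u) := fun _ _ h =>
  prefixReversal_left_injective u (Sym2.congr_right.1 h)

/-- Removing `c` edges at a vertex `u` leaves `n - c` edges at `u`. -/
theorem exists_remaining (u : SignedPermutation n) (Fe : Finset (Sym2 (SignedPermutation n)))
    (hFe : ∀ e ∈ Fe, e ∈ (burntPancake n).incidenceSet u) :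
    ∃ K : Finset (Fin n), K.card + Fe.card = n ∧
      ∀ w, ((burntPancake n).deleteEdges (Fe : Set (Sym2 (SignedPermutation n)))).Adj u w ↔
        ∃ k ∈ K, w = prefixReversal k u := by
  have hcard : (Finset.univ.filter fun k => s(u, prefixReversal k u) ∈ Fe).card = Fe.card := by
    rw [← Finset.card_image_of_injective _ (edge_prefixReversal_injective u)]
    congr 1
    ext e
    simp only [Finset.mem_image, Finset.mem_filter, Finset.mem_univ, true_and]
    constructor
    · rintro ⟨k, hk, rfl⟩
      exact hk
    · intro he
      obtain ⟨h1, h2⟩ := hFe e he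
      obtain ⟨v, rfl⟩ := Sym2.mem_iff_exists.1 h2
      obtain ⟨k, hk : v = prefixReversal k u⟩ := h1
      exact ⟨k, hk ▸ he, by rw [hk]⟩
  refine ⟨Finset.univ.filter fun k => s(u, prefixReversal k u) ∉ Fe, ?_, fun w => ?_⟩
  · have := Finset.card_filter_add_card_filter_not (s := (Finset.univ : Finset (Fin n)))
      fun k => s(u, prefixReversal k u) ∈ Fe
    rw [Finset.card_univ, Fintype.card_fin] at this
    omega
  · simp only [deleteEdges_adj, Finset.mem_coe, Finset.mem_filter, Finset.mem_univ, true_and]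
    constructor
    · rintro ⟨⟨k, rfl⟩, h⟩
      exact ⟨k, h, rfl⟩
    · rintro ⟨k, h, rfl⟩
      exact ⟨⟨k, rfl⟩, h⟩

theorem mem_faultFree_empty {V : Type*} (v : V) : v ∈ faultFree (∅ : Finset (Sym2 V)) :=
  fun e he => absurd he (Finset.notMem_empty e)

/-- With `n - 1` edges at `u` removed, `u` has a single neighbour. -/
theorem not_isHamiltonian_remove (hn : 3 ≤ n) (u : SignedPermutation n)
    (Fe : Finset (Sym2 (SignedPermutation n)))
    (hFe : ∀ e ∈ Fe, e ∈ (burntPancake n).incidenceSet u) (hc : Fe.card = n - 1) :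
    ¬ (remove (burntPancake n) ∅ Fe).IsHamiltonian := by
  obtain ⟨K, hK, hadj⟩ := exists_remaining u Fe hFe
  obtain ⟨k, rfl⟩ := Finset.card_eq_one.1 (show K.card = 1 by omega)
  simp only [Finset.mem_singleton, exists_eq_left] at hadj
  refine not_isHamiltonian (u := ⟨u, mem_faultFree_empty u⟩)
    (v := ⟨prefixReversal k u, mem_faultFree_empty _⟩)
    (fun e => prefixReversal_ne k u (congrArg Subtype.val e)) fun x y hx hy => Subtype.ext ?_
  rw [(hadj x).1 hx, (hadj y).1 hy]

/-- With `n - 2` edges at `u` removed, `u` has two neighbours, between which no Hamiltonian path can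
pass through `u` and any further vertex. -/
theorem not_isHamiltonianConnected_remove (hn : 3 ≤ n) (u : SignedPermutation n)
    (Fe : Finset (Sym2 (SignedPermutation n)))
    (hFe : ∀ e ∈ Fe, e ∈ (burntPancake n).incidenceSet u) (hc : Fe.card = n - 2) :
    ¬ IsHamiltonianConnected (remove (burntPancake n) ∅ Fe) := by
  obtain ⟨K, hK, hadj⟩ := exists_remaining u Fe hFe
  obtain ⟨k, l, hkl, rfl⟩ := Finset.card_eq_two.1 (show K.card = 2 by omega)
  obtain ⟨j, hj⟩ : ∃ j, j ∉ ({k, l} : Finset (Fin n)) := by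
    by_contra! h
    have := Finset.card_le_card (fun j _ => h j : Finset.univ ⊆ ({k, l} : Finset (Fin n)))
    rw [Finset.card_univ, Fintype.card_fin] at this
    omega
  simp only [Finset.mem_insert, Finset.mem_singleton, not_or, exists_eq_or_imp,
    exists_eq_left] at hadj hj
  have hinj := prefixReversal_left_injective u
  refine not_isHamiltonianConnected (u := ⟨u, mem_faultFree_empty u⟩)
    (v := ⟨prefixReversal j u, mem_faultFree_empty _⟩)
    (x := ⟨prefixReversal k u, mem_faultFree_empty _⟩)
    (y := ⟨prefixReversal l u, mem_faultFree_empty _⟩)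
    (fun e => hkl (hinj (congrArg Subtype.val e)))
    (fun z hz => ((hadj z).1 hz).imp Subtype.ext Subtype.ext) ((hadj _).2 (.inl rfl))
    ((hadj _).2 (.inr rfl)) (fun e => prefixReversal_ne j u (congrArg Subtype.val e))
    (fun e => hj.1 (hinj (congrArg Subtype.val e))) fun e => hj.2 (hinj (congrArg Subtype.val e))

/-- Any number of edges at a vertex, up to its degree, form a hybrid fault set. -/
theorem exists_edges_at {c : ℕ} (hc : c ≤ n) :
    ∃ (u : SignedPermutation n) (Fe : Finset (Sym2 (SignedPermutation n))),
      (∀ e ∈ Fe, e ∈ (burntPancake n).incidenceSet u) ∧ Fe.card = c ∧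
        IsFaultSet (burntPancake n) ∅ Fe := by
  obtain ⟨K, -, hK⟩ := Finset.exists_subset_card_eq (s := (Finset.univ : Finset (Fin n))) (n := c)
    (by simpa using hc)
  let u : SignedPermutation n := ⟨fun i => (i, true), fun _ _ h => h⟩
  have hFe : ∀ e ∈ K.image fun k => s(u, prefixReversal k u),
      e ∈ (burntPancake n).incidenceSet u := by
    intro e he
    obtain ⟨k, -, rfl⟩ := Finset.mem_image.1 he
    exact ⟨⟨k, rfl⟩, Sym2.mem_mk_left _ _⟩
  exact ⟨u, K.image fun k => s(u, prefixReversal k u), hFe,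
    (Finset.card_image_of_injective _ (edge_prefixReversal_injective u)).trans hK,
    ⟨by simp [IsMatchingEdgeSet], fun e he => ⟨(hFe e he).1, fun v _ => mem_faultFree_empty v⟩⟩⟩

end BurntPancake

theorem theorem3 (n : ℕ) (hn : 3 ≤ n) :
    HybridFault.IsFaultHamiltonian (burntPancake n) (n - 2) ∧
    HybridFault.IsFaultHamiltonianConnected (burntPancake n) (n - 3) ∧
    -- both bounds are tight
    ¬ HybridFault.IsFaultHamiltonian (burntPancake n) (n - 1) ∧
    ¬ HybridFault.IsFaultHamiltonianConnected (burntPancake n) (n - 2) ∧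
    -- and edges incident to a single vertex show it
    (∀ (u : SignedPermutation n) (Fe : Finset (Sym2 (SignedPermutation n))),
      (∀ e ∈ Fe, e ∈ (burntPancake n).incidenceSet u) → Fe.card = n - 1 →
      ¬ (HybridFault.remove (burntPancake n) ∅ Fe).IsHamiltonian) ∧
    (∀ (u : SignedPermutation n) (Fe : Finset (Sym2 (SignedPermutation n))),
      (∀ e ∈ Fe, e ∈ (burntPancake n).incidenceSet u) → Fe.card = n - 2 →
      ¬ HybridFault.IsHamiltonianConnected (HybridFault.remove (burntPancake n) ∅ Fe)) := by
  refine ⟨(BurntPancake.tolerant hn).2.isFaultHamiltonian hn,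
    (BurntPancake.tolerant hn).1.isFaultHamiltonianConnected hn, fun h => ?_, fun h => ?_,
    BurntPancake.not_isHamiltonian_remove hn, BurntPancake.not_isHamiltonianConnected_remove hn⟩
  · obtain ⟨u, Fe, hFe, hc, hF⟩ := BurntPancake.exists_edges_at (Nat.sub_le n 1)
    exact BurntPancake.not_isHamiltonian_remove hn u Fe hFe hc (h ∅ Fe hF (by simp [hc]))
  · obtain ⟨u, Fe, hFe, hc, hF⟩ := BurntPancake.exists_edges_at (Nat.sub_le n 2)
    exact BurntPancake.not_isHamiltonianConnected_remove hn u Fe hFe hc (h ∅ Fe hF (by simp [hc]))
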